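/- **Setting (QCD graphs).** Let $R=R_V\cup R_E$, where $R_E$ consists of the three unoriented lines quark, ghost, gluon, and $R_V$ of the four vertices quark–quark–gluon ($qqg$), ghost–ghost–gluon ($ccg$), three-gluon ($3g$) and four-gluon ($4g$). The legs of $r\in R$ are the lines attached to $r$; an edge $e\in R_E$ has two legs of type $e$. A Feynman graph with residue $r\in R$ consists of finite sets of vertices (with types in $R_V$) and edges (with types in $R_E$), each edge having two ends, each end lying at a vertex or being one of $N$ labelled external ends; the lines meeting at a vertex are those prescribed by its type, and the external ends are labelled by the legs of $r$, compatibly with types. Edges with an external end are called external, the others internal. A graph is 1PI if it is connected, is not a tree and is not disconnected by removing any one internal edge. Isomorphisms preserve all types and fix the external labels; $\mathrm{Sym}(\Gamma)$ is the order of the automorphism group of $\Gamma$, where automorphisms act on vertices, edges and ends of edges (so that for an edge with both ends at the same vertex the exchange of its two ends is counted). The loop number is $L(\Gamma)=\#\{\text{internal edges}\}-\#\{\text{vertices}\}+1$. **Hopf algebra.** Let $k$ be a field of characteristic $0$ and $H$ the free commutative $k$-algebra on the isomorphism classes of 1PI graphs with residue in $R$. The coproduct and the counit are the algebra maps, and the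 antipode is the algebra map determined recursively, with $$\Delta(\Gamma)=\Gamma\otimes 1+1\otimes\Gamma+\sum_{\emptyset\ne\gamma\subsetneq\Gamma}\gamma\otimes\Gamma/\gamma,\qquad \epsilon(\Gamma)=0,\qquad S(\Gamma)=-\Gamma-\sum_{\emptyset\neq\gamma\subsetneq\Gamma}S(\gamma)\,\Gamma/\gamma$$ for every 1PI graph $\Gamma$ with residue in $R$. Here $\gamma$ runs over the subgraphs that are disjoint unions of 1PI graphs with residues in $R$ (each component being given by its set of internal edges). The subgraph $\gamma$ stands for the product of its components; each component stands for the average of the generators obtained from all type-compatible labellings of its external lines. In $\Gamma/\gamma$ each component whose residue is a vertex is shrunk to that vertex, and each component whose residue is an edge is replaced by that edge, its two external lines being merged into one line. **Green's functions.** For $r\in R$ and $L\ge 1$ put $\Sigma^r_L=\sum_{\Gamma}\Gamma/\mathrm{Sym}(\Gamma)\in H$, the finite sum being over all isomorphism classes of 1PI graphs with residue $r$ and loop number $L$. In $H[[t]]$, with $t$ counting loops, let $$G^v=1+\sum_{L\ge1}\Sigma^v_L t^L\quad(v\in R_V),\qquad G^e=1-\sum_{L\ge1}\Sigma^e_L t^L\quad(e\in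 R_E),$$ and define the Slavnov–Taylor elements $$\mathrm{ST}^{\rm I}=G^{3g}G^{qqg}-G^{4g}G^{\rm quark},\qquad \mathrm{ST}^{\rm II}=G^{3g}G^{ccg}-G^{4g}G^{\rm ghost},\qquad \mathrm{ST}^{\rm III}=G^{3g}G^{3g}-G^{4g}G^{\rm gluon}.$$ **Theorem.** Let $I\subseteq H$ be the ideal generated by the Slavnov–Taylor elements, that is, by the coefficients of $t^L$ in $\mathrm{ST}^{\rm I},\mathrm{ST}^{\rm II},\mathrm{ST}^{\rm III}$ for all $L\ge0$. Then $I$ is a Hopf ideal: $$\Delta(I)\subseteq I\otimes H+H\otimes I,\qquad \epsilon(I)=0,\qquad S(I)\subseteq I .$$ -/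

import Mathlib

/-! # The Connes–Kreimer Hopf algebra of QCD Feynman graphs -/

namespace QCD

/-- The three lines (edges) of QCD: quark (plain), ghost (dotted), gluon (curly). -/
inductive Line
  | quark
  | ghost
  | gluon
  deriving DecidableEq

instance : Fintype Line := ⟨{.quark, .ghost, .gluon}, fun t => by cases t <;> decide⟩

/-- The four interaction vertices of QCD. -/
inductive Vertex
  | quarkGluon
  | ghostGluon
  | gluon3
  | gluon4
  deriving DecidableEq

instance : Fintype Vertex :=
  ⟨{.quarkGluon, .ghostGluon, .gluon3, .gluon4}, fun v => by cases v <;> decide⟩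

/-- The lines attached to a vertex. -/
def Vertex.legs : Vertex → List Line
  | .quarkGluon => [.quark, .quark, .gluon]
  | .ghostGluon => [.ghost, .ghost, .gluon]
  | .gluon3 => [.gluon, .gluon, .gluon]
  | .gluon4 => [.gluon, .gluon, .gluon, .gluon]

/-- The set `R = R_V ∪ R_E` of vertices and edges of QCD. -/
abbrev Res := Vertex ⊕ Line

/-- The lines attached to an element of `R`; an edge of type `e` has two external lines of type `e`. -/
def Res.legs (r : Res) : List Line :=
  Sum.elim Vertex.legs (fun e => [e, e]) r

lemma Res.legs_length_pos (r : Res) : 0 < r.legs.length := by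
  rcases r with (_ | _ | _ | _) | _ <;> simp [Res.legs, Vertex.legs]

/-- A QCD Feynman graph with external lines labelled `0, …, N - 1`, of the types prescribed by
the legs of `r ∈ R`.  Here `V` is the set of vertices, `E` the set of all (internal and external)
edges, and `D` the set of those ends of edges that lie at a vertex.  The remaining ends are the
external ends: `ext k` is the edge that carries the `k`-th external end. -/
structure FeynmanGraph (r : Res) where
  V : Type
  E : Type
  D : Type
  [finV : Finite V]
  [finE : Finite E]
  [finD : Finite D]
  vtype : V → Vertex
  etype : E → Line
  vert : D → V
  edge : D → E
  ext : Fin r.legs.length → E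
  /-- every edge has exactly two ends -/
  edge_ends : ∀ e, Nat.card {d // edge d = e} + Nat.card {k // ext k = e} = 2
  /-- the lines meeting at a vertex are those prescribed by the type of the vertex -/
  vertex_legs : ∀ v t, Nat.card {d // vert d = v ∧ etype (edge d) = t} = (vtype v).legs.count t
  /-- the external lines have the types prescribed by `r` -/
  ext_type : ∀ k, etype (ext k) = r.legs.get k

namespace FeynmanGraph

attribute [instance] finV finE finD

variable {r : Res} (Γ : FeynmanGraph r)

/-- The internal edges. -/
def internal : Set Γ.E := {e | e ∉ Set.range Γ.ext}

/-- Two vertices are joined by an edge from `S`. -/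
def Adj (S : Set Γ.E) (v w : Γ.V) : Prop :=
  ∃ d d', Γ.edge d = Γ.edge d' ∧ Γ.edge d ∈ S ∧ Γ.vert d = v ∧ Γ.vert d' = w

/-- Two vertices are joined by a path of edges from `S`. -/
def Linked (S : Set Γ.E) : Γ.V → Γ.V → Prop := Relation.ReflTransGen (Γ.Adj S)

/-- One-particle irreducible graphs: the graph is connected, and stays so after removal of any
single internal edge; it is not a tree (for a connected graph without bridges this means that there
is at least one internal edge). -/
structure IsOnePI : Prop where
  exists_internal : Γ.internal.Nonempty
  incident : ∀ e, ∃ d, Γ.edge d = e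
  linked : ∀ e ∈ Γ.internal, ∀ v w, Γ.Linked (Γ.internal \ {e}) v w

/-! ### Subgraphs -/

/-- The vertices touched by a set of edges. -/
def verts (c : Set Γ.E) : Set Γ.V := {v | ∃ d, Γ.vert d = v ∧ Γ.edge d ∈ c}

/-- The external lines of the subgraph with set of internal edges `c`: the ends of edges
that lie at a vertex of the subgraph, the edge not belonging to `c`.  (An edge outside `c` with both
ends at vertices of the subgraph gives two external lines.) -/
def extDarts (c : Set Γ.E) : Set Γ.D := {d | Γ.vert d ∈ Γ.verts c ∧ Γ.edge d ∉ c}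

/-- A residue in `R` of the subgraph `c`, with a labelling of its external lines
compatible with the types of lines. -/
structure Labeling (c : Set Γ.E) where
  res : Res
  equiv : Fin res.legs.length ≃ Γ.extDarts c
  type_eq : ∀ k, Γ.etype (Γ.edge (equiv k)) = res.legs.get k

/-- `c` is the set of internal edges of a (connected) 1PI subgraph of `Γ` with residue in `R`. -/
structure IsSub (c : Set Γ.E) : Prop where
  subset : c ⊆ Γ.internal
  nonempty : c.Nonempty
  linked : ∀ e ∈ c, ∀ v ∈ Γ.verts c, ∀ w ∈ Γ.verts c, Γ.Linked (c \ {e}) v w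
  labeling : Nonempty (Γ.Labeling c)

variable {Γ}

lemma linked_mem_of_closed {S : Set Γ.E} {W : Set Γ.V}
    (hW : ∀ d d', Γ.edge d = Γ.edge d' → Γ.edge d ∈ S → Γ.vert d ∈ W → Γ.vert d' ∈ W)
    {v w : Γ.V} (h : Γ.Linked S v w) (hv : v ∈ W) : w ∈ W := by
  induction h with
  | refl => exact hv
  | tail _ hab ih =>
    obtain ⟨d, d', h1, h2, h3, h4⟩ := hab
    subst h3; subst h4
    exact hW d d' h1 h2 ih

lemma card_darts_of_internal {e : Γ.E} (he : e ∈ Γ.internal) :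
    Nat.card {d // Γ.edge d = e} = 2 := by
  have h := Γ.edge_ends e
  have : IsEmpty {k // Γ.ext k = e} := ⟨fun k => he ⟨k.1, k.2⟩⟩
  simpa using h

/-- the subgraph as a Feynman graph in its own right -/
noncomputable def sub {c : Set Γ.E} (hc : Γ.IsSub c) (ℓ : Γ.Labeling c) : FeynmanGraph ℓ.res where
  V := Γ.verts c
  E := c ⊕ Γ.extDarts c
  D := {d // Γ.vert d ∈ Γ.verts c}
  vtype v := Γ.vtype v
  etype := Sum.elim (fun e : c => Γ.etype e) (fun d : Γ.extDarts c => Γ.etype (Γ.edge d))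
  vert d := ⟨Γ.vert d, d.2⟩
  edge d := open Classical in
    if h : Γ.edge d ∈ c then .inl ⟨Γ.edge d, h⟩ else .inr ⟨d, d.2, h⟩
  ext k := .inr (ℓ.equiv k)
  edge_ends e := by
    classical
    rcases e with e | d
    · have : IsEmpty {k // (Sum.inr (ℓ.equiv k) : c ⊕ Γ.extDarts c) = .inl e} := ⟨fun k => by simpa using k.2⟩
      rw [Nat.card_of_isEmpty (α := {k // (Sum.inr (ℓ.equiv k) : c ⊕ Γ.extDarts c) = .inl e}), add_zero, ← card_darts_of_internal (hc.subset e.2)]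
      refine Nat.card_congr ⟨fun d => ⟨d.1.1, ?_⟩, fun d => ⟨⟨d.1, ⟨d.1, rfl, ?_⟩⟩, ?_⟩, fun _ => rfl, fun _ => rfl⟩
      · have := d.2
        split_ifs at this with h
        exact congrArg Subtype.val (Sum.inl.inj this)
      · rw [d.2]; exact e.2
      · have : Γ.edge d.1 ∈ c := by rw [d.2]; exact e.2
        simp only [this, dite_true]
        congr 1; exact Subtype.ext d.2
    · have h1 : Nat.card {k // (Sum.inr (ℓ.equiv k) : c ⊕ Γ.extDarts c) = .inr d} = 1 := by
        rw [Nat.card_eq_one_iff_unique]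
        refine ⟨⟨fun a b => Subtype.ext (ℓ.equiv.injective ?_)⟩, ⟨ℓ.equiv.symm d, by simp⟩⟩
        exact (Sum.inr.inj a.2).trans (Sum.inr.inj b.2).symm
      rw [h1]
      have : Nat.card {d' : {d // Γ.vert d ∈ Γ.verts c} // (if h : Γ.edge d' ∈ c then Sum.inl ⟨Γ.edge d', h⟩ else Sum.inr ⟨d', d'.2, h⟩ : c ⊕ Γ.extDarts c) = .inr d} = 1 := by
        rw [Nat.card_eq_one_iff_unique]
        refine ⟨⟨fun a b => ?_⟩, ⟨⟨d.1, d.2.1⟩, by simp [d.2.2]⟩⟩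
        have ha := a.2
        have hb := b.2
        split_ifs at ha with h
        split_ifs at hb with h'
        exact Subtype.ext (Subtype.ext ((congrArg Subtype.val (Sum.inr.inj ha)).trans (congrArg Subtype.val (Sum.inr.inj hb)).symm))
      rw [this]
  vertex_legs v t := by
    classical
    rw [← Γ.vertex_legs v t]
    refine Nat.card_congr ⟨fun d => ⟨d.1.1, congrArg Subtype.val d.2.1, ?_⟩, fun d => ⟨⟨d.1, by rw [d.2.1]; exact v.2⟩, Subtype.ext d.2.1, ?_⟩, fun _ => rfl, fun _ => rfl⟩
    · have := d.2.2
      split_ifs at this with h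
      · exact this
      · exact this
    · refine Eq.trans ?_ d.2.2
      dsimp only
      split_ifs <;> rfl
  ext_type k := ℓ.type_eq k

lemma sub_isOnePI {c : Set Γ.E} (hc : Γ.IsSub c) (ℓ : Γ.Labeling c) : (sub hc ℓ).IsOnePI := by
  classical
  have hint : ∀ e : c ⊕ Γ.extDarts c, e ∈ (sub hc ℓ).internal ↔ ∃ e', e = .inl e' := by
    rintro (e | d)
    · exact ⟨fun _ => ⟨e, rfl⟩, fun _ => by rintro ⟨k, hk⟩; cases hk⟩
    · refine ⟨fun h => (h ⟨ℓ.equiv.symm d, ?_⟩).elim, fun ⟨e', he'⟩ => by cases he'⟩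
      change Sum.inr (ℓ.equiv _) = _
      rw [Equiv.apply_symm_apply]
  have hedge : ∀ (d : Γ.D) (hd : Γ.vert d ∈ Γ.verts c) (h : Γ.edge d ∈ c),
      (sub hc ℓ).edge ⟨d, hd⟩ = Sum.inl ⟨Γ.edge d, h⟩ := fun d hd h => dif_pos h
  refine ⟨?_, ?_, ?_⟩
  · obtain ⟨e, he⟩ := hc.nonempty
    exact ⟨.inl ⟨e, he⟩, (hint _).2 ⟨_, rfl⟩⟩
  · rintro (e | d)
    · have h2 := card_darts_of_internal (hc.subset e.2)
      have : Nonempty {d // Γ.edge d = e} := (Nat.card_pos_iff.1 (by omega)).1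
      obtain ⟨d, hd⟩ := this
      have hdc : Γ.edge d ∈ c := by rw [hd]; exact e.2
      refine ⟨⟨d, d, rfl, hdc⟩, (hedge d _ hdc).trans ?_⟩
      congr 1
      exact Subtype.ext hd
    · exact ⟨⟨d.1, d.2.1⟩, dif_neg d.2.2⟩
  · intro e he v w
    obtain ⟨e, rfl⟩ := (hint e).1 he
    have key : ∀ x, Γ.Linked (c \ {e.1}) v.1 x → ∃ hx : x ∈ Γ.verts c,
        (sub hc ℓ).Linked ((sub hc ℓ).internal \ {.inl e}) v ⟨x, hx⟩ := by
      intro x hx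
      induction hx with
      | refl => exact ⟨v.2, .refl⟩
      | tail _ hab ih =>
        obtain ⟨hb, hl⟩ := ih
        obtain ⟨d, d', h1, h2, rfl, rfl⟩ := hab
        have h2' : Γ.edge d' ∈ c := h1 ▸ h2.1
        refine ⟨⟨d', rfl, h2'⟩, hl.tail ⟨⟨d, hb⟩, ⟨d', d', rfl, h2'⟩, ?_, ⟨?_, ?_⟩, rfl, rfl⟩⟩
        · refine (hedge d hb h2.1).trans (Eq.trans ?_ (hedge d' _ h2').symm)
          congr 1
          exact Subtype.ext h1
        · rw [hedge d hb h2.1]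
          exact (hint _).2 ⟨_, rfl⟩
        · rw [hedge d hb h2.1]
          intro h
          exact h2.2 (congrArg Subtype.val (Sum.inl.inj h))
    exact (key w.1 (hc.linked e.1 e.2 v.1 v.2 w.1 w.2)).2

/-! ### Disjoint unions of 1PI subgraphs and contraction -/

variable (Γ) in
/-- A nonempty proper subgraph `γ ⊊ Γ` that is a disjoint union of 1PI graphs with residues in `R`,
given by the set of (sets of internal edges of) its connected components. -/
structure ProperSubgraph where
  comps : Set (Set Γ.E)
  isSub : ∀ c ∈ comps, Γ.IsSub c
  disjoint : comps.PairwiseDisjoint Γ.verts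
  nonempty : comps.Nonempty
  proper : Γ.internal ∉ comps

namespace ProperSubgraph

variable (γ : Γ.ProperSubgraph)

/-- A labelling of the external lines of a component. -/
noncomputable def label (c : γ.comps) : Γ.Labeling c.1 := (γ.isSub c c.2).labeling.some

/-- The residue of a component (it is determined by the types of the external lines). -/
noncomputable def residue (c : γ.comps) : Res := (γ.label c).res

/-- Vertices that belong to a component whose residue is an edge. -/
def lineVerts : Set Γ.V := {v | ∃ c : γ.comps, (γ.residue c).isRight ∧ v ∈ Γ.verts c.1}

/-- Edges of `Γ` that are not internal edges of `γ`. -/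
abbrev Rest := {e : Γ.E // ∀ c : γ.comps, e ∉ c.1}

/-- Two edges outside `γ` are the two external lines of one component whose residue is an edge;
these are merged in `Γ / γ`. -/
def Chain (e e' : γ.Rest) : Prop :=
  ∃ c : γ.comps, (γ.residue c).isRight ∧
    ∃ d ∈ Γ.extDarts c.1, ∃ d' ∈ Γ.extDarts c.1, Γ.edge d = e.1 ∧ Γ.edge d' = e'.1

/-- The vertices of `Γ / γ`: those of `Γ` outside `γ`, and one for every component of `γ` whose
residue is a vertex. -/
abbrev NewV := {v : Γ.V // ∀ c : γ.comps, v ∉ Γ.verts c.1} ⊕ {c : γ.comps // (γ.residue c).isLeft}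

/-- The edges of `Γ / γ`. -/
abbrev NewE := Quot γ.Chain

/-- The ends of edges at the vertices of `Γ / γ`. -/
abbrev NewD := {d : Γ.D // (∀ c : γ.comps, Γ.edge d ∉ c.1) ∧ Γ.vert d ∉ γ.lineVerts}

open Classical in
/-- The image in `Γ / γ` of a vertex of `Γ`. -/
noncomputable def node (v : Γ.V) (hv : v ∉ γ.lineVerts) : γ.NewV :=
  if h : ∃ c : γ.comps, v ∈ Γ.verts c.1 then
    .inr ⟨h.choose, by
      rw [← Sum.not_isRight]
      exact fun hr => hv ⟨h.choose, hr, h.choose_spec⟩⟩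
  else .inl ⟨v, fun c hc => h ⟨c, hc⟩⟩

variable {γ}

lemma comp_unique {c c' : γ.comps} {v : Γ.V} (h : v ∈ Γ.verts c.1) (h' : v ∈ Γ.verts c'.1) :
    c = c' := by
  by_contra hne
  exact Set.disjoint_left.1 (γ.disjoint c.2 c'.2 (fun h => hne (Subtype.ext h))) h h'

lemma node_of_mem {v : Γ.V} (hv : v ∉ γ.lineVerts) {c : γ.comps} (hc : v ∈ Γ.verts c.1) :
    ∃ h, γ.node v hv = .inr ⟨c, h⟩ := by
  have h : ∃ c : γ.comps, v ∈ Γ.verts c.1 := ⟨c, hc⟩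
  obtain rfl := comp_unique h.choose_spec hc
  exact ⟨_, dif_pos h⟩

lemma node_of_notMem {v : Γ.V} (hv : v ∉ γ.lineVerts) (h : ∀ c : γ.comps, v ∉ Γ.verts c.1) :
    γ.node v hv = .inl ⟨v, h⟩ := dif_neg (fun ⟨c, hc⟩ => h c hc)

lemma node_eq_inl {v : Γ.V} (hv : v ∉ γ.lineVerts) {w} (h : γ.node v hv = .inl w) : v = w.1 := by
  by_cases hc : ∃ c : γ.comps, v ∈ Γ.verts c.1
  · obtain ⟨c, hc⟩ := hc
    obtain ⟨_, h'⟩ := node_of_mem hv hc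
    rw [h'] at h; cases h
  · push Not at hc
    rw [node_of_notMem hv hc] at h
    cases h; rfl

lemma node_eq_inr {v : Γ.V} (hv : v ∉ γ.lineVerts) {c} (h : γ.node v hv = .inr c) :
    v ∈ Γ.verts c.1.1 := by
  by_cases hc : ∃ c : γ.comps, v ∈ Γ.verts c.1
  · obtain ⟨c, hc⟩ := hc
    obtain ⟨_, h'⟩ := node_of_mem hv hc
    rw [h'] at h; cases h; exact hc
  · push Not at hc
    rw [node_of_notMem hv hc] at h
    cases h

lemma not_mem_of_vert {d : Γ.D} (h : ∀ c : γ.comps, Γ.vert d ∉ Γ.verts c.1) (c : γ.comps) :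
    Γ.edge d ∉ c.1 := fun hc => h c ⟨d, rfl, hc⟩

lemma not_mem_of_extDart {c : γ.comps} {d : Γ.D} (h : d ∈ Γ.extDarts c.1) (c' : γ.comps) :
    Γ.edge d ∉ c'.1 := fun hc => h.2 (by
      obtain rfl := comp_unique h.1 (⟨d, rfl, hc⟩ : Γ.vert d ∈ Γ.verts c'.1)
      exact hc)

lemma line_extDarts {c : γ.comps} (hc : (γ.residue c).isRight) :
    ∃ d₁ ∈ Γ.extDarts c.1, ∃ d₂ ∈ Γ.extDarts c.1, d₁ ≠ d₂ ∧
      (∀ d ∈ Γ.extDarts c.1, d = d₁ ∨ d = d₂) ∧ Γ.etype (Γ.edge d₁) = Γ.etype (Γ.edge d₂) := by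
  unfold residue at hc
  generalize γ.label c = ℓ at hc
  obtain ⟨res, φ, ht⟩ := ℓ
  rcases res with v | t
  · simp at hc
  · have ht0 := ht (0 : Fin 2)
    have ht1 := ht (1 : Fin 2)
    refine ⟨φ (0 : Fin 2), (φ _).2, φ (1 : Fin 2), (φ _).2, ?_, ?_, ht0.trans ht1.symm⟩
    · intro h
      have := φ.injective (Subtype.ext h)
      exact absurd this (by decide : (0 : Fin 2) ≠ 1)
    · intro d hd
      obtain ⟨k, hk⟩ := φ.surjective ⟨d, hd⟩
      have : ∀ k : Fin 2, k = 0 ∨ k = 1 := by decide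
      rcases this k with rfl | rfl
      · exact .inl (congrArg Subtype.val hk).symm
      · exact .inr (congrArg Subtype.val hk).symm

lemma Chain.etype_eq {e e' : γ.Rest} (h : γ.Chain e e') : Γ.etype e.1 = Γ.etype e'.1 := by
  obtain ⟨c, hc, d, hd, d', hd', h1, h2⟩ := h
  obtain ⟨d₁, -, d₂, -, -, hall, ht⟩ := line_extDarts hc
  rw [← h1, ← h2]
  rcases hall d hd with rfl | rfl <;> rcases hall d' hd' with rfl | rfl <;> simp [ht]

lemma Chain.symm {e e' : γ.Rest} (h : γ.Chain e e') : γ.Chain e' e := by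
  obtain ⟨c, hc, d, hd, d', hd', h1, h2⟩ := h
  exact ⟨c, hc, d', hd', d, hd, h2, h1⟩

end ProperSubgraph

lemma IsOnePI.eq_univ (h : Γ.IsOnePI) {W : Set Γ.V} (hne : W.Nonempty)
    (hW : ∀ d d', Γ.edge d = Γ.edge d' → Γ.edge d ∈ Γ.internal → Γ.vert d ∈ W → Γ.vert d' ∈ W)
    (v : Γ.V) : v ∈ W := by
  obtain ⟨e, he⟩ := h.exists_internal
  obtain ⟨w, hw⟩ := hne
  exact linked_mem_of_closed (fun d d' h1 h2 => hW d d' h1 h2.1) (h.linked e he w v) hw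

lemma exists_dart_ne {d : Γ.D} (h : Γ.edge d ∈ Γ.internal) : ∃ d', d' ≠ d ∧ Γ.edge d' = Γ.edge d := by
  have h2 := card_darts_of_internal h
  by_contra! hcon
  have : Nat.card {d' // Γ.edge d' = Γ.edge d} ≤ 1 := by
    rw [Finite.card_le_one_iff_subsingleton]
    refine ⟨fun a b => Subtype.ext ?_⟩
    have ha : a.1 = d := by by_contra hne; exact hcon a hne a.2
    have hb : b.1 = d := by by_contra hne; exact hcon b hne b.2
    rw [ha, hb]
  omega

lemma ext_unique {k : Fin r.legs.length} {d : Γ.D} (h : Γ.ext k = Γ.edge d) (k' : Fin r.legs.length)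
    (h' : Γ.ext k' = Γ.ext k) : k' = k := by
  have h2 := Γ.edge_ends (Γ.ext k)
  have : Nonempty {d' // Γ.edge d' = Γ.ext k} := ⟨d, h.symm⟩
  have h3 := Nat.card_pos (α := {d' // Γ.edge d' = Γ.ext k})
  have h4 : Nat.card {k' // Γ.ext k' = Γ.ext k} ≤ 1 := by omega
  rw [Finite.card_le_one_iff_subsingleton] at h4
  exact congrArg Subtype.val (Subsingleton.elim (⟨k', h'⟩ : {k' // Γ.ext k' = Γ.ext k}) ⟨k, rfl⟩)

namespace ProperSubgraph

variable {γ : Γ.ProperSubgraph}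

lemma exists_internal_rest (h : Γ.IsOnePI) (γ : Γ.ProperSubgraph) :
    ∃ e ∈ Γ.internal, ∀ c : γ.comps, e ∉ c.1 := by
  by_contra! hcon
  obtain ⟨c, hc⟩ := γ.nonempty
  have hs := γ.isSub c hc
  have huniv : ∀ v, v ∈ Γ.verts c := by
    obtain ⟨e, he⟩ := hs.nonempty
    obtain ⟨d, hd⟩ := h.incident e
    refine h.eq_univ ⟨Γ.vert d, d, rfl, hd ▸ he⟩ ?_
    rintro d d' h1 h2 h3
    obtain ⟨c', hc'⟩ := hcon _ h2
    obtain rfl := comp_unique (γ := γ) (c := ⟨c, hc⟩) (c' := c') h3 ⟨d, rfl, hc'⟩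
    exact ⟨d', rfl, h1 ▸ hc'⟩
  apply γ.proper
  convert hc
  refine Set.Subset.antisymm (fun e he => ?_) hs.subset
  obtain ⟨c', hc'⟩ := hcon e he
  obtain ⟨d, rfl⟩ := h.incident e
  obtain rfl := comp_unique (γ := γ) (c := ⟨c, hc⟩) (c' := c') (huniv (Γ.vert d)) ⟨d, rfl, hc'⟩
  exact hc'

/-- an external line of `Γ` is not adjacent to a component whose residue is an edge -/
lemma Chain.eq_of_ext (h : Γ.IsOnePI) {e e' : γ.Rest} (hch : γ.Chain e e') (he : e.1 ∉ Γ.internal) :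
    e' = e := by
  obtain ⟨c, hc, d, hd, d', hd', h1, h2⟩ := hch
  by_cases hdd : d' = d
  · subst hdd; exact Subtype.ext (h2.symm.trans h1)
  exfalso
  obtain ⟨d₁, hd₁, d₂, hd₂, hne, hall, -⟩ := line_extDarts hc
  have hall' : ∀ x ∈ Γ.extDarts c.1, x = d ∨ x = d' := by
    intro x hx
    rcases hall x hx with rfl | rfl <;> rcases hall d hd with rfl | rfl <;>
      rcases hall d' hd' with rfl | rfl <;> simp_all
  have hsub := γ.isSub c.1 c.2
  -- every internal edge other than `e'` at a vertex of `c` lies in `c`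
  have hclosed : ∀ x x', Γ.edge x = Γ.edge x' → Γ.edge x ∈ Γ.internal \ {e'.1} →
      Γ.vert x ∈ Γ.verts c.1 → Γ.vert x' ∈ Γ.verts c.1 := by
    intro x x' hx1 hx2 hx3
    by_cases hxc : Γ.edge x ∈ c.1
    · exact ⟨x', rfl, hx1 ▸ hxc⟩
    · rcases hall' x ⟨hx3, hxc⟩ with rfl | rfl
      · exact (he (h1 ▸ hx2.1)).elim
      · exact (hx2.2 h2).elim
  have hcne : ∃ v, v ∈ Γ.verts c.1 := ⟨_, hd.1⟩
  by_cases hint : e'.1 ∈ Γ.internal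
  · obtain ⟨x, hx1, hx2⟩ := exists_dart_ne (d := d') (h2 ▸ hint)
    have hxv : Γ.vert x ∈ Γ.verts c.1 :=
      linked_mem_of_closed hclosed (h.linked e'.1 hint (Γ.vert d) (Γ.vert x)) hd.1
    rcases hall' x ⟨hxv, fun hh => e'.2 c (by rw [← h2, ← hx2]; exact hh)⟩ with rfl | rfl
    · exact he (by rw [← h1, hx2, h2]; exact hint)
    · exact hx1 rfl
  · have huniv : ∀ v, v ∈ Γ.verts c.1 := h.eq_univ hcne (fun x x' hx1 hx2 hx3 =>
      hclosed x x' hx1 ⟨hx2, fun hh => hint (hh ▸ hx2)⟩ hx3)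
    obtain ⟨e₀, he₀, hrest⟩ := exists_internal_rest h γ
    obtain ⟨x, rfl⟩ := h.incident e₀
    rcases hall' x ⟨huniv _, hrest c⟩ with rfl | rfl
    · exact he (h1 ▸ he₀)
    · exact hint (h2 ▸ he₀)

lemma eq_of_mk_eq_of_ext (h : Γ.IsOnePI) {e e' : γ.Rest} (he : e.1 ∉ Γ.internal)
    (heq : Quot.mk γ.Chain e = Quot.mk γ.Chain e') : e = e' := by
  classical
  let f : γ.Rest → Option γ.Rest := fun x => if x.1 ∈ Γ.internal then none else some x
  have hf : ∀ x y, γ.Chain x y → f x = f y := by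
    intro x y hxy
    by_cases hx : x.1 ∈ Γ.internal
    · by_cases hy : y.1 ∈ Γ.internal
      · simp [f, hx, hy]
      · have := hxy.symm.eq_of_ext h hy; rw [this]
    · have := hxy.eq_of_ext h hx; rw [this]
  have h1 : f e = f e' := congrArg (Quot.lift f hf) heq
  have h2 : f e = some e := if_neg he
  rw [h2] at h1
  by_cases hy : e'.1 ∈ Γ.internal
  · simp [f, hy] at h1
  · simp [f, hy] at h1; exact h1

end ProperSubgraph

namespace ProperSubgraph

variable (γ : Γ.ProperSubgraph)

/-- The edges of `Γ` outside `γ` in a class of merged edges. -/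
def members (q : γ.NewE) : Set Γ.E := {e | ∃ h : ∀ c : γ.comps, e ∉ c.1, Quot.mk γ.Chain ⟨e, h⟩ = q}

/-- The components (whose residue is an edge) inserted in a class of merged edges. -/
def links (q : γ.NewE) : Set γ.comps :=
  {c | (γ.residue c).isRight ∧ ∃ d ∈ Γ.extDarts c.1, Γ.edge d ∈ γ.members q}

variable {γ}

lemma mem_members_of_links {q : γ.NewE} {c : γ.comps} (hc : c ∈ γ.links q) {d : Γ.D}
    (hd : d ∈ Γ.extDarts c.1) : Γ.edge d ∈ γ.members q := by
  obtain ⟨hr, d', hd', h, hq⟩ := hc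
  exact ⟨not_mem_of_extDart hd, (Quot.sound ⟨c, hr, d, hd, d', hd', rfl, rfl⟩).trans hq⟩

lemma card_members_le (q : γ.NewE) : Nat.card (γ.members q) ≤ Nat.card (γ.links q) + 1 := by
  classical
  let G : SimpleGraph (γ.members q) := SimpleGraph.fromRel (fun a b =>
    ∃ c : γ.comps, (γ.residue c).isRight ∧
    ∃ d ∈ Γ.extDarts c.1, ∃ d' ∈ Γ.extDarts c.1, Γ.edge d = a.1 ∧ Γ.edge d' = b.1)
  have hG : ∀ a b : γ.Rest, Relation.EqvGen γ.Chain a b → ∀ (ha : a.1 ∈ γ.members q)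
      (hb : b.1 ∈ γ.members q), G.Reachable ⟨a.1, ha⟩ ⟨b.1, hb⟩ := by
    intro a b hab
    induction hab with
    | rel a b hab =>
      intro ha hb
      by_cases h : (⟨a.1, ha⟩ : γ.members q) = ⟨b.1, hb⟩
      · rw [h]
      · exact SimpleGraph.Adj.reachable ((SimpleGraph.fromRel_adj _ _ _).2 ⟨h, .inl hab⟩)
    | refl a => intro ha hb; rfl
    | symm a b _ ih => intro ha hb; exact (ih hb ha).symm
    | trans a b c hab _ ih1 ih2 =>
      intro ha hc
      have hb : b.1 ∈ γ.members q := ⟨b.2, (Quot.eqvGen_sound hab).symm.trans ha.2⟩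
      exact (ih1 ha hb).trans (ih2 hb hc)
  have hconn : G.Connected := by
    obtain ⟨e, rfl⟩ := Quot.exists_rep q
    have : Nonempty (γ.members (Quot.mk γ.Chain e)) := ⟨e.1, e.2, rfl⟩
    refine ⟨fun a b => ?_⟩
    obtain ⟨ha, ha'⟩ := a.2
    obtain ⟨hb, hb'⟩ := b.2
    exact hG ⟨a.1, ha⟩ ⟨b.1, hb⟩ (Quot.eqvGen_exact (ha'.trans hb'.symm)) a.2 b.2
  refine hconn.card_vert_le_card_edgeSet_add_one.trans (Nat.add_le_add_right ?_ 1)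
  have hsel : ∀ s : G.edgeSet, ∃ c : γ.links q, ∃ d₁ ∈ Γ.extDarts c.1.1, ∃ d₂ ∈ Γ.extDarts c.1.1,
      (∀ d ∈ Γ.extDarts c.1.1, d = d₁ ∨ d = d₂) ∧
      s.1.map Subtype.val = s(Γ.edge d₁, Γ.edge d₂) := by
    rintro ⟨s, hs⟩
    induction s using Sym2.ind with
    | _ a b =>
      rw [SimpleGraph.mem_edgeSet, SimpleGraph.fromRel_adj] at hs
      have main : ∀ a b : γ.members q, a ≠ b → (∃ c : γ.comps, (γ.residue c).isRight ∧
          ∃ d ∈ Γ.extDarts c.1, ∃ d' ∈ Γ.extDarts c.1, Γ.edge d = a.1 ∧ Γ.edge d' = b.1) →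
          ∃ c : γ.links q, ∃ d₁ ∈ Γ.extDarts c.1.1, ∃ d₂ ∈ Γ.extDarts c.1.1,
          (∀ d ∈ Γ.extDarts c.1.1, d = d₁ ∨ d = d₂) ∧
          s(a.1, b.1) = s(Γ.edge d₁, Γ.edge d₂) := by
        rintro a b hab ⟨c, hc, d, hd, d', hd', h1, h2⟩
        obtain ⟨x, -, y, -, -, hall, -⟩ := line_extDarts hc
        refine ⟨⟨c, hc, d, hd, h1 ▸ a.2⟩, d, hd, d', hd', ?_, by rw [h1, h2]⟩
        have hne : d ≠ d' := by
          rintro rfl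
          exact hab (Subtype.ext (h1.symm.trans h2))
        intro z hz
        rcases hall z hz with rfl | rfl <;> rcases hall d hd with rfl | rfl <;>
          rcases hall d' hd' with rfl | rfl <;> simp_all
      rcases hs with ⟨hne, h | h⟩
      · exact main a b hne h
      · have := main b a hne.symm h
        rwa [Sym2.eq_swap] at this
  choose sel hsel' using hsel
  refine Nat.card_le_card_of_injective sel (fun s t hst => ?_)
  obtain ⟨d₁, h1, d₂, h2, hall, hs⟩ := hsel' s
  obtain ⟨x₁, k1, x₂, k2, hall', ht⟩ := hsel' t
  rw [hst] at h1 h2 hall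
  have hne : ∀ s : G.edgeSet, ∀ d, s.1.map Subtype.val ≠ s(Γ.edge d, Γ.edge d) := by
    rintro ⟨s, hs⟩ d
    induction s using Sym2.ind with
    | _ a b =>
      intro h
      rw [SimpleGraph.mem_edgeSet] at hs
      simp only [Sym2.map_mk, Sym2.eq_iff] at h
      exact hs.ne (Subtype.ext (by rcases h with h | h <;> exact h.1.trans h.2.symm))
  apply Subtype.ext
  apply Sym2.map.injective Subtype.val_injective
  rw [hs, ht]
  rcases hall' d₁ h1 with rfl | rfl <;> rcases hall' d₂ h2 with rfl | rfl
  · exact (hne _ _ hs).elim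
  · rfl
  · exact Sym2.eq_swap
  · exact (hne _ _ hs).elim

lemma card_ends (q : γ.NewE) :
    Nat.card {d : γ.NewD // Quot.mk γ.Chain ⟨Γ.edge d.1, d.2.1⟩ = q} +
      Nat.card {k // Γ.ext k ∈ γ.members q} + 2 * Nat.card (γ.links q) =
      2 * Nat.card (γ.members q) := by
  classical
  have e1 : ((e : γ.members q) × ({d // Γ.edge d = e.1} ⊕ {k // Γ.ext k = e.1})) ≃
      {d // Γ.edge d ∈ γ.members q} ⊕ {k // Γ.ext k ∈ γ.members q} :=
    { toFun := fun x => Sum.map (fun d => ⟨d.1, by rw [d.2]; exact x.1.2⟩)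
        (fun k => ⟨k.1, by rw [k.2]; exact x.1.2⟩) x.2
      invFun := Sum.elim (fun d => ⟨⟨_, d.2⟩, .inl ⟨d.1, rfl⟩⟩) (fun k => ⟨⟨_, k.2⟩, .inr ⟨k.1, rfl⟩⟩)
      left_inv := by
        rintro ⟨⟨e, he⟩, ⟨d, hd⟩ | ⟨k, hk⟩⟩
        · dsimp only at hd; subst hd; rfl
        · dsimp only at hk; subst hk; rfl
      right_inv := by
        rintro (d | k) <;> rfl }
  have := Fintype.ofFinite (γ.members q)
  have c1 := Nat.card_congr e1
  rw [Nat.card_sigma, Nat.card_sum] at c1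
  simp only [Nat.card_sum, Γ.edge_ends, Finset.sum_const, Finset.card_univ, smul_eq_mul] at c1
  rw [← Nat.card_eq_fintype_card] at c1
  have e2 : {d // Γ.edge d ∈ γ.members q} ≃
      {d : γ.NewD // Quot.mk γ.Chain ⟨Γ.edge d.1, d.2.1⟩ = q} ⊕
        ((c : γ.links q) × Γ.extDarts c.1.1) :=
    (Equiv.sumCompl (fun d : {d // Γ.edge d ∈ γ.members q} => Γ.vert d.1 ∉ γ.lineVerts)).symm.trans
    (Equiv.sumCongr
      { toFun := fun d => ⟨⟨d.1.1, d.1.2.1, d.2⟩, d.1.2.2⟩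
        invFun := fun d => ⟨⟨d.1.1, d.1.2.1, d.2⟩, d.1.2.2⟩
        left_inv := fun _ => rfl
        right_inv := fun _ => rfl }
      { toFun := fun d =>
          have h := not_not.1 d.2
          ⟨⟨h.choose, h.choose_spec.1, d.1.1, ⟨h.choose_spec.2, d.1.2.1 _⟩, d.1.2⟩,
            ⟨d.1.1, h.choose_spec.2, d.1.2.1 _⟩⟩
        invFun := fun x => ⟨⟨x.2.1, mem_members_of_links x.1.2 x.2.2⟩,
          not_not.2 ⟨x.1.1, x.1.2.1, x.2.2.1⟩⟩
        left_inv := fun _ => rfl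
        right_inv := by
          rintro ⟨⟨c, hc⟩, ⟨d, hd⟩⟩
          have h : ∃ c : γ.comps, (γ.residue c).isRight ∧ Γ.vert d ∈ Γ.verts c.1 := ⟨c, hc.1, hd.1⟩
          obtain rfl : h.choose = c := comp_unique h.choose_spec.2 hd.1
          rfl })
  have c2 := Nat.card_congr e2
  have := Fintype.ofFinite (γ.links q)
  rw [Nat.card_sum, Nat.card_sigma] at c2
  have h2 : ∀ c : γ.links q, Nat.card (Γ.extDarts c.1.1) = 2 := by
    intro c
    obtain ⟨x, hx, y, hy, hne, hall, -⟩ := line_extDarts c.2.1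
    rw [Nat.card_eq_two_iff]
    refine ⟨⟨x, hx⟩, ⟨y, hy⟩, fun h => hne (congrArg Subtype.val h), ?_⟩
    rw [Set.eq_univ_iff_forall]
    rintro ⟨z, hz⟩
    rcases hall z hz with rfl | rfl <;> simp
  simp only [h2, Finset.sum_const, Finset.card_univ, smul_eq_mul] at c2
  rw [← Nat.card_eq_fintype_card] at c2
  omega

lemma exists_end (h : Γ.IsOnePI) (q : γ.NewE) :
    Nonempty {d : γ.NewD // Quot.mk γ.Chain ⟨Γ.edge d.1, d.2.1⟩ = q} ∨
      Nonempty {k // Γ.ext k ∈ γ.members q} := by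
  by_contra! hcon
  obtain ⟨hd, hk⟩ := hcon
  have hdart : ∀ d, Γ.edge d ∈ γ.members q → ∃ c ∈ γ.links q, Γ.vert d ∈ Γ.verts c.1 := by
    intro d hdq
    by_cases hv : Γ.vert d ∈ γ.lineVerts
    · obtain ⟨c, hc, hcv⟩ := hv
      exact ⟨c, ⟨hc, d, ⟨hcv, hdq.1 c⟩, hdq⟩, hcv⟩
    · exact (hd.false ⟨⟨d, hdq.1, hv⟩, hdq.2⟩).elim
  have huniv : ∀ v, v ∈ {v | ∃ c ∈ γ.links q, v ∈ Γ.verts c.1} := by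
    refine h.eq_univ ?_ ?_
    · obtain ⟨e, rfl⟩ := Quot.exists_rep q
      obtain ⟨d, hd⟩ := h.incident e.1
      exact ⟨Γ.vert d, hdart d (hd ▸ ⟨e.2, rfl⟩)⟩
    · rintro d d' h1 - ⟨c, hc, hv⟩
      by_cases hdc : Γ.edge d ∈ c.1
      · exact ⟨c, hc, d', rfl, h1 ▸ hdc⟩
      · exact hdart d' (h1 ▸ mem_members_of_links hc ⟨hv, hdc⟩)
  have k0 : Fin r.legs.length := ⟨0, r.legs_length_pos⟩
  obtain ⟨d, hd'⟩ := h.incident (Γ.ext k0)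
  obtain ⟨c, hc, hv⟩ := huniv (Γ.vert d)
  have hm := mem_members_of_links hc (d := d)
    ⟨hv, fun hdc => (γ.isSub c.1 c.2).subset hdc ⟨k0, hd'.symm⟩⟩
  exact hk.false ⟨k0, hd' ▸ hm⟩

end ProperSubgraph

lemma card_get_eq_count (l : List Line) (t : Line) :
    Nat.card {k : Fin l.length // l.get k = t} = l.count t := by
  rw [Nat.card_eq_fintype_card, Fintype.card_subtype]
  exact Fin.card_filter_univ_eq_vector_get_eq_count t (⟨l, rfl⟩ : List.Vector Line l.length)

open ProperSubgraph in
/-- The contracted graph `Γ / γ`: every component of `γ` whose residue is a vertex is shrunk to a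
vertex of that type; every component whose residue is an edge is removed and its two external
lines are merged. -/
noncomputable def contract (h : Γ.IsOnePI) (γ : Γ.ProperSubgraph) : FeynmanGraph r where
  V := γ.NewV
  E := γ.NewE
  D := γ.NewD
  vtype := Sum.elim (fun v => Γ.vtype v.1) (fun c => (γ.residue c.1).getLeft c.2)
  etype := Quot.lift (fun e => Γ.etype e.1) (fun _ _ h => h.etype_eq)
  vert d := γ.node (Γ.vert d.1) d.2.2
  edge d := Quot.mk _ ⟨Γ.edge d.1, d.2.1⟩
  ext k := Quot.mk _ ⟨Γ.ext k, fun c hc => (γ.isSub c.1 c.2).subset hc ⟨k, rfl⟩⟩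
  edge_ends q := by
    have h1 := card_ends q
    have h2 := card_members_le q
    have h3 : Nat.card {k // Γ.ext k ∈ γ.members q} =
        Nat.card {k // (Quot.mk γ.Chain ⟨Γ.ext k, fun c hc => (γ.isSub c.1 c.2).subset hc ⟨k, rfl⟩⟩) = q} :=
      Nat.card_congr (Equiv.subtypeEquivRight fun k => ⟨fun hk => hk.2, fun hk => ⟨_, hk⟩⟩)
    have h4 : 0 < Nat.card {d : γ.NewD // Quot.mk γ.Chain ⟨Γ.edge d.1, d.2.1⟩ = q} ∨
        0 < Nat.card {k // Γ.ext k ∈ γ.members q} := by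
      rcases exists_end h q with h5 | h5
      · exact .inl Nat.card_pos
      · exact .inr Nat.card_pos
    rw [← h3]
    omega
  vertex_legs v t := by
    rcases v with v | c
    · refine Eq.trans ?_ (Γ.vertex_legs v.1 t)
      refine Nat.card_congr ⟨fun d => ⟨d.1.1, node_eq_inl _ d.2.1, d.2.2⟩, fun d =>
        ⟨⟨d.1, not_mem_of_vert (fun c => by rw [d.2.1]; exact v.2 c), ?_⟩, ?_, d.2.2⟩,
        fun _ => rfl, fun _ => rfl⟩
      · rintro ⟨c, -, hc⟩
        rw [d.2.1] at hc
        exact v.2 c hc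
      · have hd : ∀ c : γ.comps, Γ.vert d.1 ∉ Γ.verts c.1 := fun c => by rw [d.2.1]; exact v.2 c
        refine (node_of_notMem _ hd).trans ?_
        congr 1
        exact Subtype.ext d.2.1
    · obtain ⟨c, hc⟩ := c
      have hlegs : (γ.label c).res.legs = ((γ.residue c).getLeft hc).legs := by
        change (γ.residue c).legs = _
        generalize hρ : γ.residue c = ρ at hc
        rcases ρ with v | t
        · rfl
        · simp at hc
      change _ = ((γ.residue c).getLeft hc).legs.count t
      rw [← hlegs, ← card_get_eq_count]
      refine Nat.card_congr (Equiv.trans (β := {d : Γ.extDarts c.1 // Γ.etype (Γ.edge d.1) = t})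
        ⟨fun d => ⟨⟨d.1.1, node_eq_inr _ d.2.1, d.1.2.1 c⟩, d.2.2⟩, fun d =>
          ⟨⟨d.1.1, not_mem_of_extDart d.1.2, ?_⟩, ?_, d.2⟩, fun _ => rfl, fun _ => rfl⟩
        ((γ.label c).equiv.subtypeEquiv fun k => by rw [← (γ.label c).type_eq]).symm)
      · rintro ⟨c', hr, hc'⟩
        obtain rfl := comp_unique hc' d.1.2.1
        rw [← Sum.not_isRight] at hc
        exact hc hr
      · obtain ⟨_, h'⟩ := node_of_mem (v := Γ.vert d.1.1) (γ := γ) (by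
          rintro ⟨c', hr, hc'⟩
          obtain rfl := comp_unique hc' d.1.2.1
          rw [← Sum.not_isRight] at hc
          exact hc hr) d.1.2.1
        exact h'
  ext_type k := Γ.ext_type k

section

open ProperSubgraph

variable {γ : Γ.ProperSubgraph}

lemma contract_mem_internal (h : Γ.IsOnePI) {e : γ.Rest} :
    (Quot.mk γ.Chain e : γ.NewE) ∈ (contract h γ).internal ↔ e.1 ∈ Γ.internal := by
  constructor
  · rintro hq ⟨k, hk⟩
    exact hq ⟨k, congrArg (Quot.mk γ.Chain) (Subtype.ext hk)⟩
  · rintro he ⟨k, hk⟩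
    have := eq_of_mk_eq_of_ext h (γ := γ)
      (e := ⟨Γ.ext k, fun c hc => (γ.isSub c.1 c.2).subset hc ⟨k, rfl⟩⟩) (not_not.2 ⟨k, rfl⟩) hk
    exact he ⟨k, congrArg Subtype.val this⟩

lemma contract_isOnePI (h : Γ.IsOnePI) (γ : Γ.ProperSubgraph) : (contract h γ).IsOnePI := by
  classical
  have hinc : ∀ p : γ.NewE, ∃ x : γ.NewD, (contract h γ).edge x = p := by
    intro p
    by_cases hp : p ∈ (contract h γ).internal
    · have h2 := card_darts_of_internal hp
      obtain ⟨x, hx⟩ := (Nat.card_pos_iff.1 (by omega : 0 < Nat.card {d // (contract h γ).edge d = p})).1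
      exact ⟨x, hx⟩
    · obtain ⟨k, rfl⟩ := not_not.1 hp
      have h2 := (contract h γ).edge_ends ((contract h γ).ext k)
      have h3 : Nat.card {k' // (contract h γ).ext k' = (contract h γ).ext k} ≤ 1 := by
        rw [Finite.card_le_one_iff_subsingleton]
        have huniq : ∀ k', (contract h γ).ext k' = (contract h γ).ext k → k' = k := by
          intro k' hk'
          obtain ⟨d, hd⟩ := h.incident (Γ.ext k)
          refine ext_unique hd.symm k' (congrArg Subtype.val (eq_of_mk_eq_of_ext h (γ := γ)
            (e := ⟨Γ.ext k', fun c hc => (γ.isSub c.1 c.2).subset hc ⟨k', rfl⟩⟩)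
            (e' := ⟨Γ.ext k, fun c hc => (γ.isSub c.1 c.2).subset hc ⟨k, rfl⟩⟩)
            (not_not.2 ⟨k', rfl⟩) hk'))
        exact ⟨fun a b => Subtype.ext ((huniq a.1 a.2).trans (huniq b.1 b.2).symm)⟩
      obtain ⟨x, hx⟩ := (Nat.card_pos_iff.1 (by omega :
        0 < Nat.card {d // (contract h γ).edge d = (contract h γ).ext k})).1
      exact ⟨x, hx⟩
  refine ⟨?_, hinc, ?_⟩
  · obtain ⟨e, he, hrest⟩ := exists_internal_rest h γ
    exact ⟨Quot.mk γ.Chain ⟨e, hrest⟩, (contract_mem_internal h).2 he⟩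
  intro q hq
  have h2 := card_darts_of_internal hq
  obtain ⟨⟨a, ha⟩, ⟨b, hb⟩, hab, huniv⟩ := Nat.card_eq_two_iff.1 h2
  have hab' : ∀ x : γ.NewD, (contract h γ).edge x = q → x ≠ a → x = b := by
    intro x hx hxa
    have : (⟨x, hx⟩ : {d // (contract h γ).edge d = q}) ∈ ({⟨a, ha⟩, ⟨b, hb⟩} : Set _) := by
      rw [huniv]; trivial
    rcases this with h | h
    · exact (hxa (congrArg Subtype.val h)).elim
    · exact congrArg Subtype.val h
  choose rep₀ hrep₀ using hinc
  obtain ⟨rep, hrep, hrepq⟩ : ∃ rep : γ.NewE → γ.NewD,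
      (∀ p, (contract h γ).edge (rep p) = p) ∧ rep q = b := by
    refine ⟨Function.update rep₀ q b, fun p => ?_, Function.update_self _ _ _⟩
    by_cases hp : p = q
    · subst hp; exact (congrArg (contract h γ).edge (Function.update_self (f := rep₀) ..)).trans hb
    · exact (congrArg (contract h γ).edge (Function.update_of_ne hp ..)).trans (hrep₀ p)
  have hf : ∀ v, ∃ x : γ.NewV, (∀ hv : v ∉ γ.lineVerts, x = γ.node v hv) ∧
      (∀ c : γ.comps, (γ.residue c).isRight → v ∈ Γ.verts c.1 → ∀ d (hd : d ∈ Γ.extDarts c.1),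
        x = (contract h γ).vert (rep (Quot.mk γ.Chain ⟨Γ.edge d, not_mem_of_extDart hd⟩))) := by
    intro v
    by_cases hv : v ∈ γ.lineVerts
    · obtain ⟨c, hc, hcv⟩ := hv
      obtain ⟨d, hd, -⟩ := line_extDarts hc
      refine ⟨(contract h γ).vert (rep (Quot.mk γ.Chain ⟨Γ.edge d, not_mem_of_extDart hd⟩)),
        fun hv => (hv ⟨c, hc, hcv⟩).elim, fun c' hc' hcv' d' hd' => ?_⟩
      obtain rfl := comp_unique hcv hcv'
      rw [Quot.sound (r := γ.Chain) (⟨c, hc, d, hd, d', hd', rfl, rfl⟩ :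
        γ.Chain ⟨Γ.edge d, not_mem_of_extDart hd⟩ ⟨Γ.edge d', not_mem_of_extDart hd'⟩)]
    · exact ⟨γ.node v hv, fun _ => rfl, fun c hc hcv => (hv ⟨c, hc, hcv⟩).elim⟩
  choose f hf1 hf2 using hf
  -- the image of a dart outside `γ` is the vertex of some dart in the same class
  have hdart : ∀ (d : Γ.D) (hd : ∀ c : γ.comps, Γ.edge d ∉ c.1), Γ.edge d ≠ Γ.edge a.1 →
      ∃ x : γ.NewD, (contract h γ).edge x = Quot.mk γ.Chain ⟨Γ.edge d, hd⟩ ∧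
        f (Γ.vert d) = (contract h γ).vert x ∧ ((contract h γ).edge x = q → x = b) := by
    intro d hd hda
    by_cases hv : Γ.vert d ∈ γ.lineVerts
    · obtain ⟨c, hc, hcv⟩ := hv
      refine ⟨rep (Quot.mk γ.Chain ⟨Γ.edge d, hd⟩), hrep _, hf2 _ c hc hcv d ⟨hcv, hd c⟩, ?_⟩
      intro hx
      rw [hrep] at hx
      rw [hx, hrepq]
    · refine ⟨⟨d, hd, hv⟩, rfl, hf1 _ hv, fun hx => hab' _ hx ?_⟩
      rintro rfl
      exact hda rfl
  have hstep : ∀ v w, Γ.Adj (Γ.internal \ {Γ.edge a.1}) v w →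
      (contract h γ).Linked ((contract h γ).internal \ {q}) (f v) (f w) := by
    rintro _ _ ⟨d, d', h1, h2, rfl, rfl⟩
    by_cases hd : ∀ c : γ.comps, Γ.edge d ∉ c.1
    · have hd' : ∀ c : γ.comps, Γ.edge d' ∉ c.1 := h1 ▸ hd
      obtain ⟨x, hx1, hx2, hx3⟩ := hdart d hd h2.2
      obtain ⟨y, hy1, hy2, hy3⟩ := hdart d' hd' (h1 ▸ h2.2)
      have hxy : (contract h γ).edge x = (contract h γ).edge y := by
        rw [hx1, hy1]
        exact congrArg (Quot.mk γ.Chain) (Subtype.ext h1)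
      rw [hx2, hy2]
      by_cases hxq : (contract h γ).edge x = q
      · rw [hx3 hxq, hy3 (hxy ▸ hxq)]
        exact .refl
      · refine .single ⟨x, y, hxy, ⟨?_, hxq⟩, rfl, rfl⟩
        rw [hx1]
        exact (contract_mem_internal h).2 h2.1
    · push Not at hd
      obtain ⟨c, hc⟩ := hd
      have hv : Γ.vert d ∈ Γ.verts c.1 := ⟨d, rfl, hc⟩
      have hv' : Γ.vert d' ∈ Γ.verts c.1 := ⟨d', rfl, h1 ▸ hc⟩
      have : f (Γ.vert d) = f (Γ.vert d') := by
        by_cases hcr : (γ.residue c).isRight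
        · obtain ⟨x, hx, -⟩ := line_extDarts hcr
          rw [hf2 _ c hcr hv x hx, hf2 _ c hcr hv' x hx]
        · have hn : ∀ v ∈ Γ.verts c.1, v ∉ γ.lineVerts := by
            rintro v hv ⟨c', hr, hc'⟩
            obtain rfl := comp_unique hc' hv
            exact hcr hr
          obtain ⟨_, e1⟩ := node_of_mem (hn _ hv) hv
          obtain ⟨_, e2⟩ := node_of_mem (hn _ hv') hv'
          rw [hf1 _ (hn _ hv), hf1 _ (hn _ hv'), e1, e2]
      rw [this]
      exact .refl
  have hlink : ∀ v w, (contract h γ).Linked ((contract h γ).internal \ {q}) (f v) (f w) := by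
    intro v w
    have ha' : Γ.edge a.1 ∈ Γ.internal :=
      (contract_mem_internal h (γ := γ) (e := ⟨Γ.edge a.1, a.2.1⟩)).1 (by
        have : Quot.mk γ.Chain ⟨Γ.edge a.1, a.2.1⟩ = q := ha
        rw [this]; exact hq)
    have hl := h.linked _ ha' v w
    induction hl with
    | refl => exact .refl
    | tail _ hab ih => exact ih.trans (hstep _ _ hab)
  have hsurj : ∀ x : γ.NewV, ∃ v, f v = x := by
    rintro (v | c)
    · have hv : v.1 ∉ γ.lineVerts := fun ⟨c, _, hc⟩ => v.2 c hc
      exact ⟨v.1, (hf1 _ hv).trans (node_of_notMem hv v.2)⟩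
    · obtain ⟨e, he⟩ := (γ.isSub c.1.1 c.1.2).nonempty
      obtain ⟨d, rfl⟩ := h.incident e
      have hm : Γ.vert d ∈ Γ.verts c.1.1 := ⟨d, rfl, he⟩
      have hv : Γ.vert d ∉ γ.lineVerts := by
        rintro ⟨c', hr, hc'⟩
        obtain rfl := comp_unique hc' hm
        have := c.2
        rw [← Sum.not_isRight] at this
        exact this hr
      obtain ⟨_, e1⟩ := node_of_mem hv hm
      exact ⟨Γ.vert d, (hf1 _ hv).trans e1⟩
  intro v w
  obtain ⟨v, rfl⟩ := hsurj v
  obtain ⟨w, rfl⟩ := hsurj w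
  exact hlink v w

end

/-! ### Isomorphisms, symmetry factors, loop number -/

/-- An isomorphism of Feynman graphs, fixing the external lines. -/
@[ext]
structure Iso (Γ Γ' : FeynmanGraph r) where
  onV : Γ.V ≃ Γ'.V
  onE : Γ.E ≃ Γ'.E
  onD : Γ.D ≃ Γ'.D
  vtype : ∀ v, Γ'.vtype (onV v) = Γ.vtype v
  etype : ∀ e, Γ'.etype (onE e) = Γ.etype e
  vert : ∀ d, Γ'.vert (onD d) = onV (Γ.vert d)
  edge : ∀ d, Γ'.edge (onD d) = onE (Γ.edge d)
  extEdge : ∀ k, Γ'.ext k = onE (Γ.ext k)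

namespace Iso

variable {Γ Γ' Γ'' : FeynmanGraph r}

/-- The identity. -/
def refl (Γ : FeynmanGraph r) : Iso Γ Γ :=
  ⟨.refl _, .refl _, .refl _, fun _ => rfl, fun _ => rfl, fun _ => rfl, fun _ => rfl, fun _ => rfl⟩

/-- Composition of isomorphisms. -/
def trans (f : Iso Γ Γ') (g : Iso Γ' Γ'') : Iso Γ Γ'' where
  onV := f.onV.trans g.onV
  onE := f.onE.trans g.onE
  onD := f.onD.trans g.onD
  vtype v := by simp [g.vtype, f.vtype]
  etype e := by simp [g.etype, f.etype]
  vert d := by simp [g.vert, f.vert]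
  edge d := by simp [g.edge, f.edge]
  extEdge k := by rw [g.extEdge, f.extEdge]; rfl

/-- The inverse isomorphism. -/
def symm (f : Iso Γ Γ') : Iso Γ' Γ where
  onV := f.onV.symm
  onE := f.onE.symm
  onD := f.onD.symm
  vtype v := by rw [← f.vtype, Equiv.apply_symm_apply]
  etype e := by rw [← f.etype, Equiv.apply_symm_apply]
  vert d := by rw [Equiv.eq_symm_apply, ← f.vert, Equiv.apply_symm_apply]
  edge d := by rw [Equiv.eq_symm_apply, ← f.edge, Equiv.apply_symm_apply]
  extEdge k := by rw [Equiv.eq_symm_apply, ← f.extEdge]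

lemma card_internal (f : Iso Γ Γ') : Nat.card Γ.internal = Nat.card Γ'.internal := by
  refine Nat.card_congr (f.onE.subtypeEquiv fun e => not_congr (exists_congr fun k => ?_))
  rw [f.extEdge, Equiv.apply_eq_iff_eq]

end Iso

/-- The symmetry factor: the order of the group of automorphisms fixing the external lines.
An automorphism acts on vertices, edges and ends of edges; exchanging the two ends of an edge that
starts and ends at the same vertex counts as an automorphism. -/
noncomputable def symFactor (Γ : FeynmanGraph r) : ℕ := Nat.card (Iso Γ Γ)

/-- The loop number (first Betti number of a connected graph). -/
noncomputable def loopNumber (Γ : FeynmanGraph r) : ℤ :=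
  (Nat.card Γ.internal : ℤ) - Nat.card Γ.V + 1

/-- Graphs with the given residue are identified if they are isomorphic (with external lines
fixed). -/
instance isoSetoid (r : Res) : Setoid {Γ : FeynmanGraph r // Γ.IsOnePI} where
  r Γ Γ' := Nonempty (Iso Γ.1 Γ'.1)
  iseqv := ⟨fun Γ => ⟨.refl Γ.1⟩, fun ⟨f⟩ => ⟨f.symm⟩, fun ⟨f⟩ ⟨g⟩ => ⟨f.trans g⟩⟩

end FeynmanGraph

open FeynmanGraph

/-- Isomorphism classes of 1PI graphs with residue `r`. -/
abbrev OnePIClass (r : Res) : Type 1 := Quotient (isoSetoid r)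

namespace OnePIClass

variable {r : Res}

/-- The class of a 1PI graph. -/
def mk (Γ : FeynmanGraph r) (h : Γ.IsOnePI) : OnePIClass r := Quotient.mk _ ⟨Γ, h⟩

/-- Symmetry factor of an isomorphism class. -/
noncomputable def symFactor : OnePIClass r → ℕ :=
  Quotient.lift (fun Γ => Γ.1.symFactor) fun Γ Γ' ⟨f⟩ => Nat.card_congr
    ⟨fun g => f.symm.trans (g.trans f), fun g => f.trans (g.trans f.symm),
      fun g => by ext x <;> simp [Iso.trans, Iso.symm],
      fun g => by ext x <;> simp [Iso.trans, Iso.symm]⟩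

/-- Loop number of an isomorphism class. -/
noncomputable def loopNumber : OnePIClass r → ℤ :=
  Quotient.lift (fun Γ => Γ.1.loopNumber) fun Γ Γ' ⟨f⟩ => by
    unfold FeynmanGraph.loopNumber
    rw [f.card_internal, Nat.card_congr f.onV]

/-- Number of internal edges of an isomorphism class. -/
noncomputable def numEdges : OnePIClass r → ℕ :=
  Quotient.lift (fun Γ => Nat.card Γ.1.internal) fun _ _ ⟨f⟩ => f.card_internal

end OnePIClass

namespace FeynmanGraph

variable {r : Res}

lemma card_edges (Γ : FeynmanGraph r) : 2 * Nat.card Γ.E = Nat.card Γ.D + r.legs.length := by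
  have e : ((e : Γ.E) × ({d // Γ.edge d = e} ⊕ {k // Γ.ext k = e})) ≃
      Γ.D ⊕ Fin r.legs.length :=
    (Equiv.sigmaSumDistrib _ _).trans
      (Equiv.sumCongr (Equiv.sigmaFiberEquiv Γ.edge) (Equiv.sigmaFiberEquiv Γ.ext))
  have := Fintype.ofFinite Γ.E
  have c := Nat.card_congr e
  rw [Nat.card_sigma, Nat.card_sum] at c
  simp only [Nat.card_sum, Γ.edge_ends, Finset.sum_const, Finset.card_univ, smul_eq_mul] at c
  rw [← Nat.card_eq_fintype_card, Nat.card_eq_fintype_card (α := Fin _), Fintype.card_fin] at c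
  omega

lemma card_darts (Γ : FeynmanGraph r) : 3 * Nat.card Γ.V ≤ Nat.card Γ.D := by
  have h3 : ∀ v, 3 ≤ Nat.card {d // Γ.vert d = v} := by
    intro v
    have e : ((t : Line) × {d : {d // Γ.vert d = v} // Γ.etype (Γ.edge d.1) = t}) ≃
        {d // Γ.vert d = v} := Equiv.sigmaFiberEquiv (fun d : {d // Γ.vert d = v} => Γ.etype (Γ.edge d.1))
    rw [← Nat.card_congr e, Nat.card_sigma]
    have : ∀ t, Nat.card {d : {d // Γ.vert d = v} // Γ.etype (Γ.edge d.1) = t} =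
        (Γ.vtype v).legs.count t := fun t =>
      (Nat.card_congr (Equiv.subtypeSubtypeEquivSubtypeInter _ (fun d => Γ.etype (Γ.edge d) = t))).trans
        (Γ.vertex_legs v t)
    simp only [this]
    generalize Γ.vtype v = x
    revert x
    decide
  have := Fintype.ofFinite Γ.V
  rw [← Nat.card_congr (Equiv.sigmaFiberEquiv Γ.vert), Nat.card_sigma]
  calc 3 * Nat.card Γ.V = ∑ _v : Γ.V, 3 := by simp [mul_comm]
    _ ≤ _ := Finset.sum_le_sum fun v _ => h3 v

lemma card_edges_le (Γ : FeynmanGraph r) : Nat.card Γ.E ≤ Nat.card Γ.internal + r.legs.length := by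
  have h : Nat.card (Set.range Γ.ext) ≤ r.legs.length := by
    have := Finite.card_range_le Γ.ext
    rwa [Nat.card_eq_fintype_card (α := Fin _), Fintype.card_fin] at this
  have h2 : Nat.card Γ.E = Nat.card (Set.range Γ.ext) + Nat.card Γ.internal := by
    classical
    rw [← Nat.card_sum]
    exact (Nat.card_congr (Equiv.sumCompl (fun e => e ∈ Set.range Γ.ext))).symm
  omega

/-- `Γ` is isomorphic to a graph on standard finite sets with the given structure maps. -/
def Matches (Γ : FeynmanGraph r) {B : ℕ} (x : (a : Fin B) × (b : Fin B) × (c : Fin B) ×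
    ((Fin a → Vertex) × (Fin b → Line) × (Fin c → Fin a) × (Fin c → Fin b) ×
      (Fin r.legs.length → Fin b))) : Prop :=
  ∃ (f : Γ.V ≃ Fin x.1) (g : Γ.E ≃ Fin x.2.1) (h : Γ.D ≃ Fin x.2.2.1),
    (∀ v, x.2.2.2.1 (f v) = Γ.vtype v) ∧ (∀ e, x.2.2.2.2.1 (g e) = Γ.etype e) ∧
    (∀ d, x.2.2.2.2.2.1 (h d) = f (Γ.vert d)) ∧ (∀ d, x.2.2.2.2.2.2.1 (h d) = g (Γ.edge d)) ∧
    (∀ k, x.2.2.2.2.2.2.2 k = g (Γ.ext k))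

end FeynmanGraph

lemma OnePIClass.finite_loopNumber (r : Res) (L : ℕ) :
    {g : OnePIClass r | g.loopNumber = L}.Finite := by
  let B := 100 * (L + r.legs.length) + 100
  have hB : ∀ g : {g : OnePIClass r | g.loopNumber = L},
      ∃ x, FeynmanGraph.Matches (B := B) g.1.out.1 x := by
    rintro ⟨g, hg⟩
    have hl : g.out.1.loopNumber = L := by
      rw [← hg]; conv_rhs => rw [← Quotient.out_eq g]
      rfl
    unfold FeynmanGraph.loopNumber at hl
    generalize g.out.1 = Γ at hl
    have h1 := Γ.card_edges
    have h2 := Γ.card_darts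
    have h3 := Γ.card_edges_le
    have b1 : Nat.card Γ.V < B := by omega
    have b2 : Nat.card Γ.E < B := by omega
    have b3 : Nat.card Γ.D < B := by omega
    obtain ⟨f⟩ : Nonempty (Γ.V ≃ Fin (Nat.card Γ.V)) := ⟨Finite.equivFin _⟩
    obtain ⟨g⟩ : Nonempty (Γ.E ≃ Fin (Nat.card Γ.E)) := ⟨Finite.equivFin _⟩
    obtain ⟨h⟩ : Nonempty (Γ.D ≃ Fin (Nat.card Γ.D)) := ⟨Finite.equivFin _⟩
    exact ⟨⟨⟨_, b1⟩, ⟨_, b2⟩, ⟨_, b3⟩, Γ.vtype ∘ f.symm, Γ.etype ∘ g.symm, f ∘ Γ.vert ∘ h.symm,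
      g ∘ Γ.edge ∘ h.symm, g ∘ Γ.ext⟩, f, g, h, by simp, by simp, by simp, by simp, by simp⟩
  choose x hx using hB
  have hinj : Function.Injective x := by
    intro g g' hgg
    obtain ⟨f₁, g₁, h₁, a1, a2, a3, a4, a5⟩ := hx g
    have h' := hx g'
    rw [← hgg] at h'
    obtain ⟨f₂, g₂, h₂, b1, b2, b3, b4, b5⟩ := h'
    apply Subtype.ext
    rw [← Quotient.out_eq g.1, ← Quotient.out_eq g'.1]
    refine Quotient.sound ⟨⟨f₁.trans f₂.symm, g₁.trans g₂.symm, h₁.trans h₂.symm, fun v => ?_,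
      fun e => ?_, fun d => ?_, fun d => ?_, fun k => ?_⟩⟩
    · rw [← b1, ← a1]; simp
    · rw [← b2, ← a2]; simp
    · rw [← f₂.apply_eq_iff_eq, ← b3]; simp [a3]
    · rw [← g₂.apply_eq_iff_eq, ← b4]; simp [a4]
    · rw [← g₂.apply_eq_iff_eq, ← b5]; simp [a5]
  exact Set.finite_coe_iff.1 (Finite.of_injective x hinj)

namespace FeynmanGraph

variable {r : Res} {Γ : FeynmanGraph r}

instance (c : Set Γ.E) : Finite (Γ.Labeling c) := by
  have hi : Function.Injective (fun ℓ : Γ.Labeling c =>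
      (⟨ℓ.res, ℓ.equiv⟩ : (s : Res) × (Fin s.legs.length ≃ Γ.extDarts c))) := by
    rintro ⟨s, φ, _⟩ ⟨s', φ', _⟩ h
    cases h
    rfl
  exact Finite.of_injective _ hi

instance : Finite Γ.ProperSubgraph := by
  have hi : Function.Injective (ProperSubgraph.comps : Γ.ProperSubgraph → Set (Set Γ.E)) := by
    rintro ⟨⟩ ⟨⟩ h
    cases h
    rfl
  exact Finite.of_injective _ hi

end FeynmanGraph

/-! ### The Hopf algebra of Feynman graphs -/

open scoped TensorProduct

/-- The generators: (isomorphism classes of) 1PI graphs with residue in `R`. -/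
abbrev Gen : Type 1 := (r : Res) × OnePIClass r

/-- The free commutative algebra over `k` generated by the 1PI graphs. -/
abbrev GraphAlgebra (k : Type*) [Field k] := MvPolynomial Gen k

namespace GraphAlgebra

variable (k : Type*) [Field k]

/-- A 1PI graph as an element of the algebra. -/
noncomputable def of {r : Res} (Γ : FeynmanGraph r) (h : Γ.IsOnePI) : GraphAlgebra k :=
  MvPolynomial.X ⟨r, OnePIClass.mk Γ h⟩

/-- The element of the algebra given by a 1PI subgraph.  The external lines of a subgraph carry no
preferred labelling; one takes the average over all labellings. -/
noncomputable def ofComp {r : Res} {Γ : FeynmanGraph r} {c : Set Γ.E} (hc : Γ.IsSub c) :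
    GraphAlgebra k :=
  (Nat.card (Γ.Labeling c) : k)⁻¹ • ∑ᶠ ℓ : Γ.Labeling c, of k (sub hc ℓ) (sub_isOnePI hc ℓ)

/-- The element of the algebra given by a disjoint union of 1PI subgraphs. -/
noncomputable def ofSub {r : Res} {Γ : FeynmanGraph r} (γ : Γ.ProperSubgraph) : GraphAlgebra k :=
  ∏ᶠ c : γ.comps, ofComp k (γ.isSub c c.2)

/-- The contracted graph `Γ / γ` as an element of the algebra. -/
noncomputable def ofContract {r : Res} {Γ : FeynmanGraph r} (h : Γ.IsOnePI) (γ : Γ.ProperSubgraph) :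
    GraphAlgebra k :=
  of k (contract h γ) (contract_isOnePI h γ)

/-- The counit: `ε(Γ) = 0` for every 1PI graph `Γ`. -/
noncomputable def counit : GraphAlgebra k →ₐ[k] k := MvPolynomial.aeval fun _ => 0

/-- The coproduct: the algebra map with
`Δ(Γ) = Γ ⊗ 1 + 1 ⊗ Γ + ∑_{∅ ≠ γ ⊊ Γ} γ ⊗ Γ / γ` on 1PI graphs `Γ` (the right-hand side
does not depend on the representative of the isomorphism class). -/
noncomputable def coproduct : GraphAlgebra k →ₐ[k] GraphAlgebra k ⊗[k] GraphAlgebra k :=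
  MvPolynomial.aeval fun g =>
    MvPolynomial.X g ⊗ₜ[k] 1 + 1 ⊗ₜ[k] MvPolynomial.X g +
      ∑ᶠ γ : g.2.out.1.ProperSubgraph, ofSub k γ ⊗ₜ[k] ofContract k g.2.out.2 γ

/-- The antipode on graphs with at most `n` internal edges, by recursion on `n`. -/
noncomputable def antipodeAux : ℕ → (GraphAlgebra k →ₐ[k] GraphAlgebra k)
  | 0 => MvPolynomial.aeval fun _ => 0
  | n + 1 => MvPolynomial.aeval fun g =>
      -MvPolynomial.X g -
        ∑ᶠ γ : g.2.out.1.ProperSubgraph, antipodeAux n (ofSub k γ) * ofContract k g.2.out.2 γ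

/-- The antipode: the algebra map determined by the recursion
`S(Γ) = - Γ - ∑_{∅ ≠ γ ⊊ Γ} S(γ) Γ / γ` on 1PI graphs `Γ`; see `antipode_X`. -/
noncomputable def antipode : GraphAlgebra k →ₐ[k] GraphAlgebra k :=
  MvPolynomial.aeval fun g => antipodeAux k g.2.numEdges (MvPolynomial.X g)

variable {k}

lemma numEdges_out (g : Gen) : Nat.card g.2.out.1.internal = g.2.numEdges := by
  conv_rhs => rw [← Quotient.out_eq g.2]
  rfl

lemma card_internal_sub {r : Res} {Γ : FeynmanGraph r} {c : Set Γ.E} (hc : Γ.IsSub c)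
    (ℓ : Γ.Labeling c) : Nat.card (sub hc ℓ).internal = Nat.card c := by
  refine Nat.card_congr (Equiv.ofBijective (fun e : c =>
    (⟨.inl e, by rintro ⟨k, hk⟩; cases hk⟩ : (sub hc ℓ).internal)) ⟨?_, ?_⟩).symm
  · intro a b h
    exact Sum.inl.inj (congrArg Subtype.val h)
  · rintro ⟨e | d, h⟩
    · exact ⟨e, rfl⟩
    · refine (h ⟨ℓ.equiv.symm d, ?_⟩).elim
      change Sum.inr (ℓ.equiv _) = _
      rw [Equiv.apply_symm_apply]

lemma card_comp_lt {r : Res} {Γ : FeynmanGraph r} (γ : Γ.ProperSubgraph) (c : γ.comps) :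
    Nat.card c.1 < Nat.card Γ.internal := by
  have h := (γ.isSub c c.2).subset
  have hne : (c : Set Γ.E) ≠ Γ.internal := fun h => γ.proper (h ▸ c.2)
  rw [Nat.card_coe_set_eq, Nat.card_coe_set_eq]
  exact Set.ncard_lt_ncard (h.ssubset_of_ne hne) (Set.toFinite _)

/-- algebra maps that agree on graphs with fewer internal edges than `Γ` agree on `γ ⊊ Γ` -/
lemma map_ofSub_congr {r : Res} {Γ : FeynmanGraph r} (γ : Γ.ProperSubgraph)
    {f g : GraphAlgebra k →ₐ[k] GraphAlgebra k}
    (h : ∀ x : Gen, x.2.numEdges < Nat.card Γ.internal →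
      f (MvPolynomial.X x) = g (MvPolynomial.X x)) :
    f (ofSub k γ) = g (ofSub k γ) := by
  classical
  have hc : ∀ c : γ.comps, f (ofComp k (γ.isSub c c.2)) = g (ofComp k (γ.isSub c c.2)) := by
    intro c
    have := Fintype.ofFinite (Γ.Labeling c.1)
    unfold ofComp
    rw [finsum_eq_sum_of_fintype, map_smul, map_smul, map_sum, map_sum]
    congr 1
    refine Finset.sum_congr rfl fun ℓ _ => h _ ?_
    exact (card_internal_sub (γ.isSub c c.2) ℓ).trans_lt (card_comp_lt γ c)
  have := Fintype.ofFinite γ.comps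
  unfold ofSub
  rw [finprod_eq_prod_of_fintype, map_prod, map_prod]
  exact Finset.prod_congr rfl fun c _ => hc c

lemma antipodeAux_X (n : ℕ) : ∀ x : Gen, x.2.numEdges ≤ n →
    antipodeAux k n (MvPolynomial.X x) = antipode k (MvPolynomial.X x) := by
  induction n using Nat.strong_induction_on with
  | _ n ih =>
    intro x hx
    rcases hx.lt_or_eq with hlt | rfl
    · obtain ⟨m, rfl⟩ : ∃ m, n = m + 1 := ⟨n - 1, by omega⟩
      have hpos : 0 < x.2.numEdges := by
        rw [← numEdges_out]
        obtain ⟨e, he⟩ := x.2.out.2.exists_internal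
        have : Nonempty x.2.out.1.internal := ⟨⟨e, he⟩⟩
        exact Nat.card_pos
      obtain ⟨j, hj⟩ : ∃ j, x.2.numEdges = j + 1 := ⟨x.2.numEdges - 1, by omega⟩
      have hA : antipode k (MvPolynomial.X x) = antipodeAux k (j + 1) (MvPolynomial.X x) := by
        simp only [antipode, MvPolynomial.aeval_X, hj]
      rw [hA]
      simp only [antipodeAux, MvPolynomial.aeval_X]
      congr 1
      refine finsum_congr fun γ => ?_
      congr 1
      refine map_ofSub_congr γ fun y hy => ?_
      rw [numEdges_out] at hy
      rw [ih m (by omega) y (by omega), ih j (by omega) y (by omega)]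
    · simp only [antipode, MvPolynomial.aeval_X]

/-- The recursive formula for the antipode. -/
theorem antipode_X (g : Gen) : antipode k (MvPolynomial.X g) = -MvPolynomial.X g -
    ∑ᶠ γ : g.2.out.1.ProperSubgraph, antipode k (ofSub k γ) * ofContract k g.2.out.2 γ := by
  rw [← antipodeAux_X (g.2.numEdges + 1) g (Nat.le_succ _)]
  simp only [antipodeAux, MvPolynomial.aeval_X]
  congr 1
  refine finsum_congr fun γ => ?_
  congr 1
  refine map_ofSub_congr γ fun y hy => ?_
  rw [numEdges_out] at hy
  exact antipodeAux_X _ y hy.le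

variable (k)

/-! ### Green's functions and Slavnov–Taylor elements -/

/-- The sum `∑ Γ / Sym(Γ)` over all 1PI graphs `Γ` with residue `r` and loop number `L`. -/
noncomputable def graphSum (r : Res) (L : ℕ) : GraphAlgebra k :=
  ∑ g ∈ (OnePIClass.finite_loopNumber r L).toFinset,
    (g.symFactor : k)⁻¹ • MvPolynomial.X (⟨r, g⟩ : Gen)

/-- The 1PI Green's functions `G^v = 1 + ∑ Γ / Sym(Γ)` for vertices `v` and
`G^e = 1 - ∑ Γ / Sym(Γ)` for edges `e`, as formal power series in a variable counting loops. -/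
noncomputable def green : Res → PowerSeries (GraphAlgebra k)
  | .inl v => 1 + PowerSeries.mk (graphSum k (.inl v))
  | .inr e => 1 - PowerSeries.mk (graphSum k (.inr e))

/-- The first Slavnov–Taylor element. -/
noncomputable def ST₁ : PowerSeries (GraphAlgebra k) :=
  green k (.inl .gluon3) * green k (.inl .quarkGluon) -
    green k (.inl .gluon4) * green k (.inr .quark)

/-- The second Slavnov–Taylor element. -/
noncomputable def ST₂ : PowerSeries (GraphAlgebra k) :=
  green k (.inl .gluon3) * green k (.inl .ghostGluon) -
    green k (.inl .gluon4) * green k (.inr .ghost)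

/-- The third Slavnov–Taylor element. -/
noncomputable def ST₃ : PowerSeries (GraphAlgebra k) :=
  green k (.inl .gluon3) * green k (.inl .gluon3) -
    green k (.inl .gluon4) * green k (.inr .gluon)

/-- The ideal generated by the Slavnov–Taylor elements, i.e. by their components of all
loop orders. -/
noncomputable def stIdeal : Ideal (GraphAlgebra k) :=
  Ideal.span {x | ∃ L : ℕ, x = PowerSeries.coeff L (ST₁ k) ∨ x = PowerSeries.coeff L (ST₂ k) ∨
    x = PowerSeries.coeff L (ST₃ k)}

/-- The subspace `I ⊗ H + H ⊗ I` of `H ⊗ H`, for an ideal `I` of `H`. -/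
noncomputable def tensorSum (I : Ideal (GraphAlgebra k)) :
    Submodule k (GraphAlgebra k ⊗[k] GraphAlgebra k) :=
  Submodule.span k {t | ∃ x ∈ I, ∃ y, t = x ⊗ₜ[k] y ∨ t = y ⊗ₜ[k] x}

end GraphAlgebra

end QCD

/-!
# The Slavnov–Taylor identities generate a Hopf ideal

The coproduct of a Green's function is computed first. Summing `Δ(Γ)` over all graphs `Γ` of residue
`r`, weighted by symmetry factors, and sorting the terms by the contracted graph `h = Γ / γ` on the
right, one finds on the left all ways of inserting graphs in `h`: at every vertex a vertex graph or
nothing, in every internal edge a chain of self-energy graphs. Hence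
`Δ(∑_Γ Γ / Sym Γ) = (∑_Γ Γ / Sym Γ) ⊗ 1 + ∑_h D(h) ⊗ h / Sym h`, where the dressing `D(h)` is the
product of the Green's functions of the vertices of `h` and of the inverse Green's functions of
its internal edges (`GraphAlgebra.coproduct_graphSum`).

The combinatorial part is a double counting. An insertion in `h` is a `Marking.Filling`: numbers of
bivalent vertices on the internal edges, and a class of graphs for every vertex of the resulting
`Skeleton`; `Skeleton.subst` glues the graph `Γ` from it. An isomorphism from the glued graph to
a given `Γ` determines a subgraph `γ` together with an identification `Γ / γ ≅ h`; conversely every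
such pair arises from exactly one filling, and from as many isomorphisms as the inserted graphs
have automorphisms (`Marking.Filling.existsUnique_presents`, `Marking.Filling.card_presents`,
`Marking.sum_card_iso_filling`). The uniqueness holds because every edge of `Γ / γ` can be followed
in `Γ` through the self-energy components merged into it. The average over labellings in the
definition of `γ` disappears when one sums over all graphs (`GraphAlgebra.sum_average`), and
the fillings have `D(h)` as generating function (`isGeneratingFunction_filling`).

Where the Slavnov–Taylor identities hold, all vertices carry the same coupling `α`, in the sense that
`G^v` is a power of `α` times square roots of the `G^e` of its legs. Counting the ends of lines
gives `D(h) = G^r · (α²)^L` for a graph `h` with residue `r` and `L` loops (`map_dressing`). So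
modulo the identities the coproduct of `G^r(t)` is `G^r(t) ⊗ 1` times `1 ⊗ G^r` with `α² t`
substituted for `t` (`coproduct_green`). As substitution is multiplicative, the Slavnov–Taylor
elements are mapped into `I ⊗ H + H ⊗ I`. In degree `L` only elements of lower degree are needed
on the left, apart from the term `x ⊗ 1`; since `S` is a left convolution inverse of the identity,
induction on `L` gives `S(I) ⊆ I`.
-/

namespace QCD

open FeynmanGraph
open scoped TensorProduct

/-! ### Isomorphisms of graphs from bijections of darts -/

/-- Two maps to one set whose fibres have the same cardinalities differ by a bijection. -/
lemma exists_equiv_comp_eq {A B T : Type*} [Finite A] [Finite B] (f : A → T) (g : B → T)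
    (h : ∀ t, Nat.card {a // f a = t} = Nat.card {b // g b = t}) :
    ∃ e : A ≃ B, ∀ a, g (e a) = f a := by
  have e : ∀ t, {a // f a = t} ≃ {b // g b = t} := fun t =>
    ((Finite.card_eq (α := {a // f a = t}) (β := {b // g b = t})).1 (h t)).some
  refine ⟨(Equiv.sigmaFiberEquiv f).symm.trans
    ((Equiv.sigmaCongrRight e).trans (Equiv.sigmaFiberEquiv g)), fun a => ?_⟩
  exact (e (f a) ⟨a, rfl⟩).2

/-- A bijection that respects the fibres of two surjections descends to their targets. -/
lemma exists_equiv_of_surjective {D D' V V' : Type*} {f : D → V} {f' : D' → V'}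
    (hf : f.Surjective) (hf' : f'.Surjective) (e : D ≃ D')
    (h : ∀ d d', f d = f d' ↔ f' (e d) = f' (e d')) : ∃ ε : V ≃ V', ∀ d, ε (f d) = f' (e d) := by
  choose s hs using hf
  have key : ∀ d, f' (e (s (f d))) = f' (e d) := fun d => (h _ _).1 (hs _)
  refine ⟨Equiv.ofBijective (fun v => f' (e (s v))) ⟨fun v w hvw => ?_, fun v' => ?_⟩, key⟩
  · rw [← hs v, ← hs w]
    exact (h _ _).2 hvw
  · obtain ⟨d', rfl⟩ := hf' v'
    exact ⟨f (e.symm d'), by simp [key]⟩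

namespace FeynmanGraph

variable {r : Res} {Γ Γ' Γ'' : FeynmanGraph r}

lemma vert_surjective (Γ : FeynmanGraph r) : Function.Surjective Γ.vert := by
  intro v
  obtain ⟨t, ht⟩ : ∃ t, 0 < (Γ.vtype v).legs.count t := by
    generalize Γ.vtype v = x
    revert x
    decide
  rw [← Γ.vertex_legs v t, Nat.card_pos_iff] at ht
  obtain ⟨⟨d, hd, -⟩⟩ := ht.1
  exact ⟨d, hd⟩

/-- A bijection of the darts that respects incidence, types and external lines extends to an
isomorphism when every edge carries a dart. -/
lemma exists_iso_of_darts (hΓ : ∀ e, ∃ d, Γ.edge d = e) (hΓ' : ∀ e, ∃ d, Γ'.edge d = e)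
    (f : Γ.D ≃ Γ'.D) (hv : ∀ d d', Γ.vert d = Γ.vert d' ↔ Γ'.vert (f d) = Γ'.vert (f d'))
    (hvt : ∀ d, Γ'.vtype (Γ'.vert (f d)) = Γ.vtype (Γ.vert d))
    (he : ∀ d d', Γ.edge d = Γ.edge d' ↔ Γ'.edge (f d) = Γ'.edge (f d'))
    (het : ∀ d, Γ'.etype (Γ'.edge (f d)) = Γ.etype (Γ.edge d))
    (hext : ∀ k, ∃ d, Γ.ext k = Γ.edge d ∧ Γ'.ext k = Γ'.edge (f d)) :
    ∃ F : Iso Γ Γ', ∀ d, F.onD d = f d := by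
  obtain ⟨φ, hφ⟩ := exists_equiv_of_surjective Γ.vert_surjective Γ'.vert_surjective f hv
  obtain ⟨ψ, hψ⟩ := exists_equiv_of_surjective (f := Γ.edge) (f' := Γ'.edge) hΓ hΓ' f he
  refine ⟨⟨φ, ψ, f, fun v => ?_, fun e => ?_, fun d => (hφ d).symm, fun d => (hψ d).symm,
    fun k => ?_⟩, fun _ => rfl⟩
  · obtain ⟨d, rfl⟩ := Γ.vert_surjective v
    rw [hφ, hvt]
  · obtain ⟨d, rfl⟩ := hΓ e
    rw [hψ, het]
  · obtain ⟨d, h1, h2⟩ := hext k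
    rw [h1, h2, hψ]

lemma Iso.ext_of_darts (hΓ : ∀ e, ∃ d, Γ.edge d = e) {F G : Iso Γ Γ'}
    (h : ∀ d, F.onD d = G.onD d) : F = G := by
  apply Iso.ext
  · ext v
    obtain ⟨d, rfl⟩ := Γ.vert_surjective v
    rw [← F.vert, ← G.vert, h]
  · ext e
    obtain ⟨d, rfl⟩ := hΓ e
    rw [← F.edge, ← G.edge, h]
  · ext d
    exact h d

instance : Finite (Iso Γ Γ') := by
  refine Finite.of_injective (fun F : Iso Γ Γ' => (F.onV, F.onE, F.onD)) fun F G h => ?_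
  simp only [Prod.mk.injEq] at h
  exact Iso.ext h.1 h.2.1 h.2.2

lemma symFactor_pos (Γ : FeynmanGraph r) : 0 < Γ.symFactor :=
  have : Nonempty (Iso Γ Γ) := ⟨.refl Γ⟩
  Nat.card_pos

lemma card_iso_congr_left (f : Iso Γ Γ') : Nat.card (Iso Γ Γ'') = Nat.card (Iso Γ' Γ'') :=
  Nat.card_congr ⟨fun g => f.symm.trans g, fun g => f.trans g,
    fun g => by ext x <;> simp [Iso.trans, Iso.symm],
    fun g => by ext x <;> simp [Iso.trans, Iso.symm]⟩

lemma card_iso_congr_right (f : Iso Γ' Γ'') : Nat.card (Iso Γ Γ') = Nat.card (Iso Γ Γ'') :=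
  Nat.card_congr ⟨fun g => g.trans f, fun g => g.trans f.symm,
    fun g => by ext x <;> simp [Iso.trans, Iso.symm],
    fun g => by ext x <;> simp [Iso.trans, Iso.symm]⟩

lemma Iso.loopNumber_eq (f : Iso Γ Γ') : Γ.loopNumber = Γ'.loopNumber := by
  unfold loopNumber
  rw [f.card_internal, Nat.card_congr f.onV]

lemma Iso.mem_internal (f : Iso Γ Γ') {e : Γ.E} : f.onE e ∈ Γ'.internal ↔ e ∈ Γ.internal := by
  refine not_congr (exists_congr fun k => ?_)
  rw [f.extEdge, Equiv.apply_eq_iff_eq]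

/-! ### Connectivity -/

/-- Linkedness can be tested on the sets of vertices that are closed under adjacency. -/
lemma linked_of_closed {S : Set Γ.E} {v w : Γ.V}
    (h : ∀ Z : Set Γ.V, (∀ d d', Γ.edge d = Γ.edge d' → Γ.edge d ∈ S → Γ.vert d ∈ Z →
      Γ.vert d' ∈ Z) → v ∈ Z → w ∈ Z) : Γ.Linked S v w :=
  h {x | Γ.Linked S v x}
    (fun d d' h1 h2 h3 => Relation.ReflTransGen.tail h3 ⟨d, d', h1, h2, rfl, rfl⟩) .refl

/-- Connected graphs without bridges and without bare external lines.  These are the 1PI graphs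
and the corollas (one vertex, no internal edge). -/
structure IsStable (Γ : FeynmanGraph r) : Prop where
  incident : ∀ e, ∃ d, Γ.edge d = e
  linked : ∀ e v w, Γ.Linked (Γ.internal \ {e}) v w

lemma linked_mono {S T : Set Γ.E} (h : S ⊆ T) {v w : Γ.V} (hl : Γ.Linked S v w) :
    Γ.Linked T v w := by
  refine linked_of_closed fun Z hZ hv => ?_
  exact linked_mem_of_closed (fun d d' h1 h2 => hZ d d' h1 (h h2)) hl hv

lemma IsOnePI.isStable (h : Γ.IsOnePI) : Γ.IsStable := by
  refine ⟨h.incident, fun e v w => ?_⟩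
  by_cases he : e ∈ Γ.internal
  · exact h.linked e he v w
  · obtain ⟨e', he'⟩ := h.exists_internal
    have hsub : Γ.internal \ {e'} ⊆ Γ.internal \ {e} := fun x hx =>
      ⟨hx.1, fun hxe => he (hxe ▸ hx.1)⟩
    exact linked_mono hsub (h.linked e' he' v w)

lemma IsStable.isOnePI (h : Γ.IsStable) (hne : Γ.internal.Nonempty) : Γ.IsOnePI :=
  ⟨hne, h.incident, fun e _ => h.linked e⟩

lemma IsStable.mem_of_closed (h : Γ.IsStable) {Z : Set Γ.V} (hne : Z.Nonempty) (e : Γ.E)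
    (hZ : ∀ d d', Γ.edge d = Γ.edge d' → Γ.edge d ∈ Γ.internal → Γ.edge d ≠ e → Γ.vert d ∈ Z →
      Γ.vert d' ∈ Z) (v : Γ.V) : v ∈ Z := by
  obtain ⟨w, hw⟩ := hne
  exact linked_mem_of_closed (fun d d' h1 h2 => hZ d d' h1 h2.1 h2.2) (h.linked e w v) hw

/-- The dart at the inner end of the `k`-th external line. -/
noncomputable def IsStable.leg (h : Γ.IsStable) (k : Fin r.legs.length) : Γ.D :=
  (h.incident (Γ.ext k)).choose

lemma IsStable.edge_leg (h : Γ.IsStable) (k : Fin r.legs.length) : Γ.edge (h.leg k) = Γ.ext k :=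
  (h.incident (Γ.ext k)).choose_spec

lemma IsStable.ext_injective (h : Γ.IsStable) : Function.Injective Γ.ext := fun k k' hk =>
  ext_unique (h.edge_leg k').symm k hk

lemma IsStable.eq_leg (h : Γ.IsStable) {d : Γ.D} {k : Fin r.legs.length}
    (hd : Γ.edge d = Γ.ext k) : d = h.leg k := by
  have h2 := Γ.edge_ends (Γ.ext k)
  have : Nonempty {k' // Γ.ext k' = Γ.ext k} := ⟨k, rfl⟩
  have h3 := Nat.card_pos (α := {k' // Γ.ext k' = Γ.ext k})
  have h4 : Nat.card {d' // Γ.edge d' = Γ.ext k} ≤ 1 := by omega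
  rw [Finite.card_le_one_iff_subsingleton] at h4
  exact congrArg Subtype.val (Subsingleton.elim (⟨d, hd⟩ : {d' // Γ.edge d' = Γ.ext k})
    ⟨h.leg k, h.edge_leg k⟩)

lemma IsStable.leg_injective (h : Γ.IsStable) : Function.Injective h.leg := fun k k' hk =>
  h.ext_injective (by rw [← h.edge_leg, ← h.edge_leg, hk])

lemma IsStable.edge_leg_notMem (h : Γ.IsStable) (k : Fin r.legs.length) :
    Γ.edge (h.leg k) ∉ Γ.internal := fun hi => hi ⟨k, (h.edge_leg k).symm⟩

lemma IsStable.exists_leg (h : Γ.IsStable) {d : Γ.D} (hd : Γ.edge d ∉ Γ.internal) :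
    ∃ k, d = h.leg k := by
  obtain ⟨k, hk⟩ := not_not.1 hd
  exact ⟨k, h.eq_leg hk.symm⟩

lemma Iso.onD_leg (f : Iso Γ Γ') (h : Γ.IsStable) (h' : Γ'.IsStable) (k : Fin r.legs.length) :
    f.onD (h.leg k) = h'.leg k :=
  h'.eq_leg (by rw [f.edge, h.edge_leg, f.extEdge])

/-- An internal edge has only one end besides a given one. -/
lemma internal_eq_of_darts {d d' d'' : Γ.D} (hd : Γ.edge d ∈ Γ.internal)
    (h' : Γ.edge d' = Γ.edge d) (h'' : Γ.edge d'' = Γ.edge d) (hne' : d' ≠ d) (hne'' : d'' ≠ d) :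
    d' = d'' := by
  by_contra hne
  have h2 := card_darts_of_internal hd
  have h3 : ({d, d', d''} : Set Γ.D).ncard = 3 := by
    rw [Set.ncard_eq_three]
    exact ⟨d, d', d'', hne'.symm, hne''.symm, hne, rfl⟩
  have h4 : ({d, d', d''} : Set Γ.D) ⊆ {x | Γ.edge x = Γ.edge d} := by
    rintro x (rfl | rfl | rfl)
    exacts [rfl, h', h'']
  have h5 := Set.ncard_le_ncard h4 (Set.toFinite _)
  rw [h3, ← Nat.card_coe_set_eq] at h5
  exact absurd (h5.trans_eq h2) (by norm_num)

/-- Without internal edges a stable graph is a corolla: all its darts are the inner ends of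
external lines. -/
lemma IsStable.vert_unique (h : Γ.IsStable) (hi : Γ.internal = ∅) (v w : Γ.V) : v = w := by
  obtain ⟨d, -⟩ := Γ.vert_surjective v
  exact h.mem_of_closed (Z := {v}) ⟨v, rfl⟩ (Γ.edge d)
    (fun d _ _ h2 => by rw [hi] at h2; exact h2.elim) w |>.symm

lemma res_eq_of_count {s s' : Res} (h : ∀ t, s.legs.count t = s'.legs.count t) : s = s' := by
  revert s s'
  decide

/-- The residue of a corolla is the type of its vertex. -/
lemma IsStable.res_eq (h : Γ.IsStable) (hi : Γ.internal = ∅) (v : Γ.V) :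
    r = .inl (Γ.vtype v) := by
  refine res_eq_of_count fun t => ?_
  change _ = (Γ.vtype v).legs.count t
  rw [← Γ.vertex_legs v t, ← card_get_eq_count]
  refine Nat.card_congr (Equiv.ofBijective (fun k => ⟨h.leg k.1, h.vert_unique hi _ _, ?_⟩) ⟨?_, ?_⟩)
  · rw [h.edge_leg, Γ.ext_type, k.2]
  · intro k k' hk
    exact Subtype.ext (h.leg_injective (congrArg Subtype.val hk))
  · rintro ⟨d, -, hd⟩
    obtain ⟨k, rfl⟩ := h.exists_leg (d := d) (by rw [hi]; exact id)
    exact ⟨⟨k, by rw [← Γ.ext_type, ← h.edge_leg, hd]⟩, rfl⟩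

/-- A 1PI graph contains at least one loop: it stays connected when one internal edge is removed, so
that there are at least `#V - 1` other internal edges. -/
lemma IsOnePI.one_le_loopNumber (h : Γ.IsOnePI) : 1 ≤ Γ.loopNumber := by
  classical
  obtain ⟨e₀, he₀⟩ := h.exists_internal
  let S : Set Γ.E := Γ.internal \ {e₀}
  let G : SimpleGraph Γ.V := SimpleGraph.fromRel (Γ.Adj S)
  have hconn : G.Connected := by
    obtain ⟨d, -⟩ := h.incident e₀
    have : Nonempty Γ.V := ⟨Γ.vert d⟩
    refine ⟨fun v w => ?_⟩
    have hl := h.linked e₀ he₀ v w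
    induction hl with
    | refl => rfl
    | @tail b c _ hab ih =>
      by_cases hbc : b = c
      · exact hbc ▸ ih
      · exact ih.trans (SimpleGraph.Adj.reachable ((SimpleGraph.fromRel_adj _ _ _).2
          ⟨hbc, .inl hab⟩))
  have h1 := hconn.card_vert_le_card_edgeSet_add_one
  -- distinct edges of the underlying simple graph come from distinct internal edges
  have hsel : ∀ s : G.edgeSet, ∃ e : S, ∃ d d', d ≠ d' ∧ Γ.edge d = e.1 ∧ Γ.edge d' = e.1 ∧
      s.1 = s(Γ.vert d, Γ.vert d') := by
    rintro ⟨s, hs⟩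
    induction s using Sym2.ind with
    | _ a b =>
      rw [SimpleGraph.mem_edgeSet, SimpleGraph.fromRel_adj] at hs
      rcases hs with ⟨hne, ⟨d, d', h1, h2, rfl, rfl⟩ | ⟨d, d', h1, h2, rfl, rfl⟩⟩
      · exact ⟨⟨_, h2⟩, d, d', fun h => hne (h ▸ rfl), rfl, h1.symm, rfl⟩
      · exact ⟨⟨_, h2⟩, d, d', fun h => hne (h ▸ rfl), rfl, h1.symm, Sym2.eq_swap⟩
  choose sel d d' hne h2 h3 h4 using hsel
  have hinj : Function.Injective sel := by
    intro s t hst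
    apply Subtype.ext
    rw [h4 s, h4 t]
    have hs : Γ.edge (d s) ∈ Γ.internal := by rw [h2]; exact (sel s).2.1
    have e1 : Γ.edge (d t) = Γ.edge (d s) := by rw [h2, h2, hst]
    have e2 : Γ.edge (d' t) = Γ.edge (d s) := by rw [h2, h3, hst]
    have e3 : Γ.edge (d' s) = Γ.edge (d s) := by rw [h2, h3]
    by_cases hd : d t = d s
    · rw [hd, internal_eq_of_darts hs e3 e2 (hne s).symm (fun h => hne t (hd.trans h.symm))]
    · have hd' : d t = d' s := internal_eq_of_darts hs e1 e3 hd (hne s).symm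
      have : d' t = d s := by
        by_contra hcon
        exact hne t (internal_eq_of_darts hs e1 e2 hd hcon)
      rw [hd', this, Sym2.eq_swap]
  have h5 := Nat.card_le_card_of_injective sel hinj
  have h6 : Nat.card S + 1 = Nat.card Γ.internal := by
    rw [Nat.card_coe_set_eq, Nat.card_coe_set_eq]
    exact Set.ncard_sdiff_singleton_add_one he₀ (Set.toFinite _)
  unfold loopNumber
  omega

end FeynmanGraph

/-! ### Skeletons and substitution of graphs for their vertices -/

/-- A connected graph without bridges and without bare external lines: a 1PI graph or a corolla. -/
abbrev StableGraph (r : Res) := {Γ : FeynmanGraph r // Γ.IsStable}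

/-- A graph whose vertices have types in all of `R` (a vertex of type an edge of QCD is a
bivalent vertex), the darts at each vertex `w` being labelled by the legs of its type.  So the
darts are the pairs `(w, k)` of a vertex and a leg of its type. -/
structure Skeleton (r : Res) where
  W : Type
  F : Type
  [finW : Finite W]
  [finF : Finite F]
  wtype : W → Res
  etype : F → Line
  edge : ((w : W) × Fin (wtype w).legs.length) → F
  ext : Fin r.legs.length → F
  edge_ends : ∀ f, Nat.card {p // edge p = f} + Nat.card {k // ext k = f} = 2
  edge_type : ∀ p, etype (edge p) = (wtype p.1).legs.get p.2
  ext_type : ∀ k, etype (ext k) = r.legs.get k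

namespace Skeleton

attribute [instance] finW finF

variable {r : Res} (Q : Skeleton r)

/-- The darts of a skeleton. -/
abbrev P := (w : Q.W) × Fin (Q.wtype w).legs.length

/-- A skeleton that is connected and remains so after removal of any internal edge. -/
def IsStable : Prop := ∀ f (Z : Set Q.W), Z.Nonempty →
  (∀ p p' : Q.P, Q.edge p = Q.edge p' → Q.edge p ∉ Set.range Q.ext → Q.edge p ≠ f →
    p.1 ∈ Z → p'.1 ∈ Z) → ∀ w, w ∈ Z

variable (K : ∀ w, StableGraph (Q.wtype w))

open Classical in
/-- The edge of the substituted graph that carries a given dart: external lines of `K w` become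
edges of the skeleton. -/
noncomputable def substEdge (d : (w : Q.W) × (K w).1.D) : Q.F ⊕ ((w : Q.W) × (K w).1.internal) :=
  if h : ∃ k, (K d.1).1.ext k = (K d.1).1.edge d.2 then .inl (Q.edge ⟨d.1, h.choose⟩)
  else .inr ⟨d.1, ⟨(K d.1).1.edge d.2, h⟩⟩

variable {Q} in
lemma substEdge_leg (w : Q.W) (k : Fin (Q.wtype w).legs.length) :
    Q.substEdge K ⟨w, (K w).2.leg k⟩ = .inl (Q.edge ⟨w, k⟩) := by
  have h : ∃ k', (K w).1.ext k' = (K w).1.edge ((K w).2.leg k) := ⟨k, ((K w).2.edge_leg k).symm⟩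
  refine (dif_pos h).trans ?_
  rw [(K w).2.ext_injective (h.choose_spec.trans ((K w).2.edge_leg k))]

variable {Q} in
lemma substEdge_internal (w : Q.W) (d : (K w).1.D) (h : (K w).1.edge d ∈ (K w).1.internal) :
    Q.substEdge K ⟨w, d⟩ = .inr ⟨w, ⟨(K w).1.edge d, h⟩⟩ := dif_neg h

variable {Q} in
lemma substEdge_eq_inl {w : Q.W} {d : (K w).1.D} {f : Q.F}
    (h : Q.substEdge K ⟨w, d⟩ = .inl f) : ∃ k, d = (K w).2.leg k ∧ Q.edge ⟨w, k⟩ = f := by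
  by_cases hd : (K w).1.edge d ∈ (K w).1.internal
  · rw [substEdge_internal K w d hd] at h
    cases h
  · obtain ⟨k, rfl⟩ := (K w).2.exists_leg hd
    rw [substEdge_leg] at h
    exact ⟨k, rfl, Sum.inl.inj h⟩

variable {Q} in
lemma substEdge_eq_inr {d : (w : Q.W) × (K w).1.D} {w : Q.W} {e : (K w).1.internal}
    (h : Q.substEdge K d = .inr ⟨w, e⟩) : ∃ x, d = ⟨w, x⟩ ∧ (K w).1.edge x = e := by
  obtain ⟨w', d⟩ := d
  by_cases hd : (K w').1.edge d ∈ (K w').1.internal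
  · rw [substEdge_internal K w' d hd] at h
    cases h
    exact ⟨d, rfl, rfl⟩
  · obtain ⟨k, rfl⟩ := (K w').2.exists_leg hd
    rw [substEdge_leg] at h
    cases h

/-- The graph obtained from a skeleton by substituting the graph `K w` for every vertex `w`, the
`k`-th external line of `K w` being glued to the `k`-th dart at `w`. -/
noncomputable def subst : FeynmanGraph r where
  V := (w : Q.W) × (K w).1.V
  E := Q.F ⊕ ((w : Q.W) × (K w).1.internal)
  D := (w : Q.W) × (K w).1.D
  vtype v := (K v.1).1.vtype v.2
  etype := Sum.elim Q.etype (fun e => (K e.1).1.etype e.2)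
  vert d := ⟨d.1, (K d.1).1.vert d.2⟩
  edge := Q.substEdge K
  ext k := .inl (Q.ext k)
  edge_ends e := by
    rcases e with f | ⟨w, e⟩
    · rw [← Q.edge_ends f]
      congr 1
      · refine Nat.card_congr (Equiv.ofBijective
          (fun p => ⟨⟨p.1.1, (K p.1.1).2.leg p.1.2⟩,
            (substEdge_leg K p.1.1 p.1.2).trans (congrArg Sum.inl p.2)⟩) ⟨?_, ?_⟩) |>.symm
        · rintro ⟨⟨w, k⟩, hp⟩ ⟨⟨w', k'⟩, hp'⟩ h
          have h1 := congrArg Subtype.val h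
          simp only [Sigma.mk.injEq] at h1
          obtain ⟨rfl, h2⟩ := h1
          obtain rfl := (K w).2.leg_injective (eq_of_heq h2)
          rfl
        · rintro ⟨⟨w, d⟩, hd⟩
          obtain ⟨k, rfl, hf⟩ := substEdge_eq_inl K hd
          exact ⟨⟨⟨w, k⟩, hf⟩, rfl⟩
      · exact Nat.card_congr (Equiv.subtypeEquivRight fun k => ⟨Sum.inl.inj, congrArg _⟩)
    · have : IsEmpty {k // (Sum.inl (Q.ext k) : Q.F ⊕ ((w : Q.W) × (K w).1.internal)) =
          .inr ⟨w, e⟩} := ⟨fun k => by simpa using k.2⟩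
      rw [Nat.card_of_isEmpty (α := {k // (Sum.inl (Q.ext k) :
        Q.F ⊕ ((w : Q.W) × (K w).1.internal)) = .inr ⟨w, e⟩}), add_zero,
        ← card_darts_of_internal e.2]
      refine Nat.card_congr (Equiv.ofBijective (fun x => ⟨⟨w, x.1⟩, by
        have hx : (K w).1.edge x.1 ∈ (K w).1.internal := by rw [x.2]; exact e.2
        rw [substEdge_internal K w _ hx]
        congr 2
        exact Subtype.ext x.2⟩) ⟨?_, ?_⟩) |>.symm
      · intro x y h
        have h1 := congrArg Subtype.val h
        simp only [Sigma.mk.injEq, heq_eq_eq, true_and] at h1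
        exact Subtype.ext h1
      · rintro ⟨d, hd⟩
        obtain ⟨x, rfl, hx⟩ := substEdge_eq_inr K hd
        exact ⟨⟨x, hx⟩, rfl⟩
  vertex_legs v t := by
    obtain ⟨w, v⟩ := v
    have htype : ∀ d : (w : Q.W) × (K w).1.D,
        Sum.elim Q.etype (fun e : (w : Q.W) × (K w).1.internal => (K e.1).1.etype e.2)
          (Q.substEdge K d) = (K d.1).1.etype ((K d.1).1.edge d.2) := by
      rintro ⟨w, d⟩
      by_cases hd : (K w).1.edge d ∈ (K w).1.internal
      · rw [substEdge_internal K w d hd]; rfl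
      · obtain ⟨k, rfl⟩ := (K w).2.exists_leg hd
        rw [substEdge_leg, (K w).2.edge_leg, (K w).1.ext_type]
        exact Q.edge_type ⟨w, k⟩
    simp only [htype]
    rw [← (K w).1.vertex_legs v t]
    refine Nat.card_congr (Equiv.ofBijective (fun x => ⟨⟨w, x.1⟩, by rw [x.2.1], x.2.2⟩)
      ⟨?_, ?_⟩) |>.symm
    · intro x y h
      have h1 := congrArg Subtype.val h
      simp only [Sigma.mk.injEq, heq_eq_eq, true_and] at h1
      exact Subtype.ext h1
    · rintro ⟨⟨w', d⟩, hd, ht⟩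
      simp only [Sigma.mk.injEq] at hd
      obtain ⟨rfl, hd⟩ := hd
      exact ⟨⟨d, eq_of_heq hd, ht⟩, rfl⟩
  ext_type := Q.ext_type

variable {Q K}

/-- A dart of the substituted graph. -/
def dart (w : Q.W) (d : (K w).1.D) : (Q.subst K).D := ⟨w, d⟩

/-- A vertex of the substituted graph. -/
def vtx (w : Q.W) (v : (K w).1.V) : (Q.subst K).V := ⟨w, v⟩

/-- An edge of the skeleton as an edge of the substituted graph. -/
def outer (f : Q.F) : (Q.subst K).E := .inl f

/-- An internal edge of a piece as an edge of the substituted graph. -/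
def inner (w : Q.W) (e : (K w).1.internal) : (Q.subst K).E := .inr ⟨w, e⟩

lemma dart_inj {w : Q.W} {d d' : (K w).1.D} : dart w d = dart w d' ↔ d = d' :=
  ⟨fun h => eq_of_heq (Sigma.mk.inj h).2, congrArg _⟩

lemma dart_eq {w w' : Q.W} {d : (K w).1.D} {d' : (K w').1.D} (h : dart w d = dart w' d') :
    w = w' := congrArg Sigma.fst h

lemma vtx_inj {w : Q.W} {v v' : (K w).1.V} : vtx w v = vtx w v' ↔ v = v' :=
  ⟨fun h => eq_of_heq (Sigma.mk.inj h).2, congrArg _⟩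

lemma vtx_eq {w w' : Q.W} {v : (K w).1.V} {v' : (K w').1.V} (h : vtx w v = vtx w' v') :
    w = w' := congrArg Sigma.fst h

lemma outer_inj {f f' : Q.F} : (outer f : (Q.subst K).E) = outer f' ↔ f = f' :=
  ⟨Sum.inl.inj, congrArg _⟩

lemma inner_inj {w : Q.W} {e e' : (K w).1.internal} :
    (inner w e : (Q.subst K).E) = inner w e' ↔ e = e' :=
  ⟨fun h => eq_of_heq (Sigma.mk.inj (Sum.inr.inj h)).2, congrArg _⟩

lemma inner_eq {w w' : Q.W} {e : (K w).1.internal} {e' : (K w').1.internal}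
    (h : (inner w e : (Q.subst K).E) = inner w' e') : w = w' :=
  congrArg Sigma.fst (Sum.inr.inj h)

lemma outer_ne_inner {f : Q.F} {w : Q.W} {e : (K w).1.internal} :
    (outer f : (Q.subst K).E) ≠ inner w e := fun h => by cases h

lemma exists_eq_dart (x : (Q.subst K).D) : ∃ w d, x = dart w d := ⟨x.1, x.2, rfl⟩

lemma exists_eq_vtx (x : (Q.subst K).V) : ∃ w v, x = vtx w v := ⟨x.1, x.2, rfl⟩

lemma edge_cases (x : (Q.subst K).E) : (∃ f, x = outer f) ∨ ∃ w e, x = inner w e := by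
  rcases x with f | ⟨w, e⟩
  · exact .inl ⟨f, rfl⟩
  · exact .inr ⟨w, e, rfl⟩

lemma vert_dart (w : Q.W) (d : (K w).1.D) :
    (Q.subst K).vert (dart w d) = vtx w ((K w).1.vert d) := rfl

lemma vtype_vtx (w : Q.W) (v : (K w).1.V) : (Q.subst K).vtype (vtx w v) = (K w).1.vtype v := rfl

lemma subst_ext (k : Fin r.legs.length) : (Q.subst K).ext k = outer (Q.ext k) := rfl

lemma edge_dart_leg (w : Q.W) (k : Fin (Q.wtype w).legs.length) :
    (Q.subst K).edge (dart w ((K w).2.leg k)) = outer (Q.edge ⟨w, k⟩) := substEdge_leg K w k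

lemma edge_dart_internal (w : Q.W) (d : (K w).1.D) (h : (K w).1.edge d ∈ (K w).1.internal) :
    (Q.subst K).edge (dart w d) = inner w ⟨(K w).1.edge d, h⟩ := substEdge_internal K w d h

lemma mem_internal_of_edge_eq_inner {w w' : Q.W} {d : (K w).1.D} {e : (K w').1.internal}
    (h : (Q.subst K).edge (dart w d) = inner w' e) : (K w).1.edge d ∈ (K w).1.internal := by
  by_contra hd
  obtain ⟨k, rfl⟩ := (K w).2.exists_leg hd
  rw [edge_dart_leg] at h
  exact outer_ne_inner h

lemma etype_edge_dart (w : Q.W) (d : (K w).1.D) :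
    (Q.subst K).etype ((Q.subst K).edge (dart w d)) = (K w).1.etype ((K w).1.edge d) := by
  by_cases hd : (K w).1.edge d ∈ (K w).1.internal
  · rw [edge_dart_internal w d hd]; rfl
  · obtain ⟨k, rfl⟩ := (K w).2.exists_leg hd
    rw [edge_dart_leg, (K w).2.edge_leg, (K w).1.ext_type]
    exact Q.edge_type ⟨w, k⟩

lemma outer_mem_internal {f : Q.F} :
    (outer f : (Q.subst K).E) ∈ (Q.subst K).internal ↔ f ∉ Set.range Q.ext :=
  not_congr (exists_congr fun _ => ⟨Sum.inl.inj, congrArg _⟩)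

lemma inner_mem_internal (w : Q.W) (e : (K w).1.internal) :
    (inner w e : (Q.subst K).E) ∈ (Q.subst K).internal := by
  rintro ⟨k, hk⟩
  cases hk

lemma subst_incident (hinc : ∀ f, ∃ p, Q.edge p = f) (x : (Q.subst K).E) :
    ∃ d, (Q.subst K).edge d = x := by
  rcases edge_cases x with ⟨f, rfl⟩ | ⟨w, e, rfl⟩
  · obtain ⟨p, rfl⟩ := hinc f
    exact ⟨_, edge_dart_leg p.1 p.2⟩
  · obtain ⟨d, hd⟩ := (K w).2.incident e
    have hd' : (K w).1.edge d ∈ (K w).1.internal := by rw [hd]; exact e.2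
    refine ⟨_, (edge_dart_internal w d hd').trans ?_⟩
    rw [inner_inj]
    exact Subtype.ext hd

/-- Substitution of stable graphs in a stable skeleton yields a stable graph: a set of vertices
closed under adjacency is a union of full `K w`'s, hence comes from a closed set of vertices of
the skeleton. -/
lemma subst_isStable (hQ : Q.IsStable) (hinc : ∀ f, ∃ p, Q.edge p = f) :
    (Q.subst K).IsStable := by
  refine ⟨subst_incident hinc, fun f v w => linked_of_closed fun Z hZ hv => ?_⟩
  -- a piece that meets `Z` lies in `Z`; the removed edge is at most one edge `e` of the piece
  have hfull : ∀ w (x y : (K w).1.V), vtx w x ∈ Z → vtx w y ∈ Z := by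
    intro w x y hx
    obtain ⟨d₀, -⟩ := (K w).1.vert_surjective x
    obtain ⟨e, he⟩ : ∃ e, ∀ (e' : (K w).1.internal), f = inner w e' → e'.1 = e := by
      by_cases h : ∃ e' : (K w).1.internal, f = inner w e'
      · obtain ⟨e, rfl⟩ := h
        exact ⟨e, fun e' he' => by rw [inner_inj.1 he']⟩
      · exact ⟨(K w).1.edge d₀, fun e' he' => (h ⟨e', he'⟩).elim⟩
    refine (K w).2.mem_of_closed (Z := {y | vtx w y ∈ Z}) ⟨x, hx⟩ e ?_ y
    intro d d' h1 h2 h3 h4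
    have h2' : (K w).1.edge d' ∈ (K w).1.internal := h1 ▸ h2
    refine hZ (dart w d) (dart w d') ?_ ⟨?_, ?_⟩ h4
    · rw [edge_dart_internal w d h2, edge_dart_internal w d' h2', inner_inj]
      exact Subtype.ext h1
    · rw [edge_dart_internal w d h2]
      exact inner_mem_internal _ _
    · intro hf
      exact h3 (he ⟨_, h2⟩ (hf.symm.trans (edge_dart_internal w d h2)))
  -- likewise the removed edge is at most one edge `f'` of the skeleton
  obtain ⟨f', hf'⟩ : ∃ f', ∀ f'', f = outer f'' → f'' = f' := by
    rcases edge_cases f with ⟨f, rfl⟩ | ⟨w, e, rfl⟩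
    · exact ⟨f, fun f'' h => (outer_inj.1 h).symm⟩
    · exact ⟨Q.ext ⟨0, r.legs_length_pos⟩, fun f'' h => (outer_ne_inner h.symm).elim⟩
  obtain ⟨w₀, v₀, rfl⟩ := exists_eq_vtx v
  obtain ⟨w₁, v₁, rfl⟩ := exists_eq_vtx w
  have key := hQ f' {w | ∃ x, vtx w x ∈ Z} ⟨w₀, v₀, hv⟩ ?_ w₁
  · obtain ⟨x, hx⟩ := key
    exact hfull _ _ _ hx
  · rintro ⟨w, k⟩ ⟨w', k'⟩ h1 h2 h3 ⟨x, hx⟩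
    refine ⟨_, hZ (dart w ((K w).2.leg k)) (dart w' ((K w').2.leg k')) ?_ ⟨?_, ?_⟩
      (hfull _ _ _ hx)⟩
    · rw [edge_dart_leg, edge_dart_leg, h1]
    · rw [edge_dart_leg]
      exact outer_mem_internal.2 h2
    · intro hf
      exact h3 (hf' _ (hf.symm.trans (edge_dart_leg w k)))

/-- The loop number of a skeleton. -/
noncomputable def loopNumber (Q : Skeleton r) : ℤ :=
  (Nat.card {f // f ∉ Set.range Q.ext} : ℤ) - Nat.card Q.W + 1

lemma loopNumber_subst [Fintype Q.W] :
    (Q.subst K).loopNumber = Q.loopNumber + ∑ w, (K w).1.loopNumber := by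
  have e : (Q.subst K).internal ≃ {f // f ∉ Set.range Q.ext} ⊕ ((w : Q.W) × (K w).1.internal) :=
    (Equiv.subtypeSum (p := fun e => e ∈ (Q.subst K).internal)).trans (Equiv.sumCongr
      (Equiv.subtypeEquivRight fun f => outer_mem_internal)
      (Equiv.subtypeUnivEquiv fun x => inner_mem_internal x.1 x.2))
  have hV : Nat.card (Q.subst K).V = ∑ w, Nat.card (K w).1.V := Nat.card_sigma
  unfold FeynmanGraph.loopNumber loopNumber
  rw [Nat.card_congr e, hV, Nat.card_sum, Nat.card_sigma, Finset.sum_add_distrib,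
    Finset.sum_sub_distrib]
  simp
  ring

/-! ### Isomorphisms of substituted graphs -/

variable {K' : ∀ w, StableGraph (Q.wtype w)}

/-- Isomorphisms `K w ≅ K' w` for all `w` induce an isomorphism of the substituted graphs. -/
noncomputable def substIso (α : ∀ w, Iso (K w).1 (K' w).1) : Iso (Q.subst K) (Q.subst K') where
  onV := Equiv.sigmaCongrRight fun w => (α w).onV
  onE := Equiv.sumCongr (.refl _) (Equiv.sigmaCongrRight fun w =>
    (α w).onE.subtypeEquiv fun _ => (α w).mem_internal.symm)
  onD := Equiv.sigmaCongrRight fun w => (α w).onD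
  vtype v := (α v.1).vtype v.2
  etype e := by
    rcases e with f | ⟨w, e⟩
    · rfl
    · exact (α w).etype e
  vert d := congrArg (vtx d.1) ((α d.1).vert d.2)
  edge d := by
    obtain ⟨w, d, rfl⟩ := exists_eq_dart d
    change (Q.subst K').edge (dart w ((α w).onD d)) = _
    by_cases hd : (K w).1.edge d ∈ (K w).1.internal
    · rw [edge_dart_internal w d hd, edge_dart_internal w _
        (by rw [(α w).edge]; exact (α w).mem_internal.2 hd)]
      simp only [(α w).edge]
      rfl
    · obtain ⟨k, rfl⟩ := (K w).2.exists_leg hd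
      rw [(α w).onD_leg (K w).2 (K' w).2, edge_dart_leg, edge_dart_leg]
      rfl
  extEdge k := rfl

lemma substIso_onD (α : ∀ w, Iso (K w).1 (K' w).1) (w : Q.W) (d : (K w).1.D) :
    (substIso α).onD (dart w d) = dart w ((α w).onD d) := rfl

lemma substIso_onE_inner (α : ∀ w, Iso (K w).1 (K' w).1) (w : Q.W) (e : (K w).1.internal) :
    (substIso α).onE (inner w e) = inner w ⟨(α w).onE e, (α w).mem_internal.2 e.2⟩ := rfl

/-- An isomorphism of substituted graphs that fixes the darts of the skeleton maps every piece to
itself: moving along an internal edge of a piece, one never leaves through a leg. -/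
lemma exists_onD_eq_of_fix_legs (f : Iso (Q.subst K) (Q.subst K'))
    (hf : ∀ w k, f.onD (dart w ((K w).2.leg k)) = dart w ((K' w).2.leg k)) (w : Q.W)
    (d : (K w).1.D) : ∃ x, f.onD (dart w d) = dart w x := by
  have hV : ∀ d : (K w).1.D, (∃ x, f.onD (dart w d) = dart w x) ↔
      ∃ x, f.onV (vtx w ((K w).1.vert d)) = vtx w x := by
    intro d
    have h := f.vert (dart w d)
    rw [vert_dart] at h
    rw [← h]
    obtain ⟨w', y, hy⟩ := exists_eq_dart (f.onD (dart w d))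
    rw [hy, vert_dart]
    constructor
    · rintro ⟨x, hx⟩
      obtain rfl := dart_eq hx
      exact ⟨_, rfl⟩
    · rintro ⟨x, hx⟩
      obtain rfl := vtx_eq hx
      exact ⟨_, rfl⟩
  have k₀ : Fin (Q.wtype w).legs.length := ⟨0, (Q.wtype w).legs_length_pos⟩
  rw [hV]
  refine (K w).2.mem_of_closed (Z := {v | ∃ x, f.onV (vtx w v) = vtx w x})
    ⟨(K w).1.vert ((K w).2.leg k₀), ?_⟩ ((K w).1.edge ((K w).2.leg k₀)) ?_ ((K w).1.vert d)
  · exact (hV _).1 ⟨_, hf _ _⟩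
  · intro d d' h1 h2 _ h4
    obtain ⟨x, hx⟩ := (hV d).2 h4
    refine (hV d').1 ?_
    have hedge : (Q.subst K').edge (f.onD (dart w d)) = (Q.subst K').edge (f.onD (dart w d')) := by
      rw [f.edge, f.edge, edge_dart_internal w d h2, edge_dart_internal w d' (h1 ▸ h2)]
      congr 2
      exact Subtype.ext h1
    by_cases hxi : (K' w).1.edge x ∈ (K' w).1.internal
    · obtain ⟨w', y, hy⟩ := exists_eq_dart (f.onD (dart w d'))
      rw [hx, hy, edge_dart_internal w x hxi] at hedge
      have hyi := mem_internal_of_edge_eq_inner hedge.symm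
      rw [edge_dart_internal w' y hyi] at hedge
      obtain rfl := inner_eq hedge
      exact ⟨y, hy⟩
    · obtain ⟨k, rfl⟩ := (K' w).2.exists_leg hxi
      rw [← hf w k, f.onD.apply_eq_iff_eq, dart_inj] at hx
      rw [hx] at h2
      exact ((K w).2.edge_leg_notMem k h2).elim

/-- An isomorphism of substituted graphs that fixes the darts of the skeleton restricts to
isomorphisms of the substituted pieces: each piece is connected and has an external line. -/
lemma exists_substIso (f : Iso (Q.subst K) (Q.subst K')) (hinc : ∀ f, ∃ p, Q.edge p = f)
    (hf : ∀ w k, f.onD (dart w ((K w).2.leg k)) = dart w ((K' w).2.leg k)) :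
    ∃ α : ∀ w, Iso (K w).1 (K' w).1, f = substIso α := by
  have hf' : ∀ w k, f.symm.onD (dart w ((K' w).2.leg k)) = dart w ((K w).2.leg k) := fun w k => by
    rw [← hf]
    exact f.onD.symm_apply_apply _
  choose β hβ using exists_onD_eq_of_fix_legs f hf
  choose β' hβ' using exists_onD_eq_of_fix_legs f.symm hf'
  let e : ∀ w, (K w).1.D ≃ (K' w).1.D := fun w =>
    ⟨β w, β' w, fun x => by
      rw [← dart_inj (K := K), ← hβ', ← hβ]; exact f.onD.symm_apply_apply _, fun x => by
      rw [← dart_inj (K := K'), ← hβ, ← hβ']; exact f.onD.apply_symm_apply _⟩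
  have he : ∀ w d, f.onD (dart w d) = dart w (e w d) := hβ
  have hleg : ∀ w k, e w ((K w).2.leg k) = (K' w).2.leg k := fun w k => by
    rw [← dart_inj (K := K'), ← he, hf]
  have hin : ∀ w d, (K' w).1.edge (e w d) ∈ (K' w).1.internal ↔
      (K w).1.edge d ∈ (K w).1.internal := by
    intro w d
    constructor
    · intro h
      by_contra hcon
      obtain ⟨k, rfl⟩ := (K w).2.exists_leg hcon
      rw [hleg] at h
      exact (K' w).2.edge_leg_notMem k h
    · intro h
      by_contra hcon
      obtain ⟨k, hk⟩ := (K' w).2.exists_leg hcon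
      rw [← hleg, (e w).apply_eq_iff_eq] at hk
      rw [hk] at h
      exact (K w).2.edge_leg_notMem k h
  have hiso : ∀ w, ∃ α : Iso (K w).1 (K' w).1, ∀ d, α.onD d = e w d := by
    intro w
    refine exists_iso_of_darts (K w).2.incident (K' w).2.incident (e w) ?_ ?_ ?_ ?_ ?_
    · intro d d'
      rw [← vtx_inj (K := K), ← vtx_inj (K := K'), ← vert_dart, ← vert_dart, ← vert_dart,
        ← vert_dart, ← he, ← he, f.vert, f.vert, f.onV.apply_eq_iff_eq]
    · intro d
      have h := f.vtype ((Q.subst K).vert (dart w d))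
      rwa [← f.vert, he] at h
    · intro d d'
      by_cases hd : (K w).1.edge d ∈ (K w).1.internal
      · by_cases hd' : (K w).1.edge d' ∈ (K w).1.internal
        · have h : (K w).1.edge d = (K w).1.edge d' ↔
              (Q.subst K).edge (dart w d) = (Q.subst K).edge (dart w d') := by
            rw [edge_dart_internal w d hd, edge_dart_internal w d' hd', inner_inj,
              Subtype.mk.injEq]
          have h' : (K' w).1.edge (e w d) = (K' w).1.edge (e w d') ↔
              (Q.subst K').edge (dart w (e w d)) = (Q.subst K').edge (dart w (e w d')) := by
            rw [edge_dart_internal w _ ((hin w d).2 hd), edge_dart_internal w _ ((hin w d').2 hd'),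
              inner_inj, Subtype.mk.injEq]
          rw [h, h', ← he, ← he, f.edge, f.edge, f.onE.apply_eq_iff_eq]
        · exact ⟨fun h => (hd' (h ▸ hd)).elim,
            fun h => (hd' ((hin w d').1 (h ▸ (hin w d).2 hd))).elim⟩
      · obtain ⟨k, rfl⟩ := (K w).2.exists_leg hd
        rw [hleg, (K w).2.edge_leg, (K' w).2.edge_leg]
        constructor
        · intro h
          rw [(K w).2.eq_leg h.symm, hleg, (K' w).2.edge_leg]
        · intro h
          have := (K' w).2.eq_leg h.symm
          rw [← hleg, (e w).apply_eq_iff_eq] at this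
          rw [this, (K w).2.edge_leg]
    · intro d
      have h := f.etype ((Q.subst K).edge (dart w d))
      rwa [← f.edge, he, etype_edge_dart, etype_edge_dart] at h
    · exact fun k => ⟨(K w).2.leg k, ((K w).2.edge_leg k).symm, by rw [hleg, (K' w).2.edge_leg]⟩
  choose α hα using hiso
  refine ⟨α, Iso.ext_of_darts (subst_incident hinc) fun d => ?_⟩
  obtain ⟨w, d, rfl⟩ := exists_eq_dart d
  rw [he, substIso_onD, hα]

/-- The isomorphisms to a fixed graph that agree with a given one on the darts of the skeleton
form a torsor under the automorphisms of the pieces. -/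
lemma card_iso_eq_on_legs {Γ : FeynmanGraph r} [Fintype Q.W] (hinc : ∀ f, ∃ p, Q.edge p = f)
    (F₀ : Iso (Q.subst K) Γ) :
    Nat.card {F : Iso (Q.subst K) Γ //
      ∀ w k, F.onD (dart w ((K w).2.leg k)) = F₀.onD (dart w ((K w).2.leg k))} =
    ∏ w, (K w).1.symFactor := by
  unfold symFactor
  rw [← Nat.card_pi]
  have hmem : ∀ (α : ∀ w, Iso (K w).1 (K w).1) w k,
      ((substIso α).trans F₀).onD (dart w ((K w).2.leg k)) =
        F₀.onD (dart w ((K w).2.leg k)) := fun α w k => by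
    change F₀.onD ((substIso α).onD _) = _
    rw [substIso_onD, (α w).onD_leg (K w).2 (K w).2]
  refine (Nat.card_congr (Equiv.ofBijective (fun α => ⟨(substIso α).trans F₀, hmem α⟩)
    ⟨fun α β h => ?_, fun G => ?_⟩)).symm
  · funext w
    refine Iso.ext_of_darts (K w).2.incident fun d => ?_
    have h1 := congrArg (fun G => G.1.onD (dart w d)) h
    have h2 := F₀.onD.injective h1
    rwa [substIso_onD, substIso_onD, dart_inj] at h2
  · obtain ⟨α, hα⟩ := exists_substIso (G.1.trans F₀.symm) hinc (fun w k => by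
      change F₀.onD.symm (G.1.onD _) = _
      rw [G.2, Equiv.symm_apply_apply])
    refine ⟨α, Subtype.ext ?_⟩
    dsimp only
    rw [← hα]
    ext x <;> simp [Iso.trans, Iso.symm]

end Skeleton

/-! ### Subdivision of the edges of a graph by bivalent vertices -/

namespace FeynmanGraph

variable {r : Res}

/-- A choice of a labelling of the darts at each vertex by the legs of its type, and of an
orientation of each edge, under which every edge starts at a dart (so that the external end of an
external edge is its final end, marked `true`). -/
structure Marking (Γ : FeynmanGraph r) where
  lab : ∀ v, Fin (Res.legs (.inl (Γ.vtype v))).length ≃ {d // Γ.vert d = v}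
  lab_type : ∀ v k, Γ.etype (Γ.edge (lab v k)) = (Res.legs (.inl (Γ.vtype v))).get k
  ends : Γ.D ⊕ Fin r.legs.length ≃ Γ.E × Bool
  ends_fst : ∀ x, (ends x).1 = Sum.elim Γ.edge Γ.ext x
  start : Γ.E → Γ.D
  ends_start : ∀ e, ends (.inl (start e)) = (e, false)

lemma exists_marking {Γ : FeynmanGraph r} (h : Γ.IsStable) : Nonempty Γ.Marking := by
  classical
  have h1 : ∀ v, ∃ φ : Fin (Res.legs (.inl (Γ.vtype v))).length ≃ {d // Γ.vert d = v},
      ∀ k, Γ.etype (Γ.edge (φ k)) = (Res.legs (.inl (Γ.vtype v))).get k := by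
    intro v
    refine exists_equiv_comp_eq _ (fun d : {d // Γ.vert d = v} => Γ.etype (Γ.edge d)) fun t => ?_
    refine (card_get_eq_count _ t).trans ((Γ.vertex_legs v t).symm.trans ?_)
    exact (Nat.card_congr (Equiv.subtypeSubtypeEquivSubtypeInter (fun d => Γ.vert d = v)
      (fun d => Γ.etype (Γ.edge d) = t))).symm
  choose lab hlab using h1
  obtain ⟨ends, hends⟩ : ∃ φ : Γ.D ⊕ Fin r.legs.length ≃ Γ.E × Bool,
      ∀ x, (φ x).1 = Sum.elim Γ.edge Γ.ext x := by
    refine exists_equiv_comp_eq (Sum.elim Γ.edge Γ.ext) (Prod.fst : Γ.E × Bool → Γ.E) fun e => ?_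
    rw [Nat.card_congr (Equiv.subtypeSum (p := fun x => Sum.elim Γ.edge Γ.ext x = e)), Nat.card_sum]
    refine (Γ.edge_ends e).trans ?_
    have : {b : Γ.E × Bool // b.1 = e} ≃ Bool :=
      ⟨fun b => b.1.2, fun b => ⟨(e, b), rfl⟩, by rintro ⟨⟨_, b⟩, rfl⟩; rfl, fun _ => rfl⟩
    rw [Nat.card_congr this]
    simp
  have h2 : ∀ e, ∃ (b : Bool) (d : Γ.D), ends (.inl d) = (e, b) := by
    intro e
    obtain ⟨d, hd⟩ := h.incident e
    exact ⟨(ends (.inl d)).2, d, Prod.ext ((hends _).trans hd) rfl⟩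
  choose β s hs using h2
  let τ : Γ.E × Bool ≃ Γ.E × Bool :=
    ⟨fun x => (x.1, xor x.2 (β x.1)), fun x => (x.1, xor x.2 (β x.1)),
      fun x => by simp, fun x => by simp⟩
  refine ⟨⟨lab, hlab, ends.trans τ, fun x => hends x, s, fun e => ?_⟩⟩
  change τ (ends _) = _
  rw [hs]
  simp [τ]

namespace Marking

variable {Γ : FeynmanGraph r} (m : Γ.Marking) (n : Γ.E → ℕ)

lemma start_edge (e : Γ.E) : Γ.edge (m.start e) = e :=
  (m.ends_fst (.inl (m.start e))).symm.trans (congrArg Prod.fst (m.ends_start e))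

lemma ends_of_ne_start {d : Γ.D} {e : Γ.E} (hd : Γ.edge d = e) (hne : d ≠ m.start e) :
    m.ends (.inl d) = (e, true) := by
  have h1 : (m.ends (.inl d)).1 = e := (m.ends_fst _).trans hd
  have h2 : (m.ends (.inl d)).2 ≠ false := fun h2 => hne (Sum.inl.inj (m.ends.injective
    ((Prod.ext h1 h2).trans (m.ends_start e).symm)))
  exact Prod.ext h1 (by simpa using h2)

lemma ends_ext (k : Fin r.legs.length) : m.ends (.inr k) = (Γ.ext k, true) := by
  have h1 : (m.ends (.inr k)).1 = Γ.ext k := m.ends_fst _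
  have h2 : (m.ends (.inr k)).2 ≠ false := fun h2 => by
    have := m.ends.injective ((Prod.ext h1 h2).trans (m.ends_start (Γ.ext k)).symm)
    cases this
  exact Prod.ext h1 (by simpa using h2)

/-- The first or last segment of a subdivided edge. -/
def endSeg (x : Γ.E × Bool) : (e : Γ.E) × Fin (n e + 1) :=
  ⟨x.1, if x.2 then Fin.last _ else 0⟩

/-- The two ends of each segment of the subdivided edges: `(s, false)` is the first and
`(s, true)` the final end of the segment `s`. -/
noncomputable def subdivEnds :
    ((w : Γ.V ⊕ ((e : Γ.E) × Fin (n e))) × Fin (Res.legs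
      (Sum.elim (fun v => .inl (Γ.vtype v)) (fun p => .inr (Γ.etype p.1)) w)).length) ⊕
      Fin r.legs.length ≃ ((e : Γ.E) × Fin (n e + 1)) × Bool where
  toFun
    | .inl ⟨.inl v, k⟩ => (endSeg n (m.ends (.inl (m.lab v k).1)), (m.ends (.inl (m.lab v k).1)).2)
    | .inl ⟨.inr p, k⟩ => if k.1 = 0 then (⟨p.1, p.2.castSucc⟩, true) else (⟨p.1, p.2.succ⟩, false)
    | .inr k => (endSeg n (m.ends (.inr k)), (m.ends (.inr k)).2)
  invFun x :=
    let back : Γ.D ⊕ Fin r.legs.length → ((w : Γ.V ⊕ ((e : Γ.E) × Fin (n e))) × Fin (Res.legs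
      (Sum.elim (fun v => .inl (Γ.vtype v)) (fun p => .inr (Γ.etype p.1)) w)).length) ⊕
      Fin r.legs.length := Sum.map (fun d => ⟨.inl (Γ.vert d), (m.lab _).symm ⟨d, rfl⟩⟩) id
    match x with
    | (⟨e, j⟩, false) => Fin.cases (back (m.ends.symm (e, false)))
        (fun i => .inl ⟨.inr ⟨e, i⟩, (1 : Fin 2)⟩) j
    | (⟨e, j⟩, true) => Fin.lastCases (back (m.ends.symm (e, true)))
        (fun i => .inl ⟨.inr ⟨e, i⟩, (0 : Fin 2)⟩) j
  left_inv x := by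
    have key : ∀ y : Γ.E × Bool, ∀ z, m.ends z = y → (match (endSeg n y, y.2) with
      | (⟨e, j⟩, false) => Fin.cases ((Sum.map (fun d => ⟨.inl (Γ.vert d), (m.lab _).symm ⟨d, rfl⟩⟩) id :
          Γ.D ⊕ Fin r.legs.length → ((w : Γ.V ⊕ ((e : Γ.E) × Fin (n e))) × Fin (Res.legs
          (Sum.elim (fun v => .inl (Γ.vtype v)) (fun p => .inr (Γ.etype p.1)) w)).length) ⊕
          Fin r.legs.length) (m.ends.symm (e, false)))
          (fun i => .inl ⟨.inr ⟨e, i⟩, (1 : Fin 2)⟩) j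
      | (⟨e, j⟩, true) => Fin.lastCases (Sum.map (fun d => ⟨.inl (Γ.vert d), (m.lab _).symm ⟨d, rfl⟩⟩) id (m.ends.symm (e, true)))
          (fun i => .inl ⟨.inr ⟨e, i⟩, (0 : Fin 2)⟩) j) =
          Sum.map (fun d => ⟨.inl (Γ.vert d), (m.lab _).symm ⟨d, rfl⟩⟩) id z := by
      rintro ⟨e, b⟩ z hz
      rw [← Equiv.eq_symm_apply] at hz
      subst hz
      cases b
      · rfl
      · simp [endSeg]
    rcases x with ⟨v | ⟨e, i⟩, k⟩ | k
    · refine (key _ (.inl (m.lab v k).1) rfl).trans ?_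
      obtain ⟨⟨d, hd⟩, rfl⟩ := (m.lab v).symm.surjective k
      subst hd
      simp
    · have hk : ∀ k : Fin 2, k = 0 ∨ k = 1 := by decide
      rcases hk k with rfl | rfl
      · simp
      · rfl
    · exact key _ (.inr k) rfl
  right_inv x := by
    obtain ⟨⟨e, j⟩, b⟩ := x
    cases b
    · refine Fin.cases ?_ (fun i => ?_) j
      · obtain ⟨z, hz⟩ : ∃ z, z = m.ends.symm (e, false) := ⟨_, rfl⟩
        have hz' := (Equiv.eq_symm_apply _).1 hz
        simp only [Fin.cases_zero]
        rw [← hz]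
        rcases z with d | k
        · change (endSeg n (m.ends (.inl (m.lab _ ((m.lab _).symm ⟨d, rfl⟩)).1)),
            (m.ends (.inl (m.lab _ ((m.lab _).symm ⟨d, rfl⟩)).1)).2) = _
          rw [Equiv.apply_symm_apply, hz']
          rfl
        · change (endSeg n (m.ends (.inr k)), (m.ends (.inr k)).2) = _
          rw [hz']
          rfl
      · rfl
    · refine Fin.lastCases ?_ (fun i => ?_) j
      · obtain ⟨z, hz⟩ : ∃ z, z = m.ends.symm (e, true) := ⟨_, rfl⟩
        have hz' := (Equiv.eq_symm_apply _).1 hz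
        simp only [Fin.lastCases_last]
        rw [← hz]
        rcases z with d | k
        · change (endSeg n (m.ends (.inl (m.lab _ ((m.lab _).symm ⟨d, rfl⟩)).1)),
            (m.ends (.inl (m.lab _ ((m.lab _).symm ⟨d, rfl⟩)).1)).2) = _
          rw [Equiv.apply_symm_apply, hz']
          rfl
        · change (endSeg n (m.ends (.inr k)), (m.ends (.inr k)).2) = _
          rw [hz']
          rfl
      · simp

/-- The skeleton obtained from a graph by placing `n e` bivalent vertices on each edge `e`.  Leg
`0` of a bivalent vertex points to the start of the edge. -/
noncomputable def subdivide : Skeleton r where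
  W := Γ.V ⊕ ((e : Γ.E) × Fin (n e))
  F := (e : Γ.E) × Fin (n e + 1)
  wtype := Sum.elim (fun v => .inl (Γ.vtype v)) (fun p => .inr (Γ.etype p.1))
  etype f := Γ.etype f.1
  edge p := (m.subdivEnds n (.inl p)).1
  ext k := (m.subdivEnds n (.inr k)).1
  edge_ends f := by
    rw [← Nat.card_sum, ← Nat.card_congr (Equiv.subtypeSum
      (p := fun x => (m.subdivEnds n x).1 = f)),
      Nat.card_congr ((m.subdivEnds n).subtypeEquiv (q := fun y => y.1 = f) fun _ => Iff.rfl)]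
    have : {b : ((e : Γ.E) × Fin (n e + 1)) × Bool // b.1 = f} ≃ Bool :=
      ⟨fun b => b.1.2, fun b => ⟨(f, b), rfl⟩, by rintro ⟨⟨_, b⟩, rfl⟩; rfl, fun _ => rfl⟩
    rw [Nat.card_congr this]
    simp
  edge_type p := by
    rcases p with ⟨v | ⟨e, i⟩, k⟩
    · refine Eq.trans ?_ (m.lab_type v k)
      exact congrArg Γ.etype (m.ends_fst (.inl (m.lab v k).1))
    · have hk : ∀ k : Fin 2, k = 0 ∨ k = 1 := by decide
      rcases hk k with rfl | rfl <;> rfl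
  ext_type k := by
    rw [← Γ.ext_type]
    exact congrArg Γ.etype (m.ends_fst (.inr k))

variable {n}

lemma subdivide_edge_inl (v : Γ.V) (k : Fin (Res.legs (.inl (Γ.vtype v))).length) :
    (m.subdivide n).edge ⟨.inl v, k⟩ = endSeg n (m.ends (.inl (m.lab v k).1)) := rfl

lemma subdivide_edge_zero (e : Γ.E) (i : Fin (n e)) :
    (m.subdivide n).edge ⟨.inr ⟨e, i⟩, (0 : Fin 2)⟩ = ⟨e, i.castSucc⟩ := rfl

lemma subdivide_edge_one (e : Γ.E) (i : Fin (n e)) :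
    (m.subdivide n).edge ⟨.inr ⟨e, i⟩, (1 : Fin 2)⟩ = ⟨e, i.succ⟩ := rfl

lemma subdivide_ext (k : Fin r.legs.length) :
    (m.subdivide n).ext k = ⟨Γ.ext k, Fin.last _⟩ :=
  (congrArg (endSeg n) (m.ends_ext k) :)

/-- The dart of the subdivided graph given by a dart of the graph. -/
def oldDart (d : Γ.D) : (m.subdivide n).P := ⟨.inl (Γ.vert d), (m.lab _).symm ⟨d, rfl⟩⟩

lemma edge_oldDart (d : Γ.D) :
    (m.subdivide n).edge (m.oldDart d) = endSeg n (m.ends (.inl d)) := by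
  refine (m.subdivide_edge_inl _ _).trans ?_
  rw [Equiv.apply_symm_apply]

lemma edge_oldDart_start (e : Γ.E) :
    (m.subdivide n).edge (m.oldDart (m.start e)) = ⟨e, 0⟩ := by
  rw [edge_oldDart, m.ends_start]
  rfl

lemma edge_oldDart_finish {d : Γ.D} {e : Γ.E} (hd : Γ.edge d = e) (hne : d ≠ m.start e) :
    (m.subdivide n).edge (m.oldDart d) = ⟨e, Fin.last _⟩ := by
  rw [edge_oldDart, m.ends_of_ne_start hd hne]
  rfl

lemma edge_oldDart_fst (d : Γ.D) : ((m.subdivide n).edge (m.oldDart d)).1 = Γ.edge d := by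
  rw [edge_oldDart]
  exact m.ends_fst _

lemma oldDart_lab (v : Γ.V) (k : Fin (Res.legs (.inl (Γ.vtype v))).length) :
    m.oldDart (n := n) (m.lab v k).1 = ⟨.inl v, k⟩ := by
  have h : ∀ x : {d // Γ.vert d = v}, m.oldDart (n := n) x.1 = ⟨.inl v, (m.lab v).symm x⟩ := by
    rintro ⟨d, rfl⟩
    rfl
  rw [h, Equiv.symm_apply_apply]

/-- The dart at the start of a segment. -/
def segStart (e : Γ.E) (j : Fin (n e + 1)) : (m.subdivide n).P :=
  Fin.cases (m.oldDart (m.start e)) (fun i => ⟨.inr ⟨e, i⟩, (1 : Fin 2)⟩) j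

lemma edge_segStart (e : Γ.E) (j : Fin (n e + 1)) :
    (m.subdivide n).edge (m.segStart e j) = ⟨e, j⟩ := by
  refine Fin.cases ?_ (fun i => ?_) j
  · exact m.edge_oldDart_start e
  · exact m.subdivide_edge_one e i

lemma subdivide_incident (f : (m.subdivide n).F) : ∃ p, (m.subdivide n).edge p = f :=
  ⟨_, m.edge_segStart f.1 f.2⟩

variable (hn : ∀ k, n (Γ.ext k) = 0)

include hn in
lemma mem_internal_of_fin {e : Γ.E} (i : Fin (n e)) : e ∈ Γ.internal := by
  rintro ⟨k, rfl⟩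
  rw [hn] at i
  exact i.elim0

include hn in
lemma mem_range_subdivide_ext (e : Γ.E) (j : Fin (n e + 1)) :
    (⟨e, j⟩ : (m.subdivide n).F) ∈ Set.range (m.subdivide n).ext ↔ e ∉ Γ.internal := by
  constructor
  · rintro ⟨k, hk⟩ he
    rw [subdivide_ext] at hk
    exact he ⟨k, congrArg Sigma.fst hk⟩
  · intro he
    obtain ⟨k, rfl⟩ := not_not.1 he
    refine ⟨k, ?_⟩
    rw [subdivide_ext]
    congr 1
    have := hn k
    exact Fin.ext (by simp; omega)

include hn in
/-- Subdividing internal edges preserves connectedness and the absence of bridges: removing a segment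
leaves the bivalent vertices of that edge attached to one of its two ends. -/
lemma subdivide_isStable (h : Γ.IsStable) : (m.subdivide n).IsStable := by
  rintro f Z ⟨w₀, hw₀⟩ hZ
  -- an internal segment other than `f` ties its two ends
  have step : ∀ p p' : (m.subdivide n).P, ∀ e j, (m.subdivide n).edge p = ⟨e, j⟩ →
      (m.subdivide n).edge p' = ⟨e, j⟩ → e ∈ Γ.internal → (⟨e, j⟩ : (m.subdivide n).F) ≠ f →
      (p.1 ∈ Z ↔ p'.1 ∈ Z) := by
    intro p p' e j h1 h2 h3 h4
    have h5 : (⟨e, j⟩ : (m.subdivide n).F) ∉ Set.range (m.subdivide n).ext := by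
      rw [m.mem_range_subdivide_ext hn]
      exact not_not.2 h3
    exact ⟨hZ p p' (h1.trans h2.symm) (h1 ▸ h5) (h1 ▸ h4),
      hZ p' p (h2.trans h1.symm) (h2 ▸ h5) (h2 ▸ h4)⟩
  have next : ∀ e (i : Fin (n e)), (⟨e, i.castSucc⟩ : (m.subdivide n).F) ≠ f →
      ((m.segStart e i.castSucc).1 ∈ Z ↔ (m.segStart e i.succ).1 ∈ Z) := fun e i hne =>
    step (m.segStart e i.castSucc) ⟨.inr ⟨e, i⟩, (0 : Fin 2)⟩ e i.castSucc
      (m.edge_segStart _ _) (m.subdivide_edge_zero e i) (mem_internal_of_fin hn i) hne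
  -- the segments before `f` are tied to the start of the edge, those after `f` to its end
  have up : ∀ e (j : Fin (n e + 1)), (∀ j', j' < j → (⟨e, j'⟩ : (m.subdivide n).F) ≠ f) →
      ((m.segStart e 0).1 ∈ Z ↔ (m.segStart e j).1 ∈ Z) := by
    intro e j
    induction j using Fin.induction with
    | zero => exact fun _ => Iff.rfl
    | succ i ih =>
      intro hj
      rw [ih fun j' hj' => hj j' (hj'.trans Fin.castSucc_lt_succ)]
      exact next e i (hj _ Fin.castSucc_lt_succ)
  have down : ∀ e (j : Fin (n e + 1)), (∀ j', j ≤ j' → (⟨e, j'⟩ : (m.subdivide n).F) ≠ f) →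
      ((m.segStart e j).1 ∈ Z ↔ (m.segStart e (Fin.last _)).1 ∈ Z) := by
    intro e j
    induction j using Fin.reverseInduction with
    | last => exact fun _ => Iff.rfl
    | cast i ih =>
      intro hj
      rw [← ih fun j' hj' => hj j' (Fin.castSucc_lt_succ.le.trans hj')]
      exact next e i (hj _ le_rfl)
  have fin : ∀ e d, Γ.edge d = e → d ≠ m.start e → e ∈ Γ.internal →
      (⟨e, Fin.last _⟩ : (m.subdivide n).F) ≠ f →
      ((m.segStart e (Fin.last _)).1 ∈ Z ↔ (Sum.inl (Γ.vert d) : (m.subdivide n).W) ∈ Z) :=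
    fun e d h1 h2 h3 h4 => step _ (m.oldDart d) e (Fin.last _) (m.edge_segStart _ _)
      (m.edge_oldDart_finish h1 h2) h3 h4
  -- bivalent vertices are tied to one of the ends of their edge
  have tie : ∀ e (i : Fin (n e)), ∃ v : Γ.V,
      ((Sum.inr ⟨e, i⟩ : (m.subdivide n).W) ∈ Z ↔ (Sum.inl v : (m.subdivide n).W) ∈ Z) := by
    intro e i
    have he := mem_internal_of_fin hn i
    by_cases hf : ∀ j', j' < i.succ → (⟨e, j'⟩ : (m.subdivide n).F) ≠ f
    · exact ⟨Γ.vert (m.start e), (up e i.succ hf).symm⟩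
    · push Not at hf
      obtain ⟨j', hj', hf⟩ := hf
      have hf' : ∀ j, i.succ ≤ j → (⟨e, j⟩ : (m.subdivide n).F) ≠ f := by
        rintro j hj rfl
        simp only [Sigma.mk.injEq, heq_eq_eq, true_and] at hf
        subst hf
        exact absurd hj (not_le.2 hj')
      obtain ⟨d, hd, hde⟩ := exists_dart_ne (d := m.start e) (by rwa [m.start_edge])
      rw [m.start_edge] at hde
      exact ⟨Γ.vert d, (down e i.succ hf').trans (fin e d hde hd he (hf' _ (Fin.le_last _)))⟩
  have hV : ∀ v : Γ.V, (Sum.inl v : (m.subdivide n).W) ∈ Z := by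
    refine h.mem_of_closed (Z := {v | (Sum.inl v : (m.subdivide n).W) ∈ Z}) ?_ f.1 ?_
    · rcases w₀ with v | ⟨e, i⟩
      · exact ⟨v, hw₀⟩
      · obtain ⟨v, hv⟩ := tie e i
        exact ⟨v, hv.1 hw₀⟩
    · intro d d' h1 h2 h3 h4
      have hf : ∀ j, (⟨Γ.edge d, j⟩ : (m.subdivide n).F) ≠ f := by
        rintro j rfl
        exact h3 rfl
      have key : ∀ x, Γ.edge x = Γ.edge d → ((m.segStart (Γ.edge d) 0).1 ∈ Z ↔
          (Sum.inl (Γ.vert x) : (m.subdivide n).W) ∈ Z) := by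
        intro x hx
        by_cases hxs : x = m.start (Γ.edge d)
        · subst hxs
          rfl
        · rw [up _ (Fin.last _) fun j _ => hf j]
          exact fin _ x hx hxs h2 (hf _)
      exact (key d' h1.symm).1 ((key d rfl).2 h4)
  rintro (v | ⟨e, i⟩)
  · exact hV v
  · obtain ⟨v, hv⟩ := tie e i
    exact hv.2 (hV v)

include hn in
lemma loopNumber_subdivide : (m.subdivide n).loopNumber = Γ.loopNumber := by
  classical
  have := Fintype.ofFinite Γ.E
  have e1 : {f // f ∉ Set.range (m.subdivide n).ext} ≃
      ((e : Γ.internal) × Fin (n e.1 + 1)) :=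
    { toFun := fun f => ⟨⟨f.1.1, not_not.1 fun h => f.2
        ((m.mem_range_subdivide_ext hn f.1.1 f.1.2).2 h)⟩, f.1.2⟩
      invFun := fun x => ⟨⟨x.1.1, x.2⟩, fun h =>
        (m.mem_range_subdivide_ext hn x.1.1 x.2).1 h x.1.2⟩
      left_inv := fun _ => rfl
      right_inv := fun _ => rfl }
  have hW : Nat.card (m.subdivide n).W = Nat.card (Γ.V ⊕ ((e : Γ.E) × Fin (n e))) := rfl
  unfold Skeleton.loopNumber FeynmanGraph.loopNumber
  rw [Nat.card_congr e1, hW, Nat.card_sum, Nat.card_sigma, Nat.card_sigma]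
  have h0 : ∑ e : Γ.E, n e = ∑ e : Γ.internal, n e := by
    rw [← Finset.sum_filter_of_ne (p := fun e => e ∈ Γ.internal)]
    · exact Finset.sum_subtype _ (by simp) _
    · rintro e - he ⟨k, rfl⟩
      exact he (hn k)
  simp only [Nat.card_eq_fintype_card, Fintype.card_fin, Finset.sum_add_distrib, h0]
  simp
  ring

end Marking
end FeynmanGraph

/-! ### The subgraph cut out by a presentation as a substituted graph -/

namespace FeynmanGraph

variable {r : Res} {Γ : FeynmanGraph r}

lemma Labeling.res_eq {c : Set Γ.E} (ℓ ℓ' : Γ.Labeling c) : ℓ.res = ℓ'.res := by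
  have key : ∀ ℓ : Γ.Labeling c, ∀ t,
      ℓ.res.legs.count t = Nat.card {d : Γ.extDarts c // Γ.etype (Γ.edge d) = t} := fun ℓ t => by
    rw [← card_get_eq_count]
    exact Nat.card_congr (ℓ.equiv.subtypeEquiv fun k => by rw [← ℓ.type_eq])
  exact res_eq_of_count fun t => (key ℓ t).trans (key ℓ' t).symm

lemma ProperSubgraph.residue_eq {γ : Γ.ProperSubgraph} (c : γ.comps) (ℓ : Γ.Labeling c.1) :
    γ.residue c = ℓ.res := Labeling.res_eq _ _

lemma ProperSubgraph.ext_comps {γ γ' : Γ.ProperSubgraph} (h : ∀ c, c ∈ γ.comps ↔ c ∈ γ'.comps) :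
    γ = γ' := by
  obtain ⟨c, _⟩ := γ
  obtain ⟨c', _⟩ := γ'
  obtain rfl : c = c' := Set.ext h
  rfl

/-- Two vertices of `Γ` have the same image in `Γ / γ` when they are equal or lie in the same
component. -/
lemma ProperSubgraph.node_eq_iff {γ : Γ.ProperSubgraph} {v w : Γ.V} (hv : v ∉ γ.lineVerts)
    (hw : w ∉ γ.lineVerts) : γ.node v hv = γ.node w hw ↔
      v = w ∨ ∃ c : γ.comps, v ∈ Γ.verts c.1 ∧ w ∈ Γ.verts c.1 := by
  constructor
  · intro h
    rcases hx : γ.node v hv with x | c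
    · rw [hx] at h
      exact .inl ((node_eq_inl hv hx).trans (node_eq_inl hw h.symm).symm)
    · rw [hx] at h
      exact .inr ⟨c.1, node_eq_inr hv hx, node_eq_inr hw h.symm⟩
  · rintro (rfl | ⟨c, h1, h2⟩)
    · rfl
    · obtain ⟨_, h3⟩ := node_of_mem hv h1
      obtain ⟨_, h4⟩ := node_of_mem hw h2
      rw [h3, h4]

end FeynmanGraph

namespace Skeleton

variable {r : Res} {Q : Skeleton r} {K : ∀ w, StableGraph (Q.wtype w)} {Γ : FeynmanGraph r}
  (F : Iso (Q.subst K) Γ)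

/-- The set of edges of `Γ` that come from internal edges of the piece `K w`. -/
def compSet (w : Q.W) : Set Γ.E := Set.range fun x : (K w).1.internal => F.onE (inner w x)

/-- The dart of `Γ` that comes from a dart of the skeleton. -/
noncomputable def legDart (p : Q.P) : Γ.D := F.onD (dart p.1 ((K p.1).2.leg p.2))

variable {F}

lemma exists_eq_onD_dart (d : Γ.D) : ∃ w x, d = F.onD (dart w x) := by
  obtain ⟨w, x, h⟩ := exists_eq_dart (F.onD.symm d)
  exact ⟨w, x, by rw [← h, Equiv.apply_symm_apply]⟩

lemma exists_eq_onV_vtx (v : Γ.V) : ∃ w x, v = F.onV (vtx w x) := by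
  obtain ⟨w, x, h⟩ := exists_eq_vtx (F.onV.symm v)
  exact ⟨w, x, by rw [← h, Equiv.apply_symm_apply]⟩

lemma vert_onD_dart (w : Q.W) (d : (K w).1.D) :
    Γ.vert (F.onD (dart w d)) = F.onV (vtx w ((K w).1.vert d)) := F.vert _

lemma legDart_injective : Function.Injective (legDart F) := by
  rintro ⟨w, k⟩ ⟨w', k'⟩ h
  have h1 := F.onD.injective h
  obtain rfl := dart_eq h1
  rw [dart_inj] at h1
  exact congrArg (Sigma.mk w) ((K w).2.leg_injective h1)

lemma edge_legDart (p : Q.P) : Γ.edge (legDart F p) = F.onE (outer (Q.edge p)) := by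
  rw [legDart, F.edge, edge_dart_leg]

lemma vert_legDart (p : Q.P) :
    Γ.vert (legDart F p) = F.onV (vtx p.1 ((K p.1).1.vert ((K p.1).2.leg p.2))) :=
  vert_onD_dart _ _

lemma edge_onD_mem_compSet {w w' : Q.W} {d : (K w').1.D} :
    Γ.edge (F.onD (dart w' d)) ∈ compSet F w ↔ w' = w ∧ (K w').1.edge d ∈ (K w').1.internal := by
  rw [F.edge]
  constructor
  · rintro ⟨x, hx⟩
    have h1 := (F.onE.injective hx).symm
    have h2 := mem_internal_of_edge_eq_inner h1
    rw [edge_dart_internal w' d h2] at h1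
    exact ⟨inner_eq h1, h2⟩
  · rintro ⟨rfl, h⟩
    exact ⟨⟨_, h⟩, by rw [edge_dart_internal w' d h]⟩

lemma outer_notMem_compSet (f : Q.F) (w : Q.W) : F.onE (outer f) ∉ compSet F w := by
  rintro ⟨x, hx⟩
  exact outer_ne_inner (F.onE.injective hx).symm

lemma mem_verts_compSet {w w' : Q.W} {v : (K w').1.V} :
    F.onV (vtx w' v) ∈ Γ.verts (compSet F w) ↔ w' = w ∧ (K w).1.internal.Nonempty := by
  constructor
  · rintro ⟨d, h1, h2⟩
    obtain ⟨w₁, x, rfl⟩ := exists_eq_onD_dart (F := F) d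
    obtain ⟨rfl, h3⟩ := edge_onD_mem_compSet.1 h2
    rw [vert_onD_dart, F.onV.apply_eq_iff_eq] at h1
    exact ⟨(vtx_eq h1).symm, ⟨_, h3⟩⟩
  · rintro ⟨rfl, e, he⟩
    obtain ⟨d, rfl⟩ := (K w').2.incident e
    have hmem : ∀ d, (K w').1.edge d ∈ (K w').1.internal →
        F.onV (vtx w' ((K w').1.vert d)) ∈ Γ.verts (compSet F w') := fun d hd =>
      ⟨F.onD (dart w' d), vert_onD_dart w' d, edge_onD_mem_compSet.2 ⟨rfl, hd⟩⟩
    have k₀ : Fin (Q.wtype w').legs.length := ⟨0, (Q.wtype w').legs_length_pos⟩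
    refine (K w').2.mem_of_closed (Z := {v | F.onV (vtx w' v) ∈ Γ.verts (compSet F w')})
      ⟨_, hmem d he⟩ ((K w').1.edge ((K w').2.leg k₀)) ?_ v
    intro x x' h1 h2 _ _
    exact hmem x' (h1 ▸ h2)

lemma mem_extDarts_compSet {w : Q.W} (hne : (K w).1.internal.Nonempty) {d : Γ.D} :
    d ∈ Γ.extDarts (compSet F w) ↔ ∃ k, d = legDart F ⟨w, k⟩ := by
  obtain ⟨w₁, x, rfl⟩ := exists_eq_onD_dart (F := F) d
  constructor
  · rintro ⟨h1, h2⟩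
    rw [vert_onD_dart] at h1
    obtain ⟨rfl, -⟩ := mem_verts_compSet.1 h1
    obtain ⟨k, rfl⟩ := (K w₁).2.exists_leg fun h => h2 (edge_onD_mem_compSet.2 ⟨rfl, h⟩)
    exact ⟨k, rfl⟩
  · rintro ⟨k, hk⟩
    rw [hk]
    refine ⟨?_, fun h => (K w).2.edge_leg_notMem k (edge_onD_mem_compSet.1 h).2⟩
    rw [vert_legDart]
    exact mem_verts_compSet.2 ⟨rfl, hne⟩

/-- The labelling of the external lines of a piece by the legs of the vertex it replaces. -/
noncomputable def compLabeling {w : Q.W} (hne : (K w).1.internal.Nonempty) :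
    Γ.Labeling (compSet F w) where
  res := Q.wtype w
  equiv := Equiv.ofBijective
    (fun k => ⟨legDart F ⟨w, k⟩, (mem_extDarts_compSet hne).2 ⟨k, rfl⟩⟩)
    ⟨fun k k' h => by
      have h1 := legDart_injective (congrArg Subtype.val h)
      simpa using h1, fun d => by
      obtain ⟨k, hk⟩ := (mem_extDarts_compSet hne).1 d.2
      exact ⟨k, Subtype.ext hk.symm⟩⟩
  type_eq k := by
    change Γ.etype (Γ.edge (legDart F ⟨w, k⟩)) = _
    rw [edge_legDart, F.etype]
    exact Q.edge_type ⟨w, k⟩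

lemma compSet_isSub {w : Q.W} (hne : (K w).1.internal.Nonempty) : Γ.IsSub (compSet F w) := by
  refine ⟨?_, ?_, ?_, ⟨compLabeling hne⟩⟩
  · rintro _ ⟨x, rfl⟩
    exact F.mem_internal.2 (inner_mem_internal _ _)
  · obtain ⟨e, he⟩ := hne
    exact ⟨_, ⟨e, he⟩, rfl⟩
  · rintro _ ⟨e, rfl⟩ v hv v' hv'
    obtain ⟨w₁, x, rfl⟩ := exists_eq_onV_vtx (F := F) v
    obtain ⟨w₂, x', rfl⟩ := exists_eq_onV_vtx (F := F) v'
    obtain ⟨rfl, -⟩ := mem_verts_compSet.1 hv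
    obtain ⟨rfl, -⟩ := mem_verts_compSet.1 hv'
    refine linked_of_closed fun Z hZ hx => ?_
    refine (K w₂).2.mem_of_closed (Z := {y | F.onV (vtx w₂ y) ∈ Z}) ⟨x, hx⟩ e ?_ x'
    intro d d' h1 h2 h3 h4
    have h2' : (K w₂).1.edge d' ∈ (K w₂).1.internal := h1 ▸ h2
    have h5 := hZ (F.onD (dart w₂ d)) (F.onD (dart w₂ d')) ?_
      ⟨edge_onD_mem_compSet.2 ⟨rfl, h2⟩, ?_⟩ (by rwa [vert_onD_dart])
    · rwa [vert_onD_dart] at h5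
    · rw [F.edge, F.edge, edge_dart_internal w₂ d h2, edge_dart_internal w₂ d' h2']
      congr 2
      exact Subtype.ext h1
    · intro h6
      change _ = _ at h6
      rw [F.edge, edge_dart_internal w₂ d h2, F.onE.apply_eq_iff_eq, inner_inj] at h6
      exact h3 (congrArg Subtype.val h6)

variable (F) in
/-- The subgraph `γ` consists of the nontrivial pieces of the presentation `F`. -/
def Carries (γ : Γ.ProperSubgraph) : Prop :=
  ∀ c, c ∈ γ.comps ↔ ∃ w, (K w).1.internal.Nonempty ∧ c = compSet F w

/-- The nontrivial pieces form a proper subgraph, as soon as an edge of the skeleton is internal. -/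
lemma exists_carries (hne : ∃ w, (K w).1.internal.Nonempty) (hf : ∃ f, f ∉ Set.range Q.ext) :
    ∃ γ, Carries F γ := by
  refine ⟨⟨{c | ∃ w, (K w).1.internal.Nonempty ∧ c = compSet F w}, ?_, ?_, ?_, ?_⟩,
    fun c => Iff.rfl⟩
  · rintro c ⟨w, h, rfl⟩
    exact compSet_isSub h
  · rintro _ ⟨w, h, rfl⟩ _ ⟨w', h', rfl⟩ hww
    refine Set.disjoint_left.2 fun v hv hv' => hww ?_
    obtain ⟨w₁, x, rfl⟩ := exists_eq_onV_vtx (F := F) v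
    obtain ⟨rfl, -⟩ := mem_verts_compSet.1 hv
    obtain ⟨rfl, -⟩ := mem_verts_compSet.1 hv'
    rfl
  · obtain ⟨w, h⟩ := hne
    exact ⟨_, w, h, rfl⟩
  · rintro ⟨w, h, hw⟩
    obtain ⟨f, hf⟩ := hf
    have h1 : F.onE (outer f) ∈ Γ.internal := F.mem_internal.2 (outer_mem_internal.2 hf)
    rw [hw] at h1
    exact outer_notMem_compSet f w h1

variable {γ : Γ.ProperSubgraph} (hγ : Carries F γ)

/-- The graph substituted for a bivalent vertex is never trivial: corollas have vertices of `R_V`. -/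
lemma internal_nonempty_of_isRight {w : Q.W} (hw : (Q.wtype w).isRight) :
    (K w).1.internal.Nonempty := by
  by_contra hcon
  rw [Set.not_nonempty_iff_eq_empty] at hcon
  have k₀ : Fin (Q.wtype w).legs.length := ⟨0, (Q.wtype w).legs_length_pos⟩
  have h := (K w).2.res_eq hcon ((K w).1.vert ((K w).2.leg k₀))
  rw [h] at hw
  cases hw

lemma residue_compSet {c : γ.comps} {w : Q.W} (hne : (K w).1.internal.Nonempty)
    (hc : c.1 = compSet F w) : γ.residue c = Q.wtype w := by
  obtain ⟨c, hc'⟩ := c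
  dsimp only at hc
  subst hc
  exact ProperSubgraph.residue_eq (⟨_, hc'⟩ : γ.comps) (compLabeling hne)

include hγ

lemma onV_mem_lineVerts {w : Q.W} {v : (K w).1.V} :
    F.onV (vtx w v) ∈ γ.lineVerts ↔ (Q.wtype w).isRight := by
  constructor
  · rintro ⟨c, h1, h2⟩
    obtain ⟨w', hne, hc⟩ := (hγ c).1 c.2
    rw [hc] at h2
    obtain ⟨rfl, -⟩ := mem_verts_compSet.1 h2
    rwa [residue_compSet hne hc] at h1
  · intro hw
    have hne := internal_nonempty_of_isRight (K := K) hw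
    refine ⟨⟨compSet F w, (hγ _).2 ⟨w, hne, rfl⟩⟩, ?_, mem_verts_compSet.2 ⟨rfl, hne⟩⟩
    rwa [residue_compSet hne rfl]

lemma edge_onD_notMem_comps {w : Q.W} {d : (K w).1.D} :
    (∀ c : γ.comps, Γ.edge (F.onD (dart w d)) ∉ c.1) ↔ ∃ k, d = (K w).2.leg k := by
  constructor
  · intro h
    refine (K w).2.exists_leg fun hd => ?_
    exact h ⟨compSet F w, (hγ _).2 ⟨w, ⟨_, hd⟩, rfl⟩⟩ (edge_onD_mem_compSet.2 ⟨rfl, hd⟩)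
  · rintro ⟨k, rfl⟩ c hc
    obtain ⟨w', -, hw'⟩ := (hγ c).1 c.2
    rw [hw'] at hc
    exact (K w).2.edge_leg_notMem k (edge_onD_mem_compSet.1 hc).2

lemma outer_notMem_comps (f : Q.F) (c : γ.comps) : F.onE (outer f) ∉ c.1 := by
  obtain ⟨w, -, hw⟩ := (hγ c).1 c.2
  rw [hw]
  exact outer_notMem_compSet f w

lemma edge_legDart_notMem_comps (p : Q.P) (c : γ.comps) : Γ.edge (legDart F p) ∉ c.1 := by
  rw [edge_legDart]
  exact outer_notMem_comps hγ _ c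

lemma legDart_newD {p : Q.P} (hp : (Q.wtype p.1).isLeft) :
    (∀ c : γ.comps, Γ.edge (legDart F p) ∉ c.1) ∧ Γ.vert (legDart F p) ∉ γ.lineVerts := by
  refine ⟨edge_legDart_notMem_comps hγ p, ?_⟩
  rw [vert_legDart, onV_mem_lineVerts hγ, Sum.not_isRight]
  exact hp

lemma exists_eq_legDart (x : γ.NewD) :
    ∃ p : Q.P, (Q.wtype p.1).isLeft ∧ x.1 = legDart F p := by
  obtain ⟨d, h1, h2⟩ := x
  obtain ⟨w, y, rfl⟩ := exists_eq_onD_dart (F := F) d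
  obtain ⟨k, rfl⟩ := (edge_onD_notMem_comps hγ).1 h1
  rw [vert_onD_dart, onV_mem_lineVerts hγ, Sum.not_isRight] at h2
  exact ⟨⟨w, k⟩, h2, rfl⟩

lemma node_onV_eq_iff {w w' : Q.W} {v : (K w).1.V} {v' : (K w').1.V}
    (h : F.onV (vtx w v) ∉ γ.lineVerts) (h' : F.onV (vtx w' v') ∉ γ.lineVerts) :
    γ.node _ h = γ.node _ h' ↔ w = w' := by
  rw [ProperSubgraph.node_eq_iff]
  constructor
  · rintro (heq | ⟨c, h1, h2⟩)
    · exact vtx_eq (F.onV.injective heq)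
    · obtain ⟨w₁, -, hw₁⟩ := (hγ c).1 c.2
      rw [hw₁] at h1 h2
      exact (mem_verts_compSet.1 h1).1.trans (mem_verts_compSet.1 h2).1.symm
  · rintro rfl
    by_cases hne : (K w).1.internal.Nonempty
    · exact .inr ⟨⟨compSet F w, (hγ _).2 ⟨w, hne, rfl⟩⟩, mem_verts_compSet.2 ⟨rfl, hne⟩,
        mem_verts_compSet.2 ⟨rfl, hne⟩⟩
    · rw [Set.not_nonempty_iff_eq_empty] at hne
      rw [(K w).2.vert_unique hne v v']
      exact .inl rfl

lemma vtype_node_onV (hΓ : Γ.IsOnePI) {w : Q.W} {v : (K w).1.V}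
    (h : F.onV (vtx w v) ∉ γ.lineVerts) :
    Sum.inl ((contract hΓ γ).vtype (γ.node _ h)) = Q.wtype w := by
  by_cases hne : (K w).1.internal.Nonempty
  · have hc : compSet F w ∈ γ.comps := (hγ _).2 ⟨w, hne, rfl⟩
    obtain ⟨h1, h2⟩ := ProperSubgraph.node_of_mem h (c := ⟨_, hc⟩) (mem_verts_compSet.2 ⟨rfl, hne⟩)
    rw [h2, ← residue_compSet (c := ⟨_, hc⟩) hne rfl]
    exact Sum.inl_getLeft _ h1
  · have h1 : ∀ c : γ.comps, F.onV (vtx w v) ∉ Γ.verts c.1 := by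
      intro c hc
      obtain ⟨w₁, hw₁, hw₁'⟩ := (hγ c).1 c.2
      rw [hw₁'] at hc
      obtain ⟨rfl, -⟩ := mem_verts_compSet.1 hc
      exact hne hw₁
    rw [ProperSubgraph.node_of_notMem h h1]
    rw [Set.not_nonempty_iff_eq_empty] at hne
    change Sum.inl (Γ.vtype (F.onV (vtx w v))) = _
    rw [F.vtype, vtype_vtx]
    exact ((K w).2.res_eq hne v).symm

lemma exists_eq_outer {e : Γ.E} (he : ∀ c : γ.comps, e ∉ c.1) : ∃ f, e = F.onE (outer f) := by
  rcases edge_cases (F.onE.symm e) with ⟨f, hf⟩ | ⟨w, x, hx⟩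
  · exact ⟨f, by rw [← hf, Equiv.apply_symm_apply]⟩
  · refine (he ⟨compSet F w, (hγ _).2 ⟨w, ⟨_, x.2⟩, rfl⟩⟩ ⟨x, ?_⟩).elim
    dsimp only
    rw [← hx, Equiv.apply_symm_apply]

/-- Two edges of the skeleton are merged in `Γ / γ` in one step when they meet in a bivalent vertex. -/
lemma chain_iff {f f' : Q.F} :
    γ.Chain ⟨F.onE (outer f), outer_notMem_comps hγ f⟩
      ⟨F.onE (outer f'), outer_notMem_comps hγ f'⟩ ↔
    ∃ w k k', (Q.wtype w).isRight ∧ Q.edge ⟨w, k⟩ = f ∧ Q.edge ⟨w, k'⟩ = f' := by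
  constructor
  · rintro ⟨c, hc, d, hd, d', hd', h1, h2⟩
    obtain ⟨w, hne, hw⟩ := (hγ c).1 c.2
    rw [hw] at hd hd'
    obtain ⟨k, rfl⟩ := (mem_extDarts_compSet hne).1 hd
    obtain ⟨k', rfl⟩ := (mem_extDarts_compSet hne).1 hd'
    rw [residue_compSet hne hw] at hc
    rw [edge_legDart, F.onE.apply_eq_iff_eq, outer_inj] at h1 h2
    exact ⟨w, k, k', hc, h1, h2⟩
  · rintro ⟨w, k, k', hw, rfl, rfl⟩
    have hne := internal_nonempty_of_isRight (K := K) hw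
    refine ⟨⟨compSet F w, (hγ _).2 ⟨w, hne, rfl⟩⟩, ?_, _, (mem_extDarts_compSet hne).2 ⟨k, rfl⟩,
      _, (mem_extDarts_compSet hne).2 ⟨k', rfl⟩, edge_legDart _, edge_legDart _⟩
    rwa [residue_compSet hne rfl]

end Skeleton

/-! ### Contractions of substituted subdivided graphs -/

namespace FeynmanGraph.Marking

open Skeleton

variable {r : Res} {Γ₀ Γ : FeynmanGraph r} (m : Γ₀.Marking) {n n' : Γ₀.E → ℕ}
  {K : ∀ w, StableGraph ((m.subdivide n).wtype w)}
  {K' : ∀ w, StableGraph ((m.subdivide n').wtype w)}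
  {F : Iso ((m.subdivide n).subst K) Γ} {F' : Iso ((m.subdivide n').subst K') Γ}
  {γ : Γ.ProperSubgraph}

/-- `γ` consists of the nontrivial pieces of the presentation `F`, and `φ` identifies `Γ / γ` with
the graph that was subdivided. -/
def Presents (F : Iso ((m.subdivide n).subst K) Γ) (hΓ : Γ.IsOnePI) (γ : Γ.ProperSubgraph)
    (φ : Iso (contract hΓ γ) Γ₀) : Prop :=
  Carries F γ ∧ ∀ d : Γ₀.D, ∃ h, φ.onD ⟨legDart F (m.oldDart d), h⟩ = d

lemma oldDart_injective : Function.Injective (m.oldDart (n := n)) := by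
  have h : ∀ d, (m.lab _ (m.oldDart (n := n) d).2).1 = d := fun d => by
    change (m.lab _ ((m.lab _).symm ⟨d, rfl⟩)).1 = d
    rw [Equiv.apply_symm_apply]
  intro d d' hd
  have key : ∀ p : (m.subdivide n).P, ∀ v k, p = ⟨.inl v, k⟩ →
      ∃ x : Γ₀.D, (∀ v' k', p = ⟨.inl v', k'⟩ → (m.lab v' k').1 = x) := by
    rintro _ v k rfl
    refine ⟨(m.lab v k).1, fun v' k' h' => ?_⟩
    cases h'
    rfl
  obtain ⟨x, hx⟩ := key (m.oldDart d) _ _ rfl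
  exact (h d).symm.trans ((hx _ _ rfl).trans ((hx _ _ hd).symm.trans (h d')))

lemma eq_oldDart_of_isLeft {p : (m.subdivide n).P} (hp : ((m.subdivide n).wtype p.1).isLeft) :
    ∃ d, p = m.oldDart d := by
  obtain ⟨v | e, k⟩ := p
  · exact ⟨_, (m.oldDart_lab v k).symm⟩
  · cases hp

/-- Two segments become the same edge of `Γ / γ` exactly when they are segments of the same edge. -/
lemma quot_eq_iff (hγ : Carries F γ) (f f' : (m.subdivide n).F) :
    (Quot.mk γ.Chain ⟨F.onE (outer f), outer_notMem_comps hγ f⟩ =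
      Quot.mk γ.Chain ⟨F.onE (outer f'), outer_notMem_comps hγ f'⟩) ↔ f.1 = f'.1 := by
  constructor
  · intro h
    let ψ : γ.Rest → Option Γ₀.E := fun x =>
      Sum.elim (fun f : (e : Γ₀.E) × Fin (n e + 1) => some f.1) (fun _ => none) (F.onE.symm x.1)
    have hψ : ∀ f : (m.subdivide n).F, ψ ⟨F.onE (outer f), outer_notMem_comps hγ f⟩ = some f.1 := by
      intro f
      change Sum.elim _ _ (F.onE.symm (F.onE (outer f))) = _
      rw [Equiv.symm_apply_apply]
      rfl
    have hresp : ∀ x y, γ.Chain x y → ψ x = ψ y := by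
      rintro ⟨x, hx⟩ ⟨y, hy⟩ hxy
      obtain ⟨f, rfl⟩ := exists_eq_outer hγ hx
      obtain ⟨f', rfl⟩ := exists_eq_outer hγ hy
      rw [hψ, hψ]
      obtain ⟨w, k, k', hw, rfl, rfl⟩ := (chain_iff hγ).1 hxy
      obtain v | ⟨e, i⟩ := w
      · cases hw
      · have hk : ∀ k : Fin 2, k = 0 ∨ k = 1 := by decide
        rcases hk k with rfl | rfl <;> rcases hk k' with rfl | rfl <;> rfl
    have h1 : ψ ⟨F.onE (outer f), _⟩ = ψ ⟨F.onE (outer f'), _⟩ :=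
      congrArg (Quot.lift ψ hresp) h
    exact Option.some.inj ((hψ f).symm.trans (h1.trans (hψ f')))
  · have key : ∀ (e : Γ₀.E) (j : Fin (n e + 1)),
        (Quot.mk γ.Chain ⟨F.onE (outer (⟨e, 0⟩ : (m.subdivide n).F)), outer_notMem_comps hγ _⟩ =
          Quot.mk γ.Chain ⟨F.onE (outer (⟨e, j⟩ : (m.subdivide n).F)),
            outer_notMem_comps hγ _⟩) := by
      intro e j
      induction j using Fin.induction with
      | zero => rfl
      | succ i ih =>
        exact ih.trans (Quot.sound ((chain_iff hγ).2 ⟨.inr ⟨e, i⟩, (0 : Fin 2), (1 : Fin 2), rfl,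
          m.subdivide_edge_zero e i, m.subdivide_edge_one e i⟩))
    obtain ⟨e, j⟩ := f
    obtain ⟨e', j'⟩ := f'
    rintro rfl
    exact (key e j).symm.trans (key e j')

/-- Contracting the nontrivial pieces undoes substitution and subdivision. -/
lemma exists_presents_of_carries (h₀ : Γ₀.IsOnePI) (hΓ : Γ.IsOnePI) (hγ : Carries F γ) :
    ∃ φ, m.Presents F hΓ γ φ := by
  have hnew : ∀ d, (∀ c : γ.comps, Γ.edge (legDart F (m.oldDart d)) ∉ c.1) ∧
      Γ.vert (legDart F (m.oldDart d)) ∉ γ.lineVerts := fun d =>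
    legDart_newD hγ (p := m.oldDart d) rfl
  let f : Γ₀.D ≃ (contract hΓ γ).D := Equiv.ofBijective
    (fun d => (⟨legDart F (m.oldDart d), hnew d⟩ : γ.NewD))
    ⟨fun d d' h => m.oldDart_injective (legDart_injective (congrArg Subtype.val h)), fun x => by
      obtain ⟨p, hp, hx⟩ := exists_eq_legDart hγ x
      obtain ⟨d, rfl⟩ := m.eq_oldDart_of_isLeft hp
      exact ⟨d, Subtype.ext hx.symm⟩⟩
  have hvert : ∀ d, ∃ h, (contract hΓ γ).vert (f d) =
      γ.node (F.onV (vtx (m.oldDart d).1 ((K _).1.vert ((K _).2.leg (m.oldDart d).2)))) h := by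
    intro d
    refine ⟨by rw [← vert_legDart]; exact (hnew d).2, ?_⟩
    change γ.node (Γ.vert (legDart F (m.oldDart d))) (hnew d).2 = _
    simp only [vert_legDart]
  have hedge : ∀ d, (contract hΓ γ).edge (f d) = Quot.mk γ.Chain
      ⟨F.onE (outer ((m.subdivide n).edge (m.oldDart d))), outer_notMem_comps hγ _⟩ := by
    intro d
    refine congrArg (Quot.mk γ.Chain) (Subtype.ext ?_)
    exact edge_legDart _
  have hiff : ∀ d d', (contract hΓ γ).edge (f d) = (contract hΓ γ).edge (f d') ↔
      Γ₀.edge d = Γ₀.edge d' := by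
    intro d d'
    rw [hedge, hedge, ← m.edge_oldDart_fst (n := n) d, ← m.edge_oldDart_fst (n := n) d']
    exact m.quot_eq_iff hγ _ _
  obtain ⟨φ, hφ⟩ := exists_iso_of_darts h₀.incident (contract_isOnePI hΓ γ).incident f
    (fun d d' => by
      obtain ⟨h1, h2⟩ := hvert d
      obtain ⟨h3, h4⟩ := hvert d'
      rw [h2, h4]
      exact Sum.inl_injective.eq_iff.symm.trans (node_onV_eq_iff hγ h1 h3).symm)
    (fun d => by
      obtain ⟨h1, h2⟩ := hvert d
      rw [h2]
      exact Sum.inl_injective (vtype_node_onV hγ hΓ h1))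
    (fun d d' => (hiff d d').symm)
    (fun d => by
      rw [hedge]
      change Γ.etype (F.onE (outer _)) = _
      rw [F.etype, ← m.edge_oldDart_fst (n := n) d]
      rfl)
    (fun k => by
      obtain ⟨d, hd⟩ := h₀.incident (Γ₀.ext k)
      refine ⟨d, hd.symm, ?_⟩
      have h1 : (contract hΓ γ).ext k = Quot.mk γ.Chain
          ⟨F.onE (outer ((m.subdivide n).ext k)), outer_notMem_comps hγ _⟩ :=
        congrArg (Quot.mk γ.Chain) (Subtype.ext (F.extEdge k))
      rw [h1, hedge]
      refine (m.quot_eq_iff hγ _ _).2 ?_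
      rw [m.edge_oldDart_fst, hd, subdivide_ext])
  refine ⟨φ.symm, hγ, fun d => ⟨hnew d, ?_⟩⟩
  change φ.onD.symm (f d) = d
  rw [← hφ, Equiv.symm_apply_apply]

/-- An isomorphism presents at most one subgraph, with one identification of the contracted graph. -/
lemma Presents.unique {hΓ : Γ.IsOnePI} {γ γ' : Γ.ProperSubgraph} {φ : Iso (contract hΓ γ) Γ₀}
    {φ' : Iso (contract hΓ γ') Γ₀} (h : m.Presents F hΓ γ φ) (h' : m.Presents F hΓ γ' φ') :
    (⟨γ, φ⟩ : (γ : Γ.ProperSubgraph) × Iso (contract hΓ γ) Γ₀) = ⟨γ', φ'⟩ := by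
  obtain rfl : γ = γ' := ProperSubgraph.ext_comps fun c => (h.1 c).trans (h'.1 c).symm
  congr 1
  refine Iso.ext_of_darts (contract_isOnePI hΓ γ).incident fun x => ?_
  obtain ⟨p, hp, hx⟩ := exists_eq_legDart h.1 x
  obtain ⟨d, rfl⟩ := m.eq_oldDart_of_isLeft hp
  obtain ⟨h1, h2⟩ := h.2 d
  obtain ⟨h3, h4⟩ := h'.2 d
  obtain rfl : x = ⟨legDart F (m.oldDart d), h1⟩ := Subtype.ext hx
  exact h2.trans h4.symm

lemma fst_inr_inj {e : Γ₀.E} {i j : Fin (n e)}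
    (h : (Sum.inr ⟨e, i⟩ : (m.subdivide n).W) = Sum.inr ⟨e, j⟩) : i.1 = j.1 :=
  congrArg Fin.val (eq_of_heq (Sigma.mk.inj (Sum.inr.inj h)).2)

/-- The darts of the skeleton are determined by the subgraph and the identification of the
contracted graph: one follows each edge from its start, passing through the bivalent components. -/
lemma Presents.legDart_eq (hn : ∀ k, n (Γ₀.ext k) = 0) {hΓ : Γ.IsOnePI}
    {φ : Iso (contract hΓ γ) Γ₀} (h : m.Presents F hΓ γ φ) (h' : m.Presents F' hΓ γ φ)
    (e : Γ₀.E) (j : ℕ) (hj : j ≤ n e) :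
    ∃ hj' : j ≤ n' e, legDart F (m.segStart e ⟨j, Nat.lt_succ_of_le hj⟩) =
      legDart F' (m.segStart e ⟨j, Nat.lt_succ_of_le hj'⟩) ∧
      ∀ i (hi : i < j), legDart F ⟨.inr ⟨e, ⟨i, hi.trans_le hj⟩⟩, (0 : Fin 2)⟩ =
        legDart F' ⟨.inr ⟨e, ⟨i, hi.trans_le hj'⟩⟩, (0 : Fin 2)⟩ := by
  induction j with
  | zero =>
    refine ⟨Nat.zero_le _, ?_, fun i hi => absurd hi (Nat.not_lt_zero i)⟩
    obtain ⟨h1, h2⟩ := h.2 (m.start e)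
    obtain ⟨h3, h4⟩ := h'.2 (m.start e)
    exact congrArg Subtype.val (φ.onD.injective (h2.trans h4.symm))
  | succ j ih =>
    obtain ⟨hj', h1, h2⟩ := ih (Nat.le_of_succ_le hj)
    have he : e ∈ Γ₀.internal := mem_internal_of_fin hn ⟨j, hj⟩
    -- the other end of the segment
    have e1 : Γ.edge (legDart F (m.segStart e ⟨j, by omega⟩)) =
        Γ.edge (legDart F ⟨.inr ⟨e, ⟨j, hj⟩⟩, (0 : Fin 2)⟩) := by
      rw [edge_legDart, edge_legDart, m.edge_segStart]
      exact congrArg (fun f => F.onE (outer f)) (m.subdivide_edge_zero e ⟨j, hj⟩).symm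
    have e2 : legDart F (m.segStart e ⟨j, by omega⟩) ≠
        legDart F ⟨.inr ⟨e, ⟨j, hj⟩⟩, (0 : Fin 2)⟩ := by
      intro heq
      have h3 := legDart_injective heq
      rcases j with _ | j
      · cases h3
      · have h4 : (⟨.inr ⟨e, ⟨j, Nat.lt_of_succ_lt hj⟩⟩, (1 : Fin 2)⟩ : (m.subdivide n).P) =
          ⟨.inr ⟨e, ⟨j + 1, hj⟩⟩, (0 : Fin 2)⟩ := h3
        exact Nat.succ_ne_self j (fst_inr_inj (congrArg Sigma.fst h4)).symm
    have hint : Γ.edge (legDart F (m.segStart e ⟨j, by omega⟩)) ∈ Γ.internal := by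
      rw [edge_legDart, m.edge_segStart]
      refine F.mem_internal.2 (outer_mem_internal.2 ?_)
      exact fun hc => (m.mem_range_subdivide_ext hn e _).1 hc he
    have hline : Γ.vert (legDart F ⟨.inr ⟨e, ⟨j, hj⟩⟩, (0 : Fin 2)⟩) ∈ γ.lineVerts := by
      rw [vert_legDart]
      exact (onV_mem_lineVerts h.1).2 rfl
    -- if `F'` had no further component on the edge, its final dart would be the other end of the
    -- segment, although it does not lie in a bivalent component
    have hjlt : j < n' e := by
      by_contra hcon
      obtain rfl : j = n' e := by omega
      obtain ⟨d, hd, hde⟩ := exists_dart_ne (d := m.start e) (by rwa [m.start_edge])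
      rw [m.start_edge] at hde
      have e3 : Γ.edge (legDart F' (m.oldDart d)) =
          Γ.edge (legDart F (m.segStart e ⟨n' e, by omega⟩)) := by
        rw [h1, edge_legDart, edge_legDart, m.edge_segStart, m.edge_oldDart_finish hde hd]
        rfl
      have e4 : legDart F' (m.oldDart d) ≠ legDart F (m.segStart e ⟨n' e, by omega⟩) := by
        rw [h1]
        intro heq
        have h3 := legDart_injective heq
        revert h3
        generalize hx : (⟨n' e, Nat.lt_succ_of_le hj'⟩ : Fin (n' e + 1)) = x
        refine Fin.cases ?_ (fun i => ?_) x
        · exact fun h3 => hd (m.oldDart_injective h3)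
        · intro h3
          cases h3
      have e5 := internal_eq_of_darts hint e1.symm e3 e2.symm e4
      rw [e5, vert_legDart, onV_mem_lineVerts h'.1] at hline
      cases hline
    have e3 : Γ.edge (legDart F (m.segStart e ⟨j, by omega⟩)) =
        Γ.edge (legDart F' ⟨.inr ⟨e, ⟨j, hjlt⟩⟩, (0 : Fin 2)⟩) := by
      rw [h1, edge_legDart, edge_legDart, m.edge_segStart]
      exact congrArg (fun f => F'.onE (outer f)) (m.subdivide_edge_zero e ⟨j, hjlt⟩).symm
    have e4 : legDart F (m.segStart e ⟨j, by omega⟩) ≠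
        legDart F' ⟨.inr ⟨e, ⟨j, hjlt⟩⟩, (0 : Fin 2)⟩ := by
      rw [h1]
      intro heq
      have h3 := legDart_injective heq
      rcases j with _ | j
      · cases h3
      · have h4 : (⟨.inr ⟨e, ⟨j, Nat.lt_of_succ_lt hjlt⟩⟩, (1 : Fin 2)⟩ : (m.subdivide n').P) =
          ⟨.inr ⟨e, ⟨j + 1, hjlt⟩⟩, (0 : Fin 2)⟩ := h3
        exact Nat.succ_ne_self j (fst_inr_inj (congrArg Sigma.fst h4)).symm
    have hzero := internal_eq_of_darts hint e1.symm e3.symm e2.symm e4.symm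
    refine ⟨hjlt, ?_, fun i hi => ?_⟩
    · -- the component through which the edge passes has exactly one other external dart
      change legDart F ⟨.inr ⟨e, ⟨j, hj⟩⟩, (1 : Fin 2)⟩ =
        legDart F' ⟨.inr ⟨e, ⟨j, hjlt⟩⟩, (1 : Fin 2)⟩
      have hne := internal_nonempty_of_isRight (K := K) (w := .inr ⟨e, ⟨j, hj⟩⟩) rfl
      have hne' := internal_nonempty_of_isRight (K := K') (w := .inr ⟨e, ⟨j, hjlt⟩⟩) rfl
      have hc := (h.1 _).2 ⟨_, hne, rfl⟩
      have hc' := (h'.1 _).2 ⟨_, hne', rfl⟩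
      have hcc : (⟨_, hc⟩ : γ.comps) = ⟨_, hc'⟩ := ProperSubgraph.comp_unique
        (v := Γ.vert (legDart F ⟨.inr ⟨e, ⟨j, hj⟩⟩, (0 : Fin 2)⟩))
        (by rw [vert_legDart]; exact mem_verts_compSet.2 ⟨rfl, hne⟩)
        (by rw [hzero, vert_legDart]; exact mem_verts_compSet.2 ⟨rfl, hne'⟩)
      have hcc' : compSet F (.inr ⟨e, ⟨j, hj⟩⟩) = compSet F' (.inr ⟨e, ⟨j, hjlt⟩⟩) :=
        congrArg Subtype.val hcc
      have hmem := (mem_extDarts_compSet (F := F) hne).2 ⟨(1 : Fin 2), rfl⟩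
      rw [hcc'] at hmem
      obtain ⟨k, hk⟩ := (mem_extDarts_compSet (F := F') hne').1 hmem
      have hk' : ∀ k : Fin 2, k = 0 ∨ k = 1 := by decide
      rcases hk' k with rfl | rfl
      · rw [← hzero] at hk
        have h3 := legDart_injective hk
        have h4 : (1 : Fin 2) = 0 := eq_of_heq (Sigma.mk.inj h3).2
        exact absurd h4 (by decide)
      · exact hk
    · rcases Nat.lt_succ_iff_lt_or_eq.1 hi with hi | rfl
      · exact h2 i hi
      · exact hzero

/-- The numbers of bivalent components on the edges are determined by the subgraph. -/
lemma Presents.eq_count (hn : ∀ k, n (Γ₀.ext k) = 0) (hn' : ∀ k, n' (Γ₀.ext k) = 0)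
    {hΓ : Γ.IsOnePI} {φ : Iso (contract hΓ γ) Γ₀} (h : m.Presents F hΓ γ φ)
    (h' : m.Presents F' hΓ γ φ) : n = n' := by
  funext e
  exact le_antisymm (h.legDart_eq m hn h' e (n e) le_rfl).1 (h'.legDart_eq m hn' h e (n' e) le_rfl).1

lemma Presents.legDart_unique {K' : ∀ w, StableGraph ((m.subdivide n).wtype w)}
    {F' : Iso ((m.subdivide n).subst K') Γ} (hn : ∀ k, n (Γ₀.ext k) = 0)
    {hΓ : Γ.IsOnePI} {φ : Iso (contract hΓ γ) Γ₀} (h : m.Presents F hΓ γ φ)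
    (h' : m.Presents F' hΓ γ φ) (p : (m.subdivide n).P) : legDart F p = legDart F' p := by
  obtain ⟨v | ⟨e, i⟩, k⟩ := p
  · obtain ⟨d, hd⟩ := m.eq_oldDart_of_isLeft (p := ⟨.inl v, k⟩) rfl
    rw [hd]
    obtain ⟨h1, h2⟩ := h.2 d
    obtain ⟨h3, h4⟩ := h'.2 d
    exact congrArg Subtype.val (φ.onD.injective (h2.trans h4.symm))
  · have hk' : ∀ k : Fin 2, k = 0 ∨ k = 1 := by decide
    obtain ⟨h1, h2, h3⟩ := h.legDart_eq m hn h' e (i + 1) i.2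
    rcases hk' k with rfl | rfl
    · exact h3 i (Nat.lt_succ_self i)
    · exact h2

/-- Whether `F` presents a subgraph depends only on the images of the darts of the skeleton. -/
lemma Presents.congr {K' : ∀ w, StableGraph ((m.subdivide n).wtype w)}
    {F' : Iso ((m.subdivide n).subst K') Γ}
    {hΓ : Γ.IsOnePI} {φ : Iso (contract hΓ γ) Γ₀} (h : m.Presents F hΓ γ φ)
    (heq : ∀ p, legDart F' p = legDart F p) : m.Presents F' hΓ γ φ := by
  obtain ⟨α, hα⟩ := exists_substIso (F'.trans F.symm) m.subdivide_incident (fun w k => by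
    change F.onD.symm (F'.onD _) = _
    have := heq ⟨w, k⟩
    rw [legDart, legDart] at this
    rw [this, Equiv.symm_apply_apply])
  have hα' : ∀ w (x : (K' w).1.internal), F'.onE (inner w x) =
      F.onE (inner w ⟨(α w).onE x, (α w).mem_internal.2 x.2⟩) := by
    intro w x
    rw [← substIso_onE_inner, ← hα]
    change _ = F.onE (F.onE.symm (F'.onE _))
    rw [Equiv.apply_symm_apply]
  have hcomp : ∀ w, compSet F' w = compSet F w := by
    intro w
    ext e
    constructor
    · rintro ⟨x, rfl⟩
      exact ⟨_, (hα' w x).symm⟩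
    · rintro ⟨x, rfl⟩
      refine ⟨⟨(α w).symm.onE x, (α w).symm.mem_internal.2 x.2⟩, ?_⟩
      dsimp only
      rw [hα']
      congr 2
      exact Subtype.ext ((α w).onE.apply_symm_apply _)
  have hne : ∀ w, (K' w).1.internal.Nonempty ↔ (K w).1.internal.Nonempty := fun w =>
    ⟨fun ⟨x, hx⟩ => ⟨_, (α w).mem_internal.2 hx⟩, fun ⟨x, hx⟩ => ⟨_, (α w).symm.mem_internal.2 hx⟩⟩
  refine ⟨fun c => ?_, fun d => ?_⟩
  · simp only [hcomp, hne]
    exact h.1 c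
  · simp only [heq]
    exact h.2 d

end FeynmanGraph.Marking

/-! ### Assembling a graph from pieces -/

namespace FeynmanGraph

variable {r : Res} {Γ : FeynmanGraph r}

/-- The map `b` identifies the stable graph `K` with the part of `Γ` that has the vertices `U` and
the internal edges `c`. -/
structure IsPiece (U : Set Γ.V) (c : Set Γ.E) {s : Res} (K : StableGraph s)
    (b : K.1.D → Γ.D) : Prop where
  inj : Function.Injective b
  range : ∀ d, (∃ x, b x = d) ↔ Γ.vert d ∈ U
  vert : ∀ x y, K.1.vert x = K.1.vert y ↔ Γ.vert (b x) = Γ.vert (b y)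
  vtype : ∀ x, Γ.vtype (Γ.vert (b x)) = K.1.vtype (K.1.vert x)
  edge_mem : ∀ x, K.1.edge x ∈ K.1.internal ↔ Γ.edge (b x) ∈ c
  edge_eq : ∀ x y, K.1.edge x ∈ K.1.internal → K.1.edge y ∈ K.1.internal →
    (K.1.edge x = K.1.edge y ↔ Γ.edge (b x) = Γ.edge (b y))
  etype : ∀ x, Γ.etype (Γ.edge (b x)) = K.1.etype (K.1.edge x)

/-- A tree with one vertex. -/
def corolla (v : Vertex) : FeynmanGraph (.inl v) where
  V := Unit
  E := Fin v.legs.length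
  D := Fin v.legs.length
  vtype _ := v
  etype := v.legs.get
  vert _ := ()
  edge := id
  ext := id
  edge_ends e := by
    change Nat.card {d : Fin v.legs.length // d = e} +
      Nat.card {k : Fin v.legs.length // k = e} = 2
    simp
  vertex_legs _ t := by
    rw [← card_get_eq_count]
    exact Nat.card_congr (Equiv.subtypeEquivRight fun _ => by simp)
  ext_type _ := rfl

lemma corolla_internal (v : Vertex) : (corolla v).internal = ∅ :=
  Set.eq_empty_of_forall_notMem fun e he => he ⟨e, rfl⟩

lemma corolla_isStable (v : Vertex) : (corolla v).IsStable :=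
  ⟨fun e => ⟨e, rfl⟩, fun _ _ _ => .refl⟩

/-- The darts of a stable graph without internal edges are its legs. -/
noncomputable def IsStable.legEquiv {s : Res} {K : FeynmanGraph s} (h : K.IsStable)
    (hi : K.internal = ∅) : Fin s.legs.length ≃ K.D :=
  Equiv.ofBijective h.leg ⟨h.leg_injective, fun d => by
    obtain ⟨k, hk⟩ := h.exists_leg (d := d) (by rw [hi]; exact Set.notMem_empty _)
    exact ⟨k, hk.symm⟩⟩

/-- A stable graph without internal edges is determined by its residue. -/
lemma exists_iso_of_internal_eq_empty {s : Res} {K K' : FeynmanGraph s} (h : K.IsStable)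
    (h' : K'.IsStable) (hi : K.internal = ∅) (hi' : K'.internal = ∅) : Nonempty (Iso K K') := by
  have hleg : ∀ d : K.D, ∃ k, d = h.leg k ∧ (h.legEquiv hi).symm.trans (h'.legEquiv hi') d =
      h'.leg k := fun d => by
    obtain ⟨k, rfl⟩ := (h.legEquiv hi).surjective d
    exact ⟨k, rfl, by rw [Equiv.trans_apply, Equiv.symm_apply_apply]; rfl⟩
  obtain ⟨F, -⟩ := exists_iso_of_darts h.incident h'.incident
    ((h.legEquiv hi).symm.trans (h'.legEquiv hi'))
    (fun d d' => ⟨fun _ => h'.vert_unique hi' _ _, fun _ => h.vert_unique hi _ _⟩)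
    (fun d => Sum.inl_injective ((h'.res_eq hi' _).symm.trans (h.res_eq hi _)))
    (fun d d' => by
      obtain ⟨k, hk, hk'⟩ := hleg d
      obtain ⟨l, hl, hl'⟩ := hleg d'
      rw [hk', hl', hk, hl, h.edge_leg, h.edge_leg, h'.edge_leg, h'.edge_leg,
        h.ext_injective.eq_iff, h'.ext_injective.eq_iff])
    (fun d => by
      obtain ⟨k, hk, hk'⟩ := hleg d
      rw [hk', hk, h.edge_leg, h'.edge_leg, K.ext_type, K'.ext_type])
    (fun k => ⟨h.leg k, (h.edge_leg k).symm, by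
      have h1 : (h.legEquiv hi).symm (h.leg k) = k := (h.legEquiv hi).symm_apply_apply k
      rw [Equiv.trans_apply, h1]
      exact (h'.edge_leg k).symm⟩)
  exact ⟨F⟩

/-- A vertex of `Γ`, with a labelling of its darts, is a piece. -/
lemma exists_isPiece_of_internal_eq_empty (v : Γ.V) {s : Res} (hs : s = .inl (Γ.vtype v))
    (θ : Fin s.legs.length → Γ.D) (hinj : Function.Injective θ)
    (hrange : ∀ d, (∃ k, θ k = d) ↔ Γ.vert d = v)
    (htype : ∀ k, Γ.etype (Γ.edge (θ k)) = s.legs.get k) (K : StableGraph s)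
    (hK : K.1.internal = ∅) :
    ∃ b : K.1.D → Γ.D, IsPiece {v} ∅ K b ∧ ∀ k, b (K.2.leg k) = θ k := by
  have hleg : ∀ k, (K.2.legEquiv hK).symm (K.2.leg k) = k := (K.2.legEquiv hK).symm_apply_apply
  have hv : ∀ k, Γ.vert (θ k) = v := fun k => (hrange _).1 ⟨k, rfl⟩
  refine ⟨fun x => θ ((K.2.legEquiv hK).symm x),
    ⟨hinj.comp (K.2.legEquiv hK).symm.injective, fun d => ?_, fun x y => ?_, fun x => ?_,
    fun x => ?_, fun x y hx => ?_, fun x => ?_⟩, fun k => congrArg θ (hleg k)⟩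
  · refine Iff.trans ?_ (hrange d)
    exact ((K.2.legEquiv hK).symm.surjective.exists (p := fun k => θ k = d)).symm
  · exact ⟨fun _ => (hv _).trans (hv _).symm, fun _ => K.2.vert_unique hK _ _⟩
  · rw [hv]
    exact Sum.inl_injective (hs.symm.trans (K.2.res_eq hK _))
  · rw [hK]
    exact Iff.rfl
  · rw [hK] at hx
    exact hx.elim
  · obtain ⟨k, rfl⟩ := (K.2.legEquiv hK).surjective x
    rw [Equiv.symm_apply_apply, htype]
    exact (K.1.ext_type k).symm.trans (congrArg K.1.etype (K.2.edge_leg k).symm)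

lemma exists_isPiece_of_vertex (v : Γ.V) {s : Res} (hs : s = .inl (Γ.vtype v))
    (θ : Fin s.legs.length → Γ.D) (hinj : Function.Injective θ)
    (hrange : ∀ d, (∃ k, θ k = d) ↔ Γ.vert d = v)
    (htype : ∀ k, Γ.etype (Γ.edge (θ k)) = s.legs.get k) :
    ∃ (K : StableGraph s) (b : K.1.D → Γ.D), IsPiece {v} ∅ K b ∧ ∀ k, b (K.2.leg k) = θ k := by
  obtain ⟨K, hK⟩ : ∃ K : StableGraph s, K.1.internal = ∅ := by
    subst hs
    exact ⟨⟨corolla _, corolla_isStable _⟩, corolla_internal _⟩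
  exact ⟨K, exists_isPiece_of_internal_eq_empty v hs θ hinj hrange htype K hK⟩

lemma sub_edge_of_mem {c : Set Γ.E} (hc : Γ.IsSub c) (ℓ : Γ.Labeling c) {d : Γ.D}
    (hd : Γ.vert d ∈ Γ.verts c) (h : Γ.edge d ∈ c) :
    (sub hc ℓ).edge ⟨d, hd⟩ = Sum.inl ⟨Γ.edge d, h⟩ := dif_pos h

lemma sub_edge_of_notMem {c : Set Γ.E} (hc : Γ.IsSub c) (ℓ : Γ.Labeling c) {d : Γ.D}
    (hd : Γ.vert d ∈ Γ.verts c) (h : Γ.edge d ∉ c) :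
    (sub hc ℓ).edge ⟨d, hd⟩ = Sum.inr ⟨d, hd, h⟩ := dif_neg h

lemma sub_mem_internal {c : Set Γ.E} (hc : Γ.IsSub c) (ℓ : Γ.Labeling c)
    (x : (sub hc ℓ).D) : (sub hc ℓ).edge x ∈ (sub hc ℓ).internal ↔ Γ.edge x.1 ∈ c := by
  obtain ⟨d, hd⟩ := x
  by_cases h : Γ.edge d ∈ c
  · rw [sub_edge_of_mem hc ℓ hd h]
    exact ⟨fun _ => h, fun _ => by rintro ⟨k, hk⟩; cases hk⟩
  · rw [sub_edge_of_notMem hc ℓ hd h]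
    refine ⟨fun hi => (hi ⟨ℓ.equiv.symm ⟨d, hd, h⟩, ?_⟩).elim, fun hi => (h hi).elim⟩
    exact congrArg Sum.inr (ℓ.equiv.apply_symm_apply _)

/-- A subgraph with a labelling of its external lines is a piece. -/
lemma exists_isPiece_of_isSub {c : Set Γ.E} (hc : Γ.IsSub c) {s : Res}
    (θ : Fin s.legs.length → Γ.D) (hinj : Function.Injective θ)
    (hrange : ∀ d, (∃ k, θ k = d) ↔ d ∈ Γ.extDarts c)
    (htype : ∀ k, Γ.etype (Γ.edge (θ k)) = s.legs.get k) :
    ∃ (K : StableGraph s) (b : K.1.D → Γ.D),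
      IsPiece (Γ.verts c) c K b ∧ ∀ k, b (K.2.leg k) = θ k := by
  let ℓ : Γ.Labeling c := ⟨s, Equiv.ofBijective
    (fun k => ⟨θ k, (hrange _).1 ⟨k, rfl⟩⟩) ⟨fun k k' h => hinj (congrArg Subtype.val h),
      fun d => by
        obtain ⟨k, hk⟩ := (hrange d.1).2 d.2
        exact ⟨k, Subtype.ext hk⟩⟩, htype⟩
  have hst := (sub_isOnePI hc ℓ).isStable
  refine ⟨⟨sub hc ℓ, hst⟩, fun d => d.1, ⟨fun _ _ h => Subtype.ext h, fun d => ?_, fun x y => ?_,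
    fun x => rfl, sub_mem_internal hc ℓ, fun x y hx hy => ?_, fun x => ?_⟩, fun k => ?_⟩
  · exact ⟨fun ⟨x, hx⟩ => hx ▸ x.2, fun h => ⟨⟨d, h⟩, rfl⟩⟩
  · exact ⟨fun h => congrArg Subtype.val h, fun h => Subtype.ext h⟩
  · have hx' := (sub_mem_internal hc ℓ x).1 hx
    have hy' := (sub_mem_internal hc ℓ y).1 hy
    refine (iff_of_eq (congrArg₂ _ (sub_edge_of_mem hc ℓ x.2 hx')
      (sub_edge_of_mem hc ℓ y.2 hy'))).trans ?_
    exact ⟨fun h => congrArg Subtype.val (Sum.inl.inj h),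
      fun h => congrArg Sum.inl (Subtype.ext h)⟩
  · by_cases h : Γ.edge x.1 ∈ c
    · exact congrArg (sub hc ℓ).etype (sub_edge_of_mem hc ℓ x.2 h).symm
    · exact congrArg (sub hc ℓ).etype (sub_edge_of_notMem hc ℓ x.2 h).symm
  · have h1 := hst.edge_leg k
    by_cases h : Γ.edge (hst.leg k).1 ∈ c
    · have h2 := (sub_edge_of_mem hc ℓ (hst.leg k).2 h).symm.trans h1
      cases h2
    · have h2 := (sub_edge_of_notMem hc ℓ (hst.leg k).2 h).symm.trans h1
      exact congrArg Subtype.val (Sum.inr.inj h2)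

/-- A graph whose vertices are partitioned into pieces that are joined by the edges of a skeleton
is isomorphic to the substituted graph. Here `seg` sends the edges of the skeleton to the edges of
`Γ` outside the pieces. -/
lemma exists_iso_of_pieces (hΓ : ∀ e, ∃ d, Γ.edge d = e) {Q : Skeleton r}
    (hQ : ∀ f, ∃ p, Q.edge p = f) {K : ∀ w, StableGraph (Q.wtype w)}
    (U : Q.W → Set Γ.V) (c : Q.W → Set Γ.E) (b : ∀ w, (K w).1.D → Γ.D)
    (hb : ∀ w, IsPiece (U w) (c w) (K w) (b w)) (hU : ∀ v, ∃ w, v ∈ U w)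
    (hU' : ∀ v w w', v ∈ U w → v ∈ U w' → w = w') (hc : ∀ w d, Γ.edge d ∈ c w → Γ.vert d ∈ U w)
    (seg : Q.F → Γ.E) (hseg : Function.Injective seg)
    (hleg : ∀ w k, Γ.edge (b w ((K w).2.leg k)) = seg (Q.edge ⟨w, k⟩))
    (hsegc : ∀ f w, seg f ∉ c w) (hext : ∀ k, Γ.ext k = seg (Q.ext k)) :
    ∃ F : Iso (Q.subst K) Γ, ∀ w x, F.onD (Skeleton.dart w x) = b w x := by
  open Skeleton in
  have hvU : ∀ w x, Γ.vert (b w x) ∈ U w := fun w x => ((hb w).range _).1 ⟨x, rfl⟩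
  let g : (Q.subst K).D → Γ.D := fun x => b x.1 x.2
  have hg : ∀ w x, g (dart w x) = b w x := fun _ _ => rfl
  have hbij : Function.Bijective g := by
    constructor
    · intro x y hxy
      obtain ⟨w, x, rfl⟩ := exists_eq_dart x
      obtain ⟨w', y, rfl⟩ := exists_eq_dart y
      rw [hg, hg] at hxy
      obtain rfl := hU' _ w w' (hvU w x) (hxy ▸ hvU w' y)
      rw [(hb w).inj hxy]
    · intro d
      obtain ⟨w, hw⟩ := hU (Γ.vert d)
      obtain ⟨x, hx⟩ := ((hb w).range d).2 hw
      exact ⟨dart w x, hx⟩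
  have hedge : ∀ w x w' y, (Q.subst K).edge (dart w x) = (Q.subst K).edge (dart w' y) ↔
      Γ.edge (b w x) = Γ.edge (b w' y) := by
    intro w x w' y
    by_cases hx : (K w).1.edge x ∈ (K w).1.internal
    · by_cases hy : (K w').1.edge y ∈ (K w').1.internal
      · have hy' := ((hb w').edge_mem y).1 hy
        rw [edge_dart_internal w x hx, edge_dart_internal w' y hy]
        constructor
        · intro h
          obtain rfl := inner_eq h
          exact ((hb w).edge_eq x y hx hy).1 (congrArg Subtype.val (inner_inj.1 h))
        · intro h
          obtain rfl := hU' _ w w' (hvU w x) (hc w' _ (h ▸ hy'))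
          exact inner_inj.2 (Subtype.ext (((hb w).edge_eq x y hx hy).2 h))
      · obtain ⟨k, rfl⟩ := (K w').2.exists_leg hy
        rw [edge_dart_internal w x hx, edge_dart_leg, hleg]
        exact ⟨fun h => (outer_ne_inner h.symm).elim,
          fun h => (hsegc _ w (h ▸ ((hb w).edge_mem x).1 hx)).elim⟩
    · obtain ⟨k, rfl⟩ := (K w).2.exists_leg hx
      by_cases hy : (K w').1.edge y ∈ (K w').1.internal
      · rw [edge_dart_internal w' y hy, edge_dart_leg, hleg]
        exact ⟨fun h => (outer_ne_inner h).elim,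
          fun h => (hsegc _ w' (h ▸ ((hb w').edge_mem y).1 hy)).elim⟩
      · obtain ⟨k', rfl⟩ := (K w').2.exists_leg hy
        rw [edge_dart_leg, edge_dart_leg, hleg, hleg, outer_inj, hseg.eq_iff]
  obtain ⟨F, hF⟩ := exists_iso_of_darts (subst_incident hQ) hΓ (Equiv.ofBijective g hbij)
    (fun x y => by
      obtain ⟨w, x, rfl⟩ := exists_eq_dart x
      obtain ⟨w', y, rfl⟩ := exists_eq_dart y
      change _ ↔ Γ.vert (b w x) = Γ.vert (b w' y)
      rw [vert_dart, vert_dart]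
      constructor
      · intro h
        obtain rfl := vtx_eq h
        exact ((hb w).vert x y).1 (vtx_inj.1 h)
      · intro h
        obtain rfl := hU' _ w w' (hvU w x) (h ▸ hvU w' y)
        exact vtx_inj.2 (((hb w).vert x y).2 h))
    (fun x => by
      obtain ⟨w, x, rfl⟩ := exists_eq_dart x
      exact (hb w).vtype x)
    (fun x y => by
      obtain ⟨w, x, rfl⟩ := exists_eq_dart x
      obtain ⟨w', y, rfl⟩ := exists_eq_dart y
      exact hedge w x w' y)
    (fun x => by
      obtain ⟨w, x, rfl⟩ := exists_eq_dart x
      rw [etype_edge_dart]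
      exact (hb w).etype x)
    (fun k => by
      obtain ⟨⟨w, k'⟩, hp⟩ := hQ (Q.ext k)
      refine ⟨dart w ((K w).2.leg k'), ?_, ?_⟩
      · rw [edge_dart_leg, hp, subst_ext]
      · rw [hext, ← hp]
        exact (hleg w k').symm)
  exact ⟨F, fun w x => hF _⟩

/-- The pieces from which a graph is assembled can be read off the resulting isomorphism. -/
lemma compSet_eq_of_pieces (hΓ : ∀ e, ∃ d, Γ.edge d = e) {Q : Skeleton r}
    {K : ∀ w, StableGraph (Q.wtype w)} {U : Q.W → Set Γ.V} {c : Q.W → Set Γ.E}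
    {b : ∀ w, (K w).1.D → Γ.D} (hb : ∀ w, IsPiece (U w) (c w) (K w) (b w))
    (hc : ∀ w d, Γ.edge d ∈ c w → Γ.vert d ∈ U w) {F : Iso (Q.subst K) Γ}
    (hF : ∀ w x, F.onD (Skeleton.dart w x) = b w x) (w : Q.W) : Skeleton.compSet F w = c w := by
  open Skeleton in
  ext e
  obtain ⟨d, rfl⟩ := hΓ e
  constructor
  · intro h
    obtain ⟨w', x, rfl⟩ := exists_eq_onD_dart (F := F) d
    obtain ⟨rfl, hx⟩ := edge_onD_mem_compSet.1 h
    rw [hF]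
    exact ((hb w').edge_mem x).1 hx
  · intro h
    obtain ⟨x, rfl⟩ := ((hb w).range d).2 (hc w d h)
    rw [← hF]
    exact edge_onD_mem_compSet.2 ⟨rfl, ((hb w).edge_mem x).2 h⟩

end FeynmanGraph

/-! ### Following an edge of a contracted graph -/

namespace FeynmanGraph

variable {r : Res} {Γ : FeynmanGraph r}

open Classical in
/-- The other end of an internal edge; darts on external edges are fixed. -/
noncomputable def flip (d : Γ.D) : Γ.D :=
  if h : Γ.edge d ∈ Γ.internal then (exists_dart_ne h).choose else d

lemma edge_flip (d : Γ.D) : Γ.edge (flip d) = Γ.edge d := by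
  unfold flip
  split_ifs with h
  · exact (exists_dart_ne h).choose_spec.2
  · rfl

lemma flip_ne {d : Γ.D} (h : Γ.edge d ∈ Γ.internal) : flip d ≠ d := by
  unfold flip
  rw [dif_pos h]
  exact (exists_dart_ne h).choose_spec.1

lemma flip_of_notMem {d : Γ.D} (h : Γ.edge d ∉ Γ.internal) : flip d = d := dif_neg h

lemma flip_flip (d : Γ.D) : flip (flip d) = d := by
  by_cases h : Γ.edge d ∈ Γ.internal
  · have h' : Γ.edge (flip d) ∈ Γ.internal := by rwa [edge_flip]
    exact internal_eq_of_darts h' ((edge_flip _).trans rfl) (edge_flip d).symm (flip_ne h')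
      (flip_ne h).symm
  · rw [flip_of_notMem h, flip_of_notMem h]

/-- The two ends of an edge. -/
lemma eq_or_eq_flip (hΓ : Γ.IsStable) {d d' : Γ.D} (h : Γ.edge d' = Γ.edge d) :
    d' = d ∨ d' = flip d := by
  by_cases hi : Γ.edge d ∈ Γ.internal
  · by_cases hd : d' = d
    · exact .inl hd
    · exact .inr (internal_eq_of_darts hi h (edge_flip d) hd (flip_ne hi))
  · obtain ⟨k, rfl⟩ := hΓ.exists_leg hi
    exact .inl (hΓ.eq_leg (h.trans (hΓ.edge_leg k)))

namespace ProperSubgraph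

variable (γ : Γ.ProperSubgraph)

lemma exists_through {d : Γ.D} (h : ∃ c : γ.comps, (γ.residue c).isRight ∧ d ∈ Γ.extDarts c.1) :
    ∃ d', d' ≠ d ∧ ∀ c : γ.comps, d ∈ Γ.extDarts c.1 →
      d' ∈ Γ.extDarts c.1 ∧ ∀ x ∈ Γ.extDarts c.1, x = d ∨ x = d' := by
  obtain ⟨c, hc, hd⟩ := h
  obtain ⟨d₁, h1, d₂, h2, hne, hall, -⟩ := line_extDarts hc
  have key : ∀ d', d' ≠ d → d' ∈ Γ.extDarts c.1 →
      (∀ x ∈ Γ.extDarts c.1, x = d ∨ x = d') → ∃ d', d' ≠ d ∧ ∀ c : γ.comps, d ∈ Γ.extDarts c.1 →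
      d' ∈ Γ.extDarts c.1 ∧ ∀ x ∈ Γ.extDarts c.1, x = d ∨ x = d' := by
    intro d' h3 h4 h5
    refine ⟨d', h3, fun c' hc' => ?_⟩
    obtain rfl := comp_unique hc'.1 hd.1
    exact ⟨h4, h5⟩
  rcases hall d hd with rfl | rfl
  · exact key d₂ hne.symm h2 hall
  · exact key d₁ hne h1 fun x hx => (hall x hx).symm

open Classical in
/-- The other external line of a component whose residue is an edge; all other darts are fixed. -/
noncomputable def through (d : Γ.D) : Γ.D :=
  if h : ∃ c : γ.comps, (γ.residue c).isRight ∧ d ∈ Γ.extDarts c.1 then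
    (γ.exists_through h).choose else d

variable {γ} {c : γ.comps} {d : Γ.D}

lemma through_ne (hc : (γ.residue c).isRight) (hd : d ∈ Γ.extDarts c.1) : γ.through d ≠ d := by
  have h : ∃ c : γ.comps, (γ.residue c).isRight ∧ d ∈ Γ.extDarts c.1 := ⟨c, hc, hd⟩
  unfold through
  rw [dif_pos h]
  exact (γ.exists_through h).choose_spec.1

lemma through_mem (hc : (γ.residue c).isRight) (hd : d ∈ Γ.extDarts c.1) :
    γ.through d ∈ Γ.extDarts c.1 := by
  have h : ∃ c : γ.comps, (γ.residue c).isRight ∧ d ∈ Γ.extDarts c.1 := ⟨c, hc, hd⟩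
  unfold through
  rw [dif_pos h]
  exact ((γ.exists_through h).choose_spec.2 c hd).1

lemma eq_or_eq_through (hc : (γ.residue c).isRight) (hd : d ∈ Γ.extDarts c.1) {x : Γ.D}
    (hx : x ∈ Γ.extDarts c.1) : x = d ∨ x = γ.through d := by
  have h : ∃ c : γ.comps, (γ.residue c).isRight ∧ d ∈ Γ.extDarts c.1 := ⟨c, hc, hd⟩
  unfold through
  rw [dif_pos h]
  exact ((γ.exists_through h).choose_spec.2 c hd).2 x hx

lemma through_of_notMem (h : Γ.vert d ∉ γ.lineVerts) : γ.through d = d :=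
  dif_neg fun ⟨c, hc, hd⟩ => h ⟨c, hc, hd.1⟩

lemma through_through (d : Γ.D) : γ.through (γ.through d) = d := by
  by_cases h : ∃ c : γ.comps, (γ.residue c).isRight ∧ d ∈ Γ.extDarts c.1
  · obtain ⟨c, hc, hd⟩ := h
    have h1 := through_mem hc hd
    rcases eq_or_eq_through hc h1 hd with h2 | h2
    · exact (through_ne hc hd h2.symm).elim
    · exact h2.symm
  · have h1 : γ.through d = d := dif_neg h
    rw [h1, h1]

variable (γ)

/-- The darts reached from `d` by repeatedly following the edge to its other end and passing
through the component there. -/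
noncomputable def path (d : Γ.D) : ℕ → Γ.D
  | 0 => d
  | j + 1 => γ.through (flip (path d j))

variable {γ}

lemma path_add (d : Γ.D) (i j : ℕ) : γ.path d (i + j) = γ.path (γ.path d i) j := by
  induction j with
  | zero => rfl
  | succ j ih => exact congrArg (fun x => γ.through (flip x)) ih

lemma path_injective (j : ℕ) : Function.Injective fun d => γ.path d j := by
  induction j with
  | zero => exact fun _ _ h => h
  | succ j ih =>
    intro d d' h
    have h1 : γ.through (flip (γ.path d j)) = γ.through (flip (γ.path d' j)) := h
    have h2 := congrArg γ.through h1
    rw [through_through, through_through] at h2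
    have h3 := congrArg flip h2
    rw [flip_flip, flip_flip] at h3
    exact ih h3

/-- A path that starts outside the bivalent components leaves them again: since each step is a
bijection of a finite set, the path returns to its start. -/
lemma exists_path_end (hd : Γ.vert d ∉ γ.lineVerts) :
    ∃ j, Γ.vert (flip (γ.path d j)) ∉ γ.lineVerts := by
  obtain ⟨i, j, hne, hij⟩ := Finite.exists_ne_map_eq_of_infinite (γ.path d)
  wlog h : i < j generalizing i j
  · exact this j i hne.symm hij.symm (lt_of_le_of_ne (not_lt.1 h) hne.symm)
  obtain ⟨p, rfl⟩ : ∃ p, j = (p + 1) + i := ⟨j - i - 1, by omega⟩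
  rw [path_add d (p + 1) i] at hij
  have h1 : d = γ.through (flip (γ.path d p)) := path_injective i hij
  have h2 := congrArg γ.through h1
  rw [through_through, through_of_notMem hd] at h2
  exact ⟨p, h2 ▸ hd⟩

/-- The number of bivalent components through which a path passes. -/
noncomputable def pathLength (hd : Γ.vert d ∉ γ.lineVerts) : ℕ :=
  open Classical in Nat.find (exists_path_end hd)

lemma vert_flip_path_length (hd : Γ.vert d ∉ γ.lineVerts) :
    Γ.vert (flip (γ.path d (pathLength hd))) ∉ γ.lineVerts := by
  classical exact Nat.find_spec (exists_path_end hd)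

lemma vert_flip_path_of_lt (hd : Γ.vert d ∉ γ.lineVerts) {j : ℕ} (hj : j < pathLength hd) :
    Γ.vert (flip (γ.path d j)) ∈ γ.lineVerts := by
  classical exact not_not.1 (Nat.find_min (exists_path_end hd) hj)

section

variable (hd : Γ.vert d ∉ γ.lineVerts) (hrest : ∀ c : γ.comps, Γ.edge d ∉ c.1)

include hrest in
lemma path_rest (j : ℕ) (hj : j ≤ pathLength hd) (c : γ.comps) : Γ.edge (γ.path d j) ∉ c.1 := by
  induction j generalizing c with
  | zero => exact hrest c
  | succ j ih =>
    obtain ⟨c', hc', hv⟩ := vert_flip_path_of_lt hd (Nat.lt_of_succ_le hj)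
    have hmem : flip (γ.path d j) ∈ Γ.extDarts c'.1 :=
      ⟨hv, by rw [edge_flip]; exact ih (Nat.le_of_succ_le hj) c'⟩
    exact not_mem_of_extDart (through_mem hc' hmem) c

include hrest in
/-- The component through which the `j`-th step of a path passes. -/
lemma exists_path_comp {j : ℕ} (hj : j < pathLength hd) : ∃ c : γ.comps,
    (γ.residue c).isRight ∧ flip (γ.path d j) ∈ Γ.extDarts c.1 ∧
      γ.path d (j + 1) ∈ Γ.extDarts c.1 := by
  obtain ⟨c, hc, hv⟩ := vert_flip_path_of_lt hd hj
  have hmem : flip (γ.path d j) ∈ Γ.extDarts c.1 :=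
    ⟨hv, by rw [edge_flip]; exact path_rest hd hrest j hj.le c⟩
  exact ⟨c, hc, hmem, through_mem hc hmem⟩

include hrest in
lemma path_chain {j : ℕ} (hj : j < pathLength hd) :
    γ.Chain ⟨Γ.edge (γ.path d j), path_rest hd hrest j hj.le⟩
      ⟨Γ.edge (γ.path d (j + 1)), path_rest hd hrest (j + 1) hj⟩ := by
  obtain ⟨c, hc, h1, h2⟩ := exists_path_comp hd hrest hj
  exact ⟨c, hc, _, h1, _, h2, edge_flip _, rfl⟩

include hrest in
lemma path_class {j : ℕ} (hj : j ≤ pathLength hd) :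
    Quot.mk γ.Chain ⟨Γ.edge (γ.path d j), path_rest hd hrest j hj⟩ =
      Quot.mk γ.Chain ⟨Γ.edge d, hrest⟩ := by
  induction j with
  | zero => rfl
  | succ j ih => exact (Quot.sound (path_chain hd hrest hj)).symm.trans (ih (Nat.le_of_succ_le hj))

include hrest in
lemma path_internal (hΓ : Γ.IsOnePI) (hi : Γ.edge d ∈ Γ.internal) {j : ℕ}
    (hj : j ≤ pathLength hd) : Γ.edge (γ.path d j) ∈ Γ.internal := by
  rw [← contract_mem_internal hΓ (e := ⟨_, path_rest hd hrest j hj⟩), path_class hd hrest hj,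
    contract_mem_internal]
  exact hi

lemma pathLength_eq_zero (hi : Γ.edge d ∉ Γ.internal) : pathLength hd = 0 := by
  by_contra hne
  have h := vert_flip_path_of_lt hd (Nat.pos_of_ne_zero hne)
  change Γ.vert (flip d) ∈ _ at h
  rw [flip_of_notMem hi] at h
  exact hd h

lemma vert_path_mem {j : ℕ} (hrest : ∀ c : γ.comps, Γ.edge d ∉ c.1) (hj : j ≤ pathLength hd)
    (h0 : j ≠ 0) : Γ.vert (γ.path d j) ∈ γ.lineVerts := by
  obtain ⟨i, rfl⟩ := Nat.exists_eq_succ_of_ne_zero h0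
  obtain ⟨c, hc, -, h2⟩ := exists_path_comp hd hrest hj
  exact ⟨c, hc, h2.1⟩

include hrest in
/-- A path along an internal edge never runs backwards. -/
lemma flip_path_ne (hΓ : Γ.IsOnePI) (hi : Γ.edge d ∈ Γ.internal) {i j : ℕ}
    (h1 : i ≤ pathLength hd) (h2 : j ≤ pathLength hd) : flip (γ.path d i) ≠ γ.path d j := by
  -- a path that runs backwards turns around in an edge or in a component; otherwise it can be
  -- shortened by one step at both ends
  have key : ∀ m i, i + m ≤ pathLength hd → flip (γ.path d i) ≠ γ.path d (i + m) := by
    intro m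
    induction m using Nat.strong_induction_on with
    | _ m ih =>
      intro i him heq
      rcases m with _ | _ | m
      · exact flip_ne (path_internal hd hrest hΓ hi him) heq
      · obtain ⟨c, hc, h3, -⟩ := exists_path_comp hd hrest (j := i) (by omega)
        exact through_ne hc h3 heq.symm
      · have h3 : flip (γ.path d i) = γ.through (flip (γ.path d (i + m + 1))) := heq
        have h4 : γ.path d (i + 1) = flip (γ.path d (i + m + 1)) := by
          change γ.through (flip (γ.path d i)) = _
          rw [h3, through_through]
        refine ih m (by omega) (i + 1) (by omega) ?_
        rw [h4, flip_flip]
        congr 1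
        omega
  rcases le_total i j with h | h
  · obtain ⟨m, rfl⟩ := Nat.exists_eq_add_of_le h
    exact key m i h2
  · obtain ⟨m, rfl⟩ := Nat.exists_eq_add_of_le h
    intro heq
    refine key m j h1 ?_
    rw [← heq, flip_flip]

include hrest in
lemma path_inj {i j : ℕ} (h1 : i ≤ pathLength hd) (h2 : j ≤ pathLength hd)
    (h : γ.path d i = γ.path d j) : i = j := by
  wlog hij : i ≤ j generalizing i j
  · exact (this h2 h1 h.symm (le_of_not_ge hij)).symm
  obtain ⟨m, rfl⟩ := Nat.exists_eq_add_of_le' hij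
  rw [path_add d m i] at h
  have h3 : d = γ.path d m := path_injective i h
  by_contra hne
  exact hd (h3 ▸ vert_path_mem hd hrest (j := m) (by omega) (by omega))

include hrest in
/-- The segments of a path are distinct. -/
lemma edge_path_inj (hΓ : Γ.IsOnePI) {i j : ℕ} (h1 : i ≤ pathLength hd) (h2 : j ≤ pathLength hd)
    (h : Γ.edge (γ.path d i) = Γ.edge (γ.path d j)) : i = j := by
  by_cases hi : Γ.edge d ∈ Γ.internal
  · rcases eq_or_eq_flip hΓ.isStable h with h3 | h3
    · exact path_inj hd hrest h1 h2 h3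
    · exact (flip_path_ne hd hrest hΓ hi h2 h1 h3.symm).elim
  · have := pathLength_eq_zero hd hi
    omega

include hrest in
/-- A path runs through all edges that are merged with the first one: the two external lines of a
bivalent component are consecutive on a path. -/
lemma exists_path_of_class (hΓ : Γ.IsOnePI) {f : γ.Rest}
    (hf : Quot.mk γ.Chain f = Quot.mk γ.Chain ⟨Γ.edge d, hrest⟩) :
    ∃ j ≤ pathLength hd, Γ.edge (γ.path d j) = f.1 := by
  have hclosed : ∀ f f' : γ.Rest, γ.Chain f f' → (∃ j ≤ pathLength hd, Γ.edge (γ.path d j) = f.1) →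
      ∃ j ≤ pathLength hd, Γ.edge (γ.path d j) = f'.1 := by
    rintro f f' ⟨c, hc, x, hx, x', hx', h1, h2⟩ ⟨j, hj, h3⟩
    rcases eq_or_eq_flip hΓ.isStable (h1.trans h3.symm) with rfl | rfl
    · have hj0 : j ≠ 0 := by
        rintro rfl
        exact hd ⟨c, hc, hx.1⟩
      obtain ⟨i, rfl⟩ := Nat.exists_eq_succ_of_ne_zero hj0
      have h4 := through_through (γ := γ) (flip (γ.path d i))
      rcases eq_or_eq_through hc hx hx' with h5 | h5
      · exact ⟨i + 1, hj, by rw [← h2, h5]⟩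
      · refine ⟨i, by omega, ?_⟩
        rw [← h2, h5]
        change _ = Γ.edge (γ.through (γ.through (flip (γ.path d i))))
        rw [h4, edge_flip]
    · have hjn : j < pathLength hd := by
        by_contra hcon
        obtain rfl : j = pathLength hd := by omega
        exact vert_flip_path_length hd ⟨c, hc, hx.1⟩
      rcases eq_or_eq_through hc hx hx' with h5 | h5
      · exact ⟨j, hj, by rw [← h2, h5, edge_flip]⟩
      · exact ⟨j + 1, hjn, by rw [← h2, h5]; rfl⟩
  have key : ∀ f f' : γ.Rest, Relation.EqvGen γ.Chain f f' →
      ((∃ j ≤ pathLength hd, Γ.edge (γ.path d j) = f.1) ↔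
        ∃ j ≤ pathLength hd, Γ.edge (γ.path d j) = f'.1) := by
    intro f f' h
    induction h with
    | rel a b hab => exact ⟨hclosed _ _ hab, hclosed _ _ hab.symm⟩
    | refl a => rfl
    | symm a b _ ih => exact ih.symm
    | trans a b c _ _ ih1 ih2 => exact ih1.trans ih2
  exact (key _ _ (Quot.eqvGen_exact hf)).2 ⟨0, Nat.zero_le _, rfl⟩

end

end ProperSubgraph

end FeynmanGraph

/-! ### Every contraction arises from a substitution -/

namespace FeynmanGraph

variable {r : Res} {Γ₀ Γ : FeynmanGraph r}

open ProperSubgraph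

namespace ProperSubgraph

variable (γ : Γ.ProperSubgraph)

/-- The vertices of `Γ` above a vertex of `Γ / γ`. -/
def nodeVerts (x : γ.NewV) : Set Γ.V := {v | ∃ h : v ∉ γ.lineVerts, γ.node v h = x}

/-- The edges of `Γ` shrunk to a vertex of `Γ / γ`. -/
def nodeEdges : γ.NewV → Set Γ.E := Sum.elim (fun _ => ∅) (fun c => c.1.1)

variable {γ}

lemma nodeVerts_inl (v : {v : Γ.V // ∀ c : γ.comps, v ∉ Γ.verts c.1}) :
    γ.nodeVerts (.inl v) = {v.1} := by
  ext x
  constructor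
  · rintro ⟨h, hx⟩
    exact node_eq_inl h hx
  · rintro rfl
    exact ⟨fun ⟨c, _, hc⟩ => v.2 c hc, node_of_notMem _ v.2⟩

lemma nodeVerts_inr (c : {c : γ.comps // (γ.residue c).isLeft}) :
    γ.nodeVerts (.inr c) = Γ.verts c.1.1 := by
  ext x
  constructor
  · rintro ⟨h, hx⟩
    exact node_eq_inr h hx
  · intro hx
    have h : x ∉ γ.lineVerts := by
      rintro ⟨c', hr, hc'⟩
      obtain rfl := comp_unique hc' hx
      rw [← Sum.not_isLeft] at hr
      exact hr c.2
    obtain ⟨_, h2⟩ := node_of_mem h hx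
    exact ⟨h, h2⟩

/-- The part of `Γ` above a vertex of `Γ / γ` is a piece. -/
lemma exists_isPiece_of_node (hΓ : Γ.IsOnePI) (x : γ.NewV) {s : Res}
    (hs : s = .inl ((contract hΓ γ).vtype x)) (θ : Fin s.legs.length → γ.NewD)
    (hinj : Function.Injective θ) (hrange : ∀ d, (∃ k, θ k = d) ↔ (contract hΓ γ).vert d = x)
    (htype : ∀ k, Γ.etype (Γ.edge (θ k).1) = s.legs.get k) :
    ∃ (K : StableGraph s) (b : K.1.D → Γ.D),
      IsPiece (γ.nodeVerts x) (γ.nodeEdges x) K b ∧ ∀ k, b (K.2.leg k) = (θ k).1 := by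
  have hrange' : ∀ d, (∃ k, (θ k).1 = d) ↔
      ∃ h : (∀ c : γ.comps, Γ.edge d ∉ c.1) ∧ Γ.vert d ∉ γ.lineVerts, γ.node (Γ.vert d) h.2 = x := by
    intro d
    constructor
    · rintro ⟨k, rfl⟩
      exact ⟨(θ k).2, (hrange _).1 ⟨k, rfl⟩⟩
    · rintro ⟨h, hx⟩
      obtain ⟨k, hk⟩ := (hrange ⟨d, h⟩).2 hx
      exact ⟨k, congrArg Subtype.val hk⟩
  rcases x with v | c
  · rw [nodeVerts_inl]
    refine exists_isPiece_of_vertex v.1 hs (fun k => (θ k).1)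
      (fun k k' h => hinj (Subtype.ext h)) (fun d => ?_) htype
    rw [hrange']
    constructor
    · rintro ⟨h, hx⟩
      exact node_eq_inl _ hx
    · intro h
      have h1 : ∀ c : γ.comps, Γ.vert d ∉ Γ.verts c.1 := fun c => by rw [h]; exact v.2 c
      refine ⟨⟨not_mem_of_vert h1, fun ⟨c, _, hc⟩ => h1 c hc⟩, ?_⟩
      rw [node_of_notMem _ h1]
      exact congrArg Sum.inl (Subtype.ext h)
  · rw [nodeVerts_inr]
    refine exists_isPiece_of_isSub (γ.isSub _ c.1.2) (fun k => (θ k).1)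
      (fun k k' h => hinj (Subtype.ext h)) (fun d => ?_) htype
    rw [hrange']
    constructor
    · rintro ⟨h, hx⟩
      exact ⟨node_eq_inr _ hx, h.1 _⟩
    · intro h
      have h1 : Γ.vert d ∈ γ.nodeVerts (.inr c) := by
        rw [nodeVerts_inr]
        exact h.1
      obtain ⟨h2, h3⟩ := h1
      exact ⟨⟨not_mem_of_extDart h, h2⟩, h3⟩

end ProperSubgraph

namespace Marking

open Skeleton

variable (m : Γ₀.Marking)

/-- Every contraction is presented by a substituted graph. Each edge of the contracted graph is
followed in `Γ` through the bivalent components merged into it, which are substituted for the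
vertices of the subdivision; the other components are substituted for the vertices they shrink to. -/
lemma exists_presents (h₀ : Γ₀.IsOnePI) (hΓ : Γ.IsOnePI) (γ : Γ.ProperSubgraph)
    (φ : Iso (contract hΓ γ) Γ₀) :
    ∃ (n : Γ₀.E → ℕ) (_ : ∀ k, n (Γ₀.ext k) = 0) (K : ∀ w, StableGraph ((m.subdivide n).wtype w))
      (F : Iso ((m.subdivide n).subst K) Γ), m.Presents F hΓ γ φ := by
  -- the components of `φ`, with the types that the definition of `Γ / γ` gives them
  let φV : γ.NewV ≃ Γ₀.V := φ.onV
  let φE : γ.NewE ≃ Γ₀.E := φ.onE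
  let φD : γ.NewD ≃ Γ₀.D := φ.onD
  -- the darts of `Γ` at which the edges of `Γ₀` start
  let s : Γ₀.E → γ.NewD := fun e => φD.symm (m.start e)
  have hd : ∀ e, Γ.vert (s e).1 ∉ γ.lineVerts := fun e => (s e).2.2
  have hrest : ∀ e, ∀ c : γ.comps, Γ.edge (s e).1 ∉ c.1 := fun e => (s e).2.1
  have hφe : ∀ x : γ.NewD, φE (Quot.mk γ.Chain ⟨Γ.edge x.1, x.2.1⟩) = Γ₀.edge (φD x) :=
    fun x => (φ.edge x).symm
  have hφv : ∀ x : γ.NewD, φV (γ.node (Γ.vert x.1) x.2.2) = Γ₀.vert (φD x) :=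
    fun x => (φ.vert x).symm
  have hclass : ∀ e, Quot.mk γ.Chain ⟨Γ.edge (s e).1, hrest e⟩ = φE.symm e := fun e => by
    rw [Equiv.eq_symm_apply, hφe, Equiv.apply_symm_apply, m.start_edge]
  have hint : ∀ e, Γ.edge (s e).1 ∈ Γ.internal ↔ e ∈ Γ₀.internal := fun e => by
    refine (contract_mem_internal hΓ (e := ⟨_, hrest e⟩)).symm.trans (φ.mem_internal.symm.trans ?_)
    refine iff_of_eq (congrArg (· ∈ Γ₀.internal) ?_)
    exact (φE.eq_symm_apply).1 (hclass e)
  let n : Γ₀.E → ℕ := fun e => pathLength (hd e)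
  have hn : ∀ k, n (Γ₀.ext k) = 0 := fun k =>
    pathLength_eq_zero _ fun h => (hint _).1 h ⟨k, rfl⟩
  -- the darts at which the segments of the edge `e` start
  let y : Γ₀.E → ℕ → Γ.D := fun e => γ.path (s e).1
  have hi : ∀ e, ∀ i : Fin (n e), Γ.edge (s e).1 ∈ Γ.internal := fun e i => by
    by_contra h
    have h1 : n e = 0 := pathLength_eq_zero _ h
    exact absurd i.2 (by omega)
  have hcomp : ∀ e, ∀ i : Fin (n e), ∃ c : γ.comps, (γ.residue c).isRight ∧
      flip (y e i) ∈ Γ.extDarts c.1 ∧ y e (i + 1) ∈ Γ.extDarts c.1 := fun e i =>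
    exists_path_comp (hd e) (hrest e) i.2
  choose comp hright hz hy using hcomp
  have hext : ∀ e (i : Fin (n e)) x, x ∈ Γ.extDarts (comp e i).1 ↔
      x = flip (y e i) ∨ x = y e (i + 1) := fun e i x =>
    ⟨fun hx => eq_or_eq_through (hright e i) (hz e i) hx, by
      rintro (rfl | rfl)
      · exact hz e i
      · exact hy e i⟩
  let Q := m.subdivide n
  let seg : Q.F → Γ.E := fun f => Γ.edge (y f.1 f.2)
  have hle : ∀ f : (e : Γ₀.E) × Fin (n e + 1), (f.2 : ℕ) ≤ pathLength (hd f.1) := fun f =>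
    Nat.lt_succ_iff.1 f.2.2
  have hsegrest : ∀ f (c : γ.comps), seg f ∉ c.1 := fun f => path_rest _ (hrest f.1) _ (hle f)
  have hsegclass : ∀ f, Quot.mk γ.Chain ⟨seg f, hsegrest f⟩ = φE.symm f.1 := fun f =>
    (path_class _ (hrest f.1) (hle f)).trans (hclass f.1)
  have hseg : Function.Injective seg := by
    intro f f' h
    have h1 : f.1 = f'.1 := by
      apply φE.symm.injective
      rw [← hsegclass, ← hsegclass]
      exact congrArg (Quot.mk γ.Chain) (Subtype.ext h)
    obtain ⟨e, j⟩ := f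
    obtain ⟨e', j'⟩ := f'
    dsimp only at h1
    subst h1
    have := edge_path_inj (hd e) (hrest e) hΓ (hle ⟨e, j⟩) (hle ⟨e, j'⟩) h
    exact congrArg (Sigma.mk e) (Fin.ext this)
  -- the darts of the skeleton
  let a : ∀ w, Fin (Q.wtype w).legs.length → Γ.D
    | .inl v, k => (φD.symm (m.lab v k).1).1
    | .inr p, k => if k.1 = 0 then flip (y p.1 p.2) else y p.1 (p.2 + 1)
  have ha : ∀ w k, Γ.edge (a w k) = seg (Q.edge ⟨w, k⟩) := by
    rintro (v | ⟨e, i⟩) k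
    · obtain ⟨⟨d, rfl⟩, rfl⟩ := (m.lab v).symm.surjective k
      have h1 : a (.inl (Γ₀.vert d)) ((m.lab _).symm ⟨d, rfl⟩) = (φD.symm d).1 := by
        change (φD.symm (m.lab _ ((m.lab _).symm ⟨d, rfl⟩)).1).1 = _
        rw [Equiv.apply_symm_apply]
      rw [h1]
      change _ = seg (Q.edge (m.oldDart d))
      by_cases hds : d = m.start (Γ₀.edge d)
      · have h2 : Q.edge (m.oldDart d) = ⟨Γ₀.edge d, 0⟩ := by
          conv_lhs => rw [hds]
          exact m.edge_oldDart_start _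
        rw [h2]
        exact congrArg (fun d => Γ.edge (φD.symm d).1) hds
      · rw [m.edge_oldDart_finish rfl hds]
        have hin : Γ₀.edge d ∈ Γ₀.internal := by
          intro hk
          obtain ⟨k, hk⟩ := hk
          have h3 := h₀.isStable.eq_leg hk.symm
          have h4 := h₀.isStable.eq_leg ((m.start_edge (Γ₀.edge d)).trans hk.symm)
          exact hds (h3.trans h4.symm)
        have hin' := (hint (Γ₀.edge d)).2 hin
        -- the end of the path is the other end of the edge of the contracted graph
        have hzl := vert_flip_path_length (hd (Γ₀.edge d))
        have hzr : ∀ c : γ.comps, Γ.edge (flip (y (Γ₀.edge d) (n (Γ₀.edge d)))) ∉ c.1 := fun c => by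
          rw [edge_flip]
          exact path_rest _ (hrest _) _ le_rfl c
        let z : γ.NewD := ⟨flip (y (Γ₀.edge d) (n (Γ₀.edge d))), hzr, hzl⟩
        have hz1 : Γ₀.edge (φD z) = Γ₀.edge d := by
          rw [← hφe, ← Equiv.eq_symm_apply, ← hsegclass ⟨Γ₀.edge d, Fin.last _⟩]
          exact congrArg (Quot.mk γ.Chain) (Subtype.ext (edge_flip _))
        have hz2 : φD z ≠ m.start (Γ₀.edge d) := by
          intro h
          rw [← Equiv.eq_symm_apply] at h
          exact flip_path_ne (hd _) (hrest _) hΓ hin' le_rfl (Nat.zero_le _)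
            (congrArg Subtype.val h)
        have hz3 : φD z = d := internal_eq_of_darts (d := m.start (Γ₀.edge d))
          (by rwa [m.start_edge]) (by rw [hz1, m.start_edge]) (by rw [m.start_edge]) hz2 hds
        rw [← Equiv.eq_symm_apply] at hz3
        rw [← hz3]
        exact edge_flip _
    · have hk : ∀ k : Fin 2, k = 0 ∨ k = 1 := by decide
      rcases hk k with rfl | rfl
      · exact edge_flip _
      · rfl
  have htype : ∀ w k, Γ.etype (Γ.edge (a w k)) = (Q.wtype w).legs.get k := by
    intro w k
    rw [ha]
    refine Eq.trans ?_ (Q.edge_type ⟨w, k⟩)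
    refine (φ.etype (Quot.mk γ.Chain ⟨seg _, hsegrest _⟩)).symm.trans (congrArg Γ₀.etype ?_)
    exact (φE.eq_symm_apply).1 (hsegclass _)
  -- the vertices and edges of the pieces
  let U : Q.W → Set Γ.V
    | .inl v => γ.nodeVerts (φV.symm v)
    | .inr p => Γ.verts (comp p.1 p.2).1
  let c : Q.W → Set Γ.E
    | .inl v => γ.nodeEdges (φV.symm v)
    | .inr p => (comp p.1 p.2).1
  have hpiece : ∀ w, ∃ (K : StableGraph (Q.wtype w)) (b : K.1.D → Γ.D),
      IsPiece (U w) (c w) K b ∧ ∀ k, b (K.2.leg k) = a w k := by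
    rintro (v | ⟨e, i⟩)
    · refine exists_isPiece_of_node hΓ (φV.symm v) ?_ (fun k => φD.symm (m.lab v k).1)
        (fun k k' h => (m.lab v).injective (Subtype.ext (φD.symm.injective h))) (fun d => ?_)
        (htype (.inl v))
      · refine congrArg Sum.inl ?_
        refine Eq.trans ?_ (φ.vtype (φV.symm v))
        exact congrArg Γ₀.vtype (φV.apply_symm_apply v).symm
      · have h1 : (contract hΓ γ).vert d = φV.symm v ↔ Γ₀.vert (φD d) = v := by
          rw [← hφv, ← Equiv.eq_symm_apply]
          rfl
        rw [h1]
        constructor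
        · rintro ⟨k, rfl⟩
          rw [Equiv.apply_symm_apply]
          exact (m.lab v k).2
        · intro h
          refine ⟨(m.lab v).symm ⟨φD d, h⟩, ?_⟩
          rw [Equiv.apply_symm_apply, Equiv.symm_apply_apply]
    · refine exists_isPiece_of_isSub (γ.isSub _ (comp e i).2) (a (.inr ⟨e, i⟩)) ?_ (fun d => ?_)
        (htype (.inr ⟨e, i⟩))
      · have hne : flip (y e i) ≠ y e (i + 1) := fun h => through_ne (hright e i) (hz e i) h.symm
        have hk : ∀ k : Fin 2, k = 0 ∨ k = 1 := by decide
        intro k k' h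
        rcases hk k with rfl | rfl <;> rcases hk k' with rfl | rfl
        · rfl
        · exact (hne h).elim
        · exact (hne h.symm).elim
        · rfl
      · rw [hext]
        constructor
        · rintro ⟨k, rfl⟩
          have hk : ∀ k : Fin 2, k = 0 ∨ k = 1 := by decide
          rcases hk k with rfl | rfl
          · exact .inl rfl
          · exact .inr rfl
        · rintro (rfl | rfl)
          · exact ⟨(0 : Fin 2), rfl⟩
          · exact ⟨(1 : Fin 2), rfl⟩
  choose K b hb hleg using hpiece
  -- the path along the edge of the contracted graph passes through every bivalent component
  have hcover : ∀ c' : γ.comps, (γ.residue c').isRight → ∃ e i, comp e i = c' := by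
    intro c' hc'
    obtain ⟨x, hx, -⟩ := line_extDarts hc'
    let f : γ.Rest := ⟨Γ.edge x, not_mem_of_extDart hx⟩
    obtain ⟨e, he⟩ : ∃ e, φE.symm e = Quot.mk γ.Chain f := ⟨_, φE.symm_apply_apply _⟩
    obtain ⟨j, hj, hje⟩ := exists_path_of_class (hd e) (hrest e) hΓ (he.symm.trans (hclass e).symm)
    have hxl : Γ.vert x ∈ γ.lineVerts := ⟨c', hc', hx.1⟩
    rcases eq_or_eq_flip hΓ.isStable hje.symm with rfl | rfl
    · have hj0 : j ≠ 0 := by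
        rintro rfl
        exact hd e hxl
      obtain ⟨i, rfl⟩ := Nat.exists_eq_succ_of_ne_zero hj0
      exact ⟨e, ⟨i, hj⟩, comp_unique (hy e ⟨i, hj⟩).1 hx.1⟩
    · have hjn : j < n e := by
        refine lt_of_le_of_ne hj ?_
        rintro rfl
        exact vert_flip_path_length (hd e) hxl
      exact ⟨e, ⟨j, hjn⟩, comp_unique (hz e ⟨j, hjn⟩).1 hx.1⟩
  have hcompinj : ∀ e i e' i', comp e i = comp e' i' →
      (Sum.inr ⟨e, i⟩ : Γ₀.V ⊕ (e : Γ₀.E) × Fin (n e)) = .inr ⟨e', i'⟩ := by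
    intro e i e' i' h
    have h1 := hz e i
    rw [h, hext] at h1
    rcases h1 with h1 | h1
    · have h2 : seg ⟨e, i.castSucc⟩ = seg ⟨e', i'.castSucc⟩ := by
        have := congrArg Γ.edge h1
        rwa [edge_flip, edge_flip] at this
      have h3 := hseg h2
      obtain rfl : e = e' := congrArg Sigma.fst h3
      have h4 := eq_of_heq (Sigma.mk.inj h3).2
      rw [Fin.castSucc_injective _ h4]
    · have h2 : seg ⟨e, i.castSucc⟩ = seg ⟨e', i'.succ⟩ := by
        have := congrArg Γ.edge h1
        rwa [edge_flip] at this
      have h3 := hseg h2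
      obtain rfl : e = e' := congrArg Sigma.fst h3
      exact (flip_path_ne (hd e) (hrest e) hΓ (hi e i) i.2.le i'.2 h1).elim
  have hcU : ∀ w d, Γ.edge d ∈ c w → Γ.vert d ∈ U w := by
    rintro (v | p) d h
    · change Γ.vert d ∈ γ.nodeVerts (φV.symm v)
      change Γ.edge d ∈ γ.nodeEdges (φV.symm v) at h
      generalize φV.symm v = x at h ⊢
      rcases x with x | x
      · exact h.elim
      · rw [nodeVerts_inr]
        exact ⟨d, rfl, h⟩
    · exact ⟨d, rfl, h⟩
  have hcsub : ∀ w e, e ∈ c w → ∃ c' : γ.comps, c w = c'.1 := by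
    rintro (v | p) e h
    · change ∃ c' : γ.comps, γ.nodeEdges (φV.symm v) = c'.1
      change e ∈ γ.nodeEdges (φV.symm v) at h
      generalize φV.symm v = x at h ⊢
      rcases x with x | x
      · exact h.elim
      · exact ⟨x.1, rfl⟩
    · exact ⟨_, rfl⟩
  obtain ⟨F, hF⟩ := exists_iso_of_pieces hΓ.incident (Q := Q) m.subdivide_incident U c b hb
    (fun v => by
      by_cases hv : v ∈ γ.lineVerts
      · obtain ⟨c', hc', hvc⟩ := hv
        obtain ⟨e, i, rfl⟩ := hcover c' hc'
        exact ⟨.inr ⟨e, i⟩, hvc⟩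
      · refine ⟨.inl (φV (γ.node v hv)), hv, ?_⟩
        rw [Equiv.symm_apply_apply])
    (by
      have hlr : ∀ (v : Γ.V) (x : γ.NewV) e i, v ∈ γ.nodeVerts x → v ∉ Γ.verts (comp e i).1 :=
        fun v x e i ⟨h, _⟩ h' => h ⟨_, hright e i, h'⟩
      rintro v (w | ⟨e, i⟩) (w' | ⟨e', i'⟩) h h'
      · obtain ⟨_, h1⟩ := h
        obtain ⟨_, h2⟩ := h'
        exact congrArg Sum.inl (φV.symm.injective (h1.symm.trans h2))
      · exact (hlr _ _ _ _ h h').elim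
      · exact (hlr _ _ _ _ h' h).elim
      · exact hcompinj _ _ _ _ (comp_unique h h'))
    hcU seg hseg (fun w k => by rw [hleg, ha])
    (fun f w h => by
      obtain ⟨c', hc'⟩ := hcsub w _ h
      exact hsegrest f c' (hc' ▸ h))
    (fun k => by
      have h1 : (Quot.mk γ.Chain ⟨Γ.ext k, fun c hc => (γ.isSub c.1 c.2).subset hc ⟨k, rfl⟩⟩ :
          γ.NewE) = Quot.mk γ.Chain ⟨seg (Q.ext k), hsegrest _⟩ := by
        rw [hsegclass, Equiv.eq_symm_apply, m.subdivide_ext]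
        exact (φ.extEdge k).symm
      exact congrArg Subtype.val (eq_of_mk_eq_of_ext hΓ (not_not.2 ⟨k, rfl⟩) h1))
  have hcomp := compSet_eq_of_pieces hΓ.incident hb hcU hF
  have hnonempty : ∀ w, (c w).Nonempty → (K w).1.internal.Nonempty := by
    rintro w ⟨e, he⟩
    rw [← hcomp w] at he
    obtain ⟨x, -⟩ := he
    exact ⟨x.1, x.2⟩
  refine ⟨n, hn, K, F, fun c' => ⟨fun hc' => ?_, ?_⟩, fun d => ?_⟩
  · obtain ⟨w, hw⟩ : ∃ w, c w = c' := by
      rcases hres : γ.residue ⟨c', hc'⟩ with v | t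
      · refine ⟨.inl (φV (.inr ⟨⟨c', hc'⟩, by rw [hres, Sum.isLeft_inl]⟩)), ?_⟩
        change γ.nodeEdges (φV.symm _) = _
        rw [Equiv.symm_apply_apply]
        rfl
      · obtain ⟨e, i, hei⟩ := hcover ⟨c', hc'⟩ (by rw [hres]; rfl)
        exact ⟨.inr ⟨e, i⟩, congrArg Subtype.val hei⟩
    refine ⟨w, hnonempty w ?_, ?_⟩
    · rw [hw]
      exact (γ.isSub _ hc').nonempty
    · rw [← hw, hcomp]
  · rintro ⟨w, ⟨e, he⟩, rfl⟩
    have h1 : F.onE (inner w ⟨e, he⟩) ∈ compSet F w := ⟨⟨e, he⟩, rfl⟩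
    rw [hcomp] at h1 ⊢
    obtain ⟨c', hc'⟩ := hcsub w _ h1
    rw [hc']
    exact c'.2
  · have h1 : legDart F (m.oldDart d) = (φD.symm d).1 := by
      refine (hF _ _).trans ((hleg _ _).trans ?_)
      change (φD.symm (m.lab _ ((m.lab _).symm ⟨d, rfl⟩)).1).1 = _
      rw [Equiv.apply_symm_apply]
    refine ⟨by rw [h1]; exact (φD.symm d).2, ?_⟩
    exact (φD.eq_symm_apply).1 (Subtype.ext h1)

end Marking

end FeynmanGraph

/-! ### Isomorphism classes of stable graphs and the corresponding elements of the algebra -/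

/-- Stable graphs are identified if they are isomorphic. -/
instance stableSetoid (r : Res) : Setoid (StableGraph r) where
  r Γ Γ' := Nonempty (Iso Γ.1 Γ'.1)
  iseqv := ⟨fun Γ => ⟨.refl Γ.1⟩, fun ⟨f⟩ => ⟨f.symm⟩, fun ⟨f⟩ ⟨g⟩ => ⟨f.trans g⟩⟩

/-- Isomorphism classes of stable graphs with residue `r`. -/
abbrev StableClass (r : Res) : Type 1 := Quotient (stableSetoid r)

/-- Permutations of the legs of `r` that preserve the types. -/
abbrev LegPerm (r : Res) :=
  {π : Equiv.Perm (Fin r.legs.length) // ∀ k, r.legs.get (π k) = r.legs.get k}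

namespace FeynmanGraph

variable {r : Res}

instance : Nonempty (LegPerm r) := ⟨⟨1, fun _ => rfl⟩⟩

/-- The graph with relabelled external lines. -/
def relabel (π : LegPerm r) (Γ : FeynmanGraph r) : FeynmanGraph r where
  __ := Γ
  ext k := Γ.ext (π.1 k)
  edge_ends e := by
    rw [← Γ.edge_ends e]
    congr 1
    exact Nat.card_congr (π.1.subtypeEquiv fun _ => Iff.rfl)
  ext_type k := (Γ.ext_type _).trans (π.2 k)

variable {Γ Γ' : FeynmanGraph r} (π : LegPerm r)

lemma relabel_internal : (relabel π Γ).internal = Γ.internal := by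
  ext e
  refine not_congr ⟨?_, ?_⟩
  · rintro ⟨k, rfl⟩
    exact ⟨π.1 k, rfl⟩
  · rintro ⟨k, rfl⟩
    exact ⟨π.1.symm k, congrArg Γ.ext (π.1.apply_symm_apply k)⟩

lemma relabel_isOnePI (h : Γ.IsOnePI) : (relabel π Γ).IsOnePI := by
  refine ⟨?_, h.incident, ?_⟩
  · rw [relabel_internal]
    exact h.exists_internal
  · rw [relabel_internal]
    exact h.linked

/-- Isomorphisms are unaffected by relabelling. -/
def Iso.relabel (f : Iso Γ Γ') : Iso (relabel π Γ) (relabel π Γ') where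
  onV := f.onV
  onE := f.onE
  onD := f.onD
  vtype := f.vtype
  etype := f.etype
  vert := f.vert
  edge := f.edge
  extEdge k := f.extEdge (π.1 k)

lemma nonempty_iso_relabel_relabel {π π' : LegPerm r} (h : ∀ k, π.1 (π'.1 k) = k) :
    Nonempty (Iso (relabel π' (relabel π Γ)) Γ) :=
  ⟨⟨.refl _, .refl _, .refl _, fun _ => rfl, fun _ => rfl, fun _ => rfl, fun _ => rfl,
    fun k => congrArg Γ.ext (h k).symm⟩⟩

lemma relabel_symFactor : (relabel π Γ).symFactor = Γ.symFactor :=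
  Nat.card_congr ⟨fun f => ⟨f.onV, f.onE, f.onD, f.vtype, f.etype, f.vert, f.edge, fun k => by
      obtain ⟨k, rfl⟩ := π.1.surjective k
      exact f.extEdge k⟩, fun f => f.relabel π, fun _ => rfl, fun _ => rfl⟩

lemma relabel_loopNumber : (relabel π Γ).loopNumber = Γ.loopNumber := by
  unfold loopNumber
  rw [relabel_internal]
  rfl

end FeynmanGraph

namespace GraphAlgebra

variable (k : Type*) [Field k] {r : Res}

/-- The average of a 1PI graph over all labellings of its external lines. -/
noncomputable def average {Γ : FeynmanGraph r} (h : Γ.IsOnePI) : GraphAlgebra k :=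
  (Nat.card (LegPerm r) : k)⁻¹ • ∑ π : LegPerm r, of k (relabel π Γ) (relabel_isOnePI π h)

variable {k}

lemma of_eq_of_iso {Γ Γ' : FeynmanGraph r} (f : Iso Γ Γ') (h : Γ.IsOnePI) (h' : Γ'.IsOnePI) :
    of k Γ h = of k Γ' h' := by
  unfold of
  congr 2
  exact Quotient.sound ⟨f⟩

lemma average_eq_of_iso {Γ Γ' : FeynmanGraph r} (f : Iso Γ Γ') (h : Γ.IsOnePI) (h' : Γ'.IsOnePI) :
    average k h = average k h' := by
  unfold average
  congr 1
  exact Finset.sum_congr rfl fun π _ => of_eq_of_iso (f.relabel π) _ _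

/-- The labellings of the external lines of a subgraph differ by permutations of the legs. -/
lemma ofComp_eq_average {Γ : FeynmanGraph r} {c : Set Γ.E} (hc : Γ.IsSub c) (ℓ : Γ.Labeling c) :
    ofComp k hc = average k (sub_isOnePI hc ℓ) := by
  let toLab : LegPerm ℓ.res → Γ.Labeling c := fun π =>
    ⟨ℓ.res, π.1.trans ℓ.equiv, fun k => (ℓ.type_eq _).trans (π.2 k)⟩
  have hbij : Function.Bijective toLab := by
    constructor
    · intro π π' h
      have h1 : (π.1.trans ℓ.equiv) = (π'.1.trans ℓ.equiv) :=
        eq_of_heq (Labeling.mk.inj h).2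
      refine Subtype.ext (Equiv.ext fun k => ℓ.equiv.injective ?_)
      exact congrArg (fun f => f k) h1
    · intro ℓ'
      have hres := Labeling.res_eq ℓ' ℓ
      obtain ⟨res, φ, ht⟩ := ℓ'
      dsimp only at hres
      subst hres
      refine ⟨⟨φ.trans ℓ.equiv.symm, fun k => ?_⟩, ?_⟩
      · rw [← ℓ.type_eq, Equiv.trans_apply, Equiv.apply_symm_apply]
        exact ht k
      · have h1 : (φ.trans ℓ.equiv.symm).trans ℓ.equiv = φ := by
          ext k
          simp
        have key : ∀ (ψ : Fin ℓ.res.legs.length ≃ Γ.extDarts c) (hψ : ψ = φ) ht',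
            (⟨ℓ.res, ψ, ht'⟩ : Γ.Labeling c) = ⟨ℓ.res, φ, ht⟩ := by
          rintro _ rfl _
          rfl
        exact key _ h1 _
  unfold ofComp average
  rw [Nat.card_congr (Equiv.ofBijective toLab hbij)]
  congr 1
  rw [← finsum_comp_equiv (Equiv.ofBijective toLab hbij), finsum_eq_sum_of_fintype]
  rfl

end GraphAlgebra

namespace StableClass

variable {r : Res}

/-- The class of a stable graph. -/
def mk (K : StableGraph r) : StableClass r := Quotient.mk _ K

/-- A graph in the class. -/
noncomputable def rep (s : StableClass r) : StableGraph r := s.out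

lemma mk_rep (s : StableClass r) : mk s.rep = s := Quotient.out_eq s

lemma mk_eq_iff {K K' : StableGraph r} : mk K = mk K' ↔ Nonempty (Iso K.1 K'.1) :=
  ⟨fun h => Quotient.exact h, fun h => Quotient.sound h⟩

lemma exists_iso_rep (K : StableGraph r) : Nonempty (Iso (mk K).rep.1 K.1) :=
  mk_eq_iff.1 (mk_rep _)

variable (k : Type*) [Field k]

open Classical in
/-- A stable graph as an element of the algebra: a 1PI graph is averaged over the labellings of
its external lines, and a single vertex gives `1`. -/
noncomputable def weight (s : StableClass r) : GraphAlgebra k :=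
  if h : s.rep.1.internal.Nonempty then GraphAlgebra.average k (s.rep.2.isOnePI h) else 1

/-- The order of the automorphism group. -/
noncomputable def sym (s : StableClass r) : ℕ := s.rep.1.symFactor

/-- The number of loops. -/
noncomputable def loops (s : StableClass r) : ℕ := s.rep.1.loopNumber.toNat

variable {k}

lemma weight_mk_of_nonempty {K : StableGraph r} (h : K.1.internal.Nonempty) :
    (mk K).weight k = GraphAlgebra.average k (K.2.isOnePI h) := by
  obtain ⟨f⟩ := exists_iso_rep K
  have h' : (mk K).rep.1.internal.Nonempty := by
    obtain ⟨e, he⟩ := h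
    exact ⟨_, f.symm.mem_internal.2 he⟩
  unfold weight
  rw [dif_pos h']
  exact GraphAlgebra.average_eq_of_iso f _ _

lemma weight_mk_of_empty {K : StableGraph r} (h : ¬ K.1.internal.Nonempty) :
    (mk K).weight k = 1 := by
  obtain ⟨f⟩ := exists_iso_rep K
  refine dif_neg ?_
  rintro ⟨e, he⟩
  exact h ⟨_, f.mem_internal.2 he⟩

end StableClass

namespace Skeleton

variable {r : Res} {Q : Skeleton r} {K : ∀ w, StableGraph (Q.wtype w)} {Γ : FeynmanGraph r}
  {F : Iso (Q.subst K) Γ}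

/-- The subgraph given by a piece is isomorphic to that piece. -/
lemma nonempty_iso_sub {w : Q.W} (hne : (K w).1.internal.Nonempty) :
    Nonempty (Iso (K w).1 (sub (compSet_isSub (F := F) hne) (compLabeling hne))) := by
  have hsub := compSet_isSub (F := F) hne
  have hst := (sub_isOnePI hsub (compLabeling hne)).isStable
  have hmem : ∀ x, Γ.vert (F.onD (dart w x)) ∈ Γ.verts (compSet F w) := fun x => by
    rw [vert_onD_dart]
    exact mem_verts_compSet.2 ⟨rfl, hne⟩
  let f : (K w).1.D → {d // Γ.vert d ∈ Γ.verts (compSet F w)} := fun x => ⟨F.onD (dart w x), hmem x⟩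
  have hf : Function.Bijective f := by
    constructor
    · intro x y h
      exact dart_inj.1 (F.onD.injective (congrArg Subtype.val h))
    · rintro ⟨d, hd⟩
      obtain ⟨w', x, rfl⟩ := exists_eq_onD_dart (F := F) d
      have hd' := hd
      rw [vert_onD_dart] at hd'
      obtain ⟨rfl, -⟩ := mem_verts_compSet.1 hd'
      exact ⟨x, rfl⟩
  have hin : ∀ x, Γ.edge (F.onD (dart w x)) ∈ compSet F w ↔
      (K w).1.edge x ∈ (K w).1.internal := fun x =>
    edge_onD_mem_compSet.trans ⟨fun h => h.2, fun h => ⟨rfl, h⟩⟩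
  have hleg : ∀ k, hst.leg k = f ((K w).2.leg k) := by
    intro k
    refine (hst.eq_leg ?_).symm
    exact sub_edge_of_notMem hsub _ (hmem _) fun h => (K w).2.edge_leg_notMem k ((hin _).1 h)
  have het : ∀ x, (sub hsub (compLabeling hne)).etype ((sub hsub (compLabeling hne)).edge (f x)) =
      Γ.etype (Γ.edge (F.onD (dart w x))) := by
    intro x
    by_cases h : Γ.edge (F.onD (dart w x)) ∈ compSet F w
    · exact congrArg (sub hsub (compLabeling hne)).etype (sub_edge_of_mem hsub _ (hmem x) h)
    · exact congrArg (sub hsub (compLabeling hne)).etype (sub_edge_of_notMem hsub _ (hmem x) h)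
  obtain ⟨G, -⟩ := exists_iso_of_darts (Γ' := sub hsub (compLabeling hne)) (K w).2.incident
    hst.incident (Equiv.ofBijective f hf)
    (fun x y => by
      rw [← vtx_inj (K := K), ← F.onV.apply_eq_iff_eq, ← vert_onD_dart, ← vert_onD_dart]
      exact ⟨fun h => Subtype.ext h, fun h => congrArg Subtype.val h⟩)
    (fun x => by
      refine Eq.trans (b := Γ.vtype (Γ.vert (F.onD (dart w x)))) rfl ?_
      rw [vert_onD_dart, F.vtype]
      rfl)
    (fun x y => by
      by_cases hx : (K w).1.edge x ∈ (K w).1.internal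
      · have hx' := sub_edge_of_mem hsub (compLabeling hne) (hmem x) ((hin x).2 hx)
        by_cases hy : (K w).1.edge y ∈ (K w).1.internal
        · have hy' := sub_edge_of_mem hsub (compLabeling hne) (hmem y) ((hin y).2 hy)
          refine Iff.trans ?_ (iff_of_eq (congrArg₂ _ hx' hy')).symm
          have h1 : (K w).1.edge x = (K w).1.edge y ↔
              Γ.edge (F.onD (dart w x)) = Γ.edge (F.onD (dart w y)) := by
            rw [F.edge, F.edge, F.onE.apply_eq_iff_eq, edge_dart_internal w x hx,
              edge_dart_internal w y hy, inner_inj, Subtype.mk.injEq]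
          rw [h1]
          exact ⟨fun h => congrArg Sum.inl (Subtype.ext h),
            fun h => congrArg Subtype.val (Sum.inl.inj h)⟩
        · refine ⟨fun h => (hy (h ▸ hx)).elim, fun h => ?_⟩
          have hy' := sub_edge_of_notMem hsub (compLabeling hne) (hmem y)
            fun h => hy ((hin y).1 h)
          cases hx'.symm.trans (h.trans hy')
      · obtain ⟨k, rfl⟩ := (K w).2.exists_leg hx
        have hk : (sub hsub (compLabeling hne)).edge (f ((K w).2.leg k)) =
            (sub hsub (compLabeling hne)).ext k :=
          (congrArg _ (hleg k).symm).trans (hst.edge_leg k)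
        refine Iff.trans ?_ (iff_of_eq (congrArg (· = _) hk)).symm
        rw [(K w).2.edge_leg]
        constructor
        · intro h
          rw [(K w).2.eq_leg h.symm]
          exact hk.symm
        · intro h
          have h1 : f y = f ((K w).2.leg k) := (hst.eq_leg h.symm).trans (hleg k)
          rw [hf.1 h1, (K w).2.edge_leg])
    (fun x => by
      refine (het x).trans ?_
      rw [F.edge, F.etype, etype_edge_dart])
    (fun k => ⟨(K w).2.leg k, ((K w).2.edge_leg k).symm, by
      refine Eq.symm ((congrArg _ (hleg k).symm).trans (hst.edge_leg k))⟩)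
  exact ⟨G⟩

/-- The element of the algebra given by the subgraph presented by `F`. -/
lemma ofSub_eq_prod_weight (k : Type*) [Field k] [Fintype Q.W] {γ : Γ.ProperSubgraph}
    (hγ : Carries F γ) : GraphAlgebra.ofSub k γ = ∏ w, (StableClass.mk (K w)).weight k := by
  classical
  have hmem : ∀ w : {w // (K w).1.internal.Nonempty}, compSet F w.1 ∈ γ.comps := fun w =>
    (hγ _).2 ⟨w.1, w.2, rfl⟩
  let e : {w // (K w).1.internal.Nonempty} → γ.comps := fun w => ⟨compSet F w.1, hmem w⟩
  have he : Function.Bijective e := by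
    constructor
    · rintro ⟨w, hw⟩ ⟨w', hw'⟩ h
      have h1 : compSet F w = compSet F w' := congrArg Subtype.val h
      obtain ⟨x, hx⟩ := hw
      have h2 : F.onE (inner w ⟨x, hx⟩) ∈ compSet F w' := h1 ▸ ⟨⟨x, hx⟩, rfl⟩
      obtain ⟨y, hy⟩ := h2
      obtain rfl := inner_eq (F.onE.injective hy)
      rfl
    · rintro ⟨c, hc⟩
      obtain ⟨w, hw, rfl⟩ := (hγ c).1 hc
      exact ⟨⟨w, hw⟩, rfl⟩
  unfold GraphAlgebra.ofSub
  have h1 : ∀ w : {w // (K w).1.internal.Nonempty}, (StableClass.mk (K w.1)).weight k =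
      GraphAlgebra.ofComp k (γ.isSub (e w) (e w).2) := by
    intro w
    obtain ⟨f⟩ := nonempty_iso_sub (F := F) w.2
    rw [StableClass.weight_mk_of_nonempty w.2]
    refine (GraphAlgebra.average_eq_of_iso f _ (sub_isOnePI _ _)).trans ?_
    exact (GraphAlgebra.ofComp_eq_average _ (compLabeling w.2)).symm
  rw [← finprod_eq_of_bijective e he h1, finprod_eq_prod_of_fintype,
    ← Finset.prod_filter_of_ne (p := fun w => (K w).1.internal.Nonempty)
      (fun w _ hw => not_not.1 fun h => hw (StableClass.weight_mk_of_empty h))]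
  exact (Finset.prod_subtype (p := fun w => (K w).1.internal.Nonempty)
    (Finset.univ.filter fun w => (K w).1.internal.Nonempty)
    (fun w => by simp) (fun w => (StableClass.mk (K w)).weight k)).symm

end Skeleton

/-! ### Counting presentations -/

section

variable {r : Res}

lemma FeynmanGraph.IsStable.loopNumber_eq_zero {K : FeynmanGraph r} (h : K.IsStable)
    (hi : K.internal = ∅) : K.loopNumber = 0 := by
  have : Subsingleton K.V := ⟨h.vert_unique hi⟩
  have : Nonempty K.V := ⟨K.vert (h.leg ⟨0, r.legs_length_pos⟩)⟩
  have hV : Nat.card K.V = 1 := Nat.card_eq_one_iff_unique.2 ⟨inferInstance, inferInstance⟩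
  unfold loopNumber
  rw [hi, hV]
  simp

lemma FeynmanGraph.IsStable.symFactor_eq_one {K : FeynmanGraph r} (h : K.IsStable)
    (hi : K.internal = ∅) : K.symFactor = 1 := by
  have : Subsingleton (Iso K K) := ⟨fun f g => Iso.ext_of_darts h.incident fun d => by
    obtain ⟨k, rfl⟩ := (h.legEquiv hi).surjective d
    exact (f.onD_leg h h k).trans (g.onD_leg h h k).symm⟩
  exact Nat.card_eq_one_iff_unique.2 ⟨this, ⟨.refl K⟩⟩

namespace StableClass

/-- The class of a single vertex. -/
def IsTrivial (s : StableClass r) : Prop := s.rep.1.internal = ∅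

lemma one_le_loopNumber {s : StableClass r} (h : ¬ s.IsTrivial) : 1 ≤ s.rep.1.loopNumber :=
  (s.rep.2.isOnePI (Set.nonempty_iff_ne_empty.2 h)).one_le_loopNumber

lemma coe_loops (s : StableClass r) : (s.loops : ℤ) = s.rep.1.loopNumber := by
  refine Int.toNat_of_nonneg ?_
  by_cases h : s.IsTrivial
  · exact (s.rep.2.loopNumber_eq_zero h).ge
  · exact zero_le_one.trans (one_le_loopNumber h)

lemma loops_eq_zero_iff {s : StableClass r} : s.loops = 0 ↔ s.IsTrivial := by
  rw [← Nat.cast_eq_zero (R := ℤ), coe_loops]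
  constructor
  · intro h
    by_contra hs
    have := one_le_loopNumber hs
    omega
  · exact s.rep.2.loopNumber_eq_zero

lemma IsTrivial.eq {s s' : StableClass r} (h : s.IsTrivial) (h' : s'.IsTrivial) : s = s' := by
  rw [← mk_rep s, ← mk_rep s', mk_eq_iff]
  exact exists_iso_of_internal_eq_empty s.rep.2 s'.rep.2 h h'

lemma IsTrivial.sym_eq {s : StableClass r} (h : s.IsTrivial) : s.sym = 1 :=
  s.rep.2.symFactor_eq_one h

lemma IsTrivial.weight_eq {k : Type*} [Field k] {s : StableClass r} (h : s.IsTrivial) :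
    s.weight k = 1 := dif_neg (Set.not_nonempty_iff_eq_empty.2 h)

lemma IsTrivial.isLeft {s : StableClass r} (h : s.IsTrivial) : r.isLeft := by
  rw [s.rep.2.res_eq h (s.rep.1.vert (s.rep.2.leg ⟨0, r.legs_length_pos⟩))]
  rfl

lemma exists_isTrivial (v : Vertex) : ∃ s : StableClass (.inl v), s.IsTrivial := by
  refine ⟨mk ⟨corolla v, corolla_isStable v⟩, ?_⟩
  obtain ⟨f⟩ := exists_iso_rep ⟨corolla v, corolla_isStable v⟩
  refine Set.eq_empty_of_forall_notMem fun e he => ?_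
  have h := f.mem_internal.2 he
  rw [corolla_internal] at h
  exact h

lemma sym_pos (s : StableClass r) : 0 < s.sym := symFactor_pos _

end StableClass

noncomputable instance (Q : Skeleton r) : Fintype Q.W := Fintype.ofFinite _

end

namespace FeynmanGraph.Marking

open Skeleton

variable {r : Res} {Γ₀ Γ : FeynmanGraph r} (m : Γ₀.Marking)

/-- The choice of a number of bivalent vertices on each internal edge of `Γ₀`, and of a class of
stable graphs for each vertex of the subdivided graph. There are no bivalent vertices on external
edges, since the graphs to be presented are 1PI. -/
structure Filling where
  num : Γ₀.E → ℕ
  num_ext : ∀ k, num (Γ₀.ext k) = 0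
  cls : ∀ w, StableClass ((m.subdivide num).wtype w)

namespace Filling

variable {m} (s : m.Filling)

/-- The graph obtained by substitution. -/
noncomputable def graph : FeynmanGraph r := (m.subdivide s.num).subst fun w => (s.cls w).rep

/-- The product of the substituted graphs. -/
noncomputable def weight (k : Type*) [Field k] : GraphAlgebra k := ∏ w, (s.cls w).weight k

/-- The number of automorphisms of the substituted graphs. -/
noncomputable def sym : ℕ := ∏ w, (s.cls w).sym

/-- The number of loops of the substituted graphs. -/
noncomputable def loops : ℕ := ∑ w, (s.cls w).loops

lemma sym_pos : 0 < s.sym := Finset.prod_pos fun w _ => (s.cls w).sym_pos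

lemma loopNumber_graph : s.graph.loopNumber = Γ₀.loopNumber + s.loops := by
  unfold graph loops
  rw [loopNumber_subst, m.loopNumber_subdivide s.num_ext, Nat.cast_sum]
  simp only [StableClass.coe_loops]

lemma graph_isOnePI (h₀ : Γ₀.IsOnePI) : s.graph.IsOnePI := by
  refine (subst_isStable (m.subdivide_isStable s.num_ext h₀.isStable)
    m.subdivide_incident).isOnePI ?_
  obtain ⟨e, he⟩ := h₀.exists_internal
  refine ⟨outer ⟨e, 0⟩, outer_mem_internal.2 fun h => ?_⟩
  exact (m.mem_range_subdivide_ext s.num_ext e 0).1 h he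

/-- No bivalent vertices, and a single vertex substituted for every vertex. -/
def IsTrivial : Prop := ∀ w, (s.cls w).IsTrivial

variable {s}

lemma IsTrivial.num_eq (h : s.IsTrivial) : s.num = fun _ => 0 := by
  funext e
  by_contra hne
  have h1 := (h (.inr ⟨e, ⟨0, Nat.pos_of_ne_zero hne⟩⟩)).isLeft
  cases h1

lemma IsTrivial.eq {s' : m.Filling} (h : s.IsTrivial) (h' : s'.IsTrivial) : s = s' := by
  have h1 := h.num_eq.trans h'.num_eq.symm
  obtain ⟨n, hn, c⟩ := s
  obtain ⟨n', hn', c'⟩ := s'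
  dsimp only at h1
  subst h1
  congr 1
  funext w
  exact (h w).eq (h' w)

lemma IsTrivial.weight_eq (k : Type*) [Field k] (h : s.IsTrivial) : s.weight k = 1 :=
  Finset.prod_eq_one fun w _ => (h w).weight_eq

lemma IsTrivial.sym_eq (h : s.IsTrivial) : s.sym = 1 :=
  Finset.prod_eq_one fun w _ => (h w).sym_eq

variable (m) in
lemma exists_isTrivial : ∃ s : m.Filling, s.IsTrivial := by
  have h : ∀ w : (m.subdivide fun _ => 0).W,
      ∃ s : StableClass ((m.subdivide fun _ => 0).wtype w), s.IsTrivial := by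
    rintro (v | p)
    · exact StableClass.exists_isTrivial (Γ₀.vtype v)
    · exact p.2.elim0
  choose c hc using h
  exact ⟨⟨fun _ => 0, fun _ => rfl, c⟩, hc⟩

/-- Substituting single vertices gives back the graph. -/
lemma IsTrivial.nonempty_iso (h₀ : Γ₀.IsOnePI) (h : s.IsTrivial) : Nonempty (Iso s.graph Γ₀) := by
  have hnum := h.num_eq
  obtain ⟨n, hn, c⟩ := s
  dsimp only at hnum
  subst hnum
  unfold graph
  dsimp only
  have h1 : ∀ v : Γ₀.V, ∃ b : ((c (.inl v)).rep).1.D → Γ₀.D,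
      IsPiece {v} ∅ (c (.inl v)).rep b ∧
        ∀ k, b (((c (.inl v)).rep).2.leg k) = (m.lab v k).1 := fun v =>
    exists_isPiece_of_internal_eq_empty v rfl (fun k => (m.lab v k).1)
      (fun k k' hk => (m.lab v).injective (Subtype.ext hk))
      (fun d => ⟨fun ⟨k, hk⟩ => hk ▸ (m.lab v k).2, fun hd =>
        ⟨(m.lab v).symm ⟨d, hd⟩, by rw [Equiv.apply_symm_apply]⟩⟩)
      (m.lab_type v) _ (h (.inl v))
  choose b hb hleg using h1
  let U : (m.subdivide fun _ => 0).W → Set Γ₀.V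
    | .inl v => {v}
    | .inr p => p.2.elim0
  let b' : ∀ w : (m.subdivide fun _ => 0).W, (c w).rep.1.D → Γ₀.D
    | .inl v => b v
    | .inr p => p.2.elim0
  obtain ⟨F, -⟩ := exists_iso_of_pieces h₀.incident m.subdivide_incident U (fun _ => ∅) b'
    (by
      rintro (v | p)
      · exact hb v
      · exact p.2.elim0)
    (fun v => ⟨.inl v, rfl⟩)
    (by
      rintro v (w | p) (w' | p') hw hw'
      · exact congrArg Sum.inl ((show v = w from hw).symm.trans hw')
      · exact p'.2.elim0
      · exact p.2.elim0
      · exact p.2.elim0)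
    (fun _ _ hd => hd.elim) (fun f => f.1)
    (by
      rintro ⟨e, j⟩ ⟨e', j'⟩ (rfl : e = e')
      exact congrArg (Sigma.mk e) (Subsingleton.elim (α := Fin 1) j j'))
    (by
      rintro (v | p) k
      · change Γ₀.edge (b v _) = _
        rw [hleg]
        exact (m.ends_fst (.inl (m.lab v k).1)).symm
      · exact p.2.elim0)
    (fun _ _ h => h)
    (fun k => by rw [m.subdivide_ext])
  exact ⟨F⟩

variable (m) in
/-- Every contraction is presented by exactly one filling. -/
lemma existsUnique_presents (h₀ : Γ₀.IsOnePI) (hΓ : Γ.IsOnePI) (γ : Γ.ProperSubgraph)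
    (φ : Iso (contract hΓ γ) Γ₀) :
    ∃! s : m.Filling, ∃ F : Iso s.graph Γ, m.Presents F hΓ γ φ := by
  obtain ⟨n, hn, K, F, hF⟩ := m.exists_presents h₀ hΓ γ φ
  have h1 : ∀ w, Nonempty (Iso (StableClass.mk (K w)).rep.1 (K w).1) := fun w =>
    StableClass.exists_iso_rep _
  let α := fun w => (h1 w).some
  refine ⟨⟨n, hn, fun w => .mk (K w)⟩, ⟨(substIso α).trans F, hF.congr m fun p => ?_⟩, ?_⟩
  · change F.onD ((substIso α).onD (dart p.1 _)) = _
    rw [substIso_onD, (α p.1).onD_leg _ (K p.1).2]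
    rfl
  · rintro ⟨n', hn', c⟩ ⟨F', hF'⟩
    obtain rfl : n' = n := hF'.eq_count m hn' hn hF
    congr 1
    funext w
    have h2 := hF'.legDart_unique m hn' hF
    obtain ⟨β, -⟩ := exists_substIso (F'.trans F.symm) m.subdivide_incident (fun w k => by
      change F.onD.symm (F'.onD _) = _
      exact (Equiv.symm_apply_eq _).2 (h2 ⟨w, k⟩))
    rw [← StableClass.mk_rep (c w), StableClass.mk_eq_iff]
    exact ⟨β w⟩

/-- The isomorphisms that present the same subgraph differ by automorphisms of the pieces. -/
lemma card_presents {hΓ : Γ.IsOnePI} {γ : Γ.ProperSubgraph} {φ : Iso (contract hΓ γ) Γ₀}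
    {F₀ : Iso s.graph Γ} (h : m.Presents F₀ hΓ γ φ) :
    Nat.card {F : Iso s.graph Γ // m.Presents F hΓ γ φ} = s.sym := by
  refine Eq.trans (Nat.card_congr (Equiv.subtypeEquivRight fun F => ?_))
    (card_iso_eq_on_legs m.subdivide_incident F₀)
  constructor
  · intro hF w k
    exact hF.legDart_unique m s.num_ext h ⟨w, k⟩
  · intro hF
    exact h.congr m fun p => hF p.1 p.2

variable (s) in
/-- An isomorphism from a substituted graph either comes from the trivial filling or presents
exactly one subgraph, with an identification of the contracted graph. -/
lemma card_iso (h₀ : Γ₀.IsOnePI) (hΓ : Γ.IsOnePI) (hs : ¬ s.IsTrivial)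
    [Fintype ((γ : Γ.ProperSubgraph) × Iso (contract hΓ γ) Γ₀)] :
    Nat.card (Iso s.graph Γ) = ∑ x : (γ : Γ.ProperSubgraph) × Iso (contract hΓ γ) Γ₀,
      Nat.card {F : Iso s.graph Γ // m.Presents F hΓ x.1 x.2} := by
  rw [← Nat.card_sigma]
  refine (Nat.card_congr (Equiv.ofBijective (fun y => y.2.1) ⟨?_, fun F => ?_⟩)).symm
  · rintro ⟨⟨γ, φ⟩, ⟨F, hF⟩⟩ ⟨⟨γ', φ'⟩, ⟨F', hF'⟩⟩ (rfl : F = F')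
    have h1 := hF.unique m hF'
    cases h1
    rfl
  · obtain ⟨w, hw⟩ := not_forall.1 hs
    obtain ⟨e, he⟩ := h₀.exists_internal
    obtain ⟨γ, hγ⟩ := exists_carries (F := F) ⟨w, Set.nonempty_iff_ne_empty.2 hw⟩
      ⟨⟨e, 0⟩, fun h => (m.mem_range_subdivide_ext s.num_ext e 0).1 h he⟩
    obtain ⟨φ, hφ⟩ := m.exists_presents_of_carries h₀ hΓ hγ
    exact ⟨⟨⟨γ, φ⟩, F, hφ⟩, rfl⟩

lemma not_isTrivial_of_presents {hΓ : Γ.IsOnePI} {γ : Γ.ProperSubgraph}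
    {φ : Iso (contract hΓ γ) Γ₀} {F : Iso s.graph Γ} (h : m.Presents F hΓ γ φ) :
    ¬ s.IsTrivial := by
  intro hs
  obtain ⟨c, hc⟩ := γ.nonempty
  obtain ⟨w, hw, -⟩ := (h.1 c).1 hc
  exact hw.ne_empty (hs w)

lemma loops_of_iso (F : Iso s.graph Γ) : (s.loops : ℤ) = Γ.loopNumber - Γ₀.loopNumber := by
  have h := F.loopNumber_eq
  rw [loopNumber_graph] at h
  omega

end Filling

open Classical in
/-- The double counting of the pairs of a subgraph and an identification of the contracted graph:
such pairs correspond to isomorphisms from the substituted graphs, up to automorphisms of the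
pieces. -/
lemma sum_card_iso_filling (k : Type*) [Field k] [CharZero k] (h₀ : Γ₀.IsOnePI) (hΓ : Γ.IsOnePI)
    (I : Finset m.Filling)
    (hI : ∀ s : m.Filling, s ∈ I ↔ (s.loops : ℤ) = Γ.loopNumber - Γ₀.loopNumber)
    [Fintype Γ.ProperSubgraph] :
    ∑ s ∈ I, ((s.sym : k)⁻¹ * (Nat.card (Iso s.graph Γ) : k)) • s.weight k =
      (Nat.card (Iso Γ₀ Γ) : k) • (1 : GraphAlgebra k) +
        ∑ γ : Γ.ProperSubgraph,
          (Nat.card (Iso (contract hΓ γ) Γ₀) : k) • GraphAlgebra.ofSub k γ := by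
  have : ∀ γ : Γ.ProperSubgraph, Fintype (Iso (contract hΓ γ) Γ₀) := fun γ => Fintype.ofFinite _
  choose idx hidx huniq using fun x : (γ : Γ.ProperSubgraph) × Iso (contract hΓ γ) Γ₀ =>
    Filling.existsUnique_presents m h₀ hΓ x.1 x.2
  choose F hF using hidx
  obtain ⟨s₀, hs₀⟩ := Filling.exists_isTrivial m
  have hcard : ∀ (s : m.Filling) x, Nat.card {F : Iso s.graph Γ // m.Presents F hΓ x.1 x.2} =
      if s = idx x then s.sym else 0 := by
    intro s x
    split_ifs with h
    · subst h
      exact Filling.card_presents (hF x)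
    · rw [Nat.card_eq_zero]
      exact .inl ⟨fun G => h (huniq x s ⟨G.1, G.2⟩)⟩
  have hne : ∀ x, idx x ≠ s₀ := fun x h => Filling.not_isTrivial_of_presents (hF x) (h ▸ hs₀)
  have hiso : ∀ s : m.Filling, Nat.card (Iso s.graph Γ) =
      (if s = s₀ then Nat.card (Iso Γ₀ Γ) else 0) +
        ∑ x : (γ : Γ.ProperSubgraph) × Iso (contract hΓ γ) Γ₀, if s = idx x then s.sym else 0 := by
    intro s
    by_cases h : s = s₀
    · subst h
      obtain ⟨f⟩ := hs₀.nonempty_iso h₀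
      rw [if_pos rfl, card_iso_congr_left f, Finset.sum_eq_zero, add_zero]
      exact fun x _ => if_neg (hne x).symm
    · rw [if_neg h, zero_add, s.card_iso h₀ hΓ fun hs => h (hs.eq hs₀)]
      exact Finset.sum_congr rfl fun x _ => hcard s x
  have hterm : ∀ s ∈ I, ((s.sym : k)⁻¹ * (Nat.card (Iso s.graph Γ) : k)) • s.weight k =
      (if s = s₀ then (Nat.card (Iso Γ₀ Γ) : k) • 1 else 0) +
        ∑ x : (γ : Γ.ProperSubgraph) × Iso (contract hΓ γ) Γ₀,
          if s = idx x then s.weight k else 0 := by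
    intro s _
    have hsym : (s.sym : k) ≠ 0 := Nat.cast_ne_zero.2 s.sym_pos.ne'
    rw [hiso, Nat.cast_add, mul_add, add_smul]
    congr 1
    · split_ifs with h
      · subst h
        rw [hs₀.sym_eq, hs₀.weight_eq k]
        simp
      · simp
    · rw [Nat.cast_sum, Finset.mul_sum, Finset.sum_smul]
      refine Finset.sum_congr rfl fun x _ => ?_
      split_ifs with h
      · rw [inv_mul_cancel₀ hsym, one_smul]
      · simp
  rw [Finset.sum_congr rfl hterm, Finset.sum_add_distrib]
  congr 1
  · rw [Finset.sum_ite_eq']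
    split_ifs with h
    · rfl
    · have hempty : IsEmpty (Iso Γ₀ Γ) := ⟨fun f => h ((hI s₀).2 (by
        obtain ⟨g⟩ := hs₀.nonempty_iso h₀
        exact Filling.loops_of_iso (g.trans f)))⟩
      rw [Nat.card_of_isEmpty]
      simp
  · rw [Finset.sum_comm, Fintype.sum_sigma]
    refine Finset.sum_congr rfl fun γ _ => ?_
    have hx : ∀ φ : Iso (contract hΓ γ) Γ₀, (∑ s ∈ I, if s = idx ⟨γ, φ⟩ then s.weight k else 0) =
        GraphAlgebra.ofSub k γ := by
      intro φ
      rw [Finset.sum_ite_eq', if_pos ((hI _).2 (Filling.loops_of_iso (F ⟨γ, φ⟩))),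
        ofSub_eq_prod_weight k (hF ⟨γ, φ⟩).1]
      exact Finset.prod_congr rfl fun w _ => by rw [StableClass.mk_rep]
    rw [Finset.sum_congr rfl fun φ _ => hx φ, Finset.sum_const, Finset.card_univ,
      Nat.card_eq_fintype_card, Nat.cast_smul_eq_nsmul]

end FeynmanGraph.Marking

/-! ### Generating functions -/

section

variable {A : Type*} [CommRing A]

/-- The power series `f` is the generating function of the family `a`, graded by `ℓ`: there are
finitely many indices of each degree `N`, and the coefficient of degree `N` is the sum of the
corresponding elements. -/
def IsGeneratingFunction {T : Type*} (ℓ : T → ℕ) (a : T → A) (f : PowerSeries A) : Prop :=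
  ∀ N, ∃ I : Finset T, (∀ t, t ∈ I ↔ ℓ t = N) ∧ PowerSeries.coeff N f = ∑ t ∈ I, a t

namespace IsGeneratingFunction

variable {T : Type*} {ℓ : T → ℕ} {a : T → A} {f : PowerSeries A}

lemma of_equiv {T' : Type*} {ℓ' : T' → ℕ} {a' : T' → A} (e : T' ≃ T)
    (h : IsGeneratingFunction ℓ a f) (hℓ : ∀ t, ℓ (e t) = ℓ' t) (ha : ∀ t, a (e t) = a' t) :
    IsGeneratingFunction ℓ' a' f := by
  intro N
  obtain ⟨I, hI, hN⟩ := h N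
  refine ⟨I.map e.symm.toEmbedding, fun t => ?_, ?_⟩
  · rw [Finset.mem_map_equiv, Equiv.symm_symm, hI, hℓ]
  · rw [hN, Finset.sum_map]
    refine Finset.sum_congr rfl fun t _ => ?_
    rw [← ha]
    exact congrArg a (e.apply_symm_apply t).symm

lemma of_unique [Unique T] (hℓ : ℓ default = 0) (ha : a default = 1) :
    IsGeneratingFunction ℓ a 1 := by
  intro N
  rw [PowerSeries.coeff_one]
  by_cases hN : N = 0
  · refine ⟨{default}, fun t => ?_, ?_⟩
    · rw [Unique.eq_default t, hℓ, Finset.mem_singleton, hN]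
      exact ⟨fun _ => rfl, fun _ => rfl⟩
    · rw [if_pos hN, Finset.sum_singleton, ha]
  · refine ⟨∅, fun t => ?_, ?_⟩
    · rw [Unique.eq_default t, hℓ]
      exact ⟨fun h => (Finset.notMem_empty _ h).elim, fun h => (hN h.symm).elim⟩
    · rw [if_neg hN, Finset.sum_empty]

lemma pi {ι : Type*} [Fintype ι] {T : ι → Type*} {ℓ : ∀ i, T i → ℕ} {a : ∀ i, T i → A}
    {f : ι → PowerSeries A} (h : ∀ i, IsGeneratingFunction (ℓ i) (a i) (f i)) :
    IsGeneratingFunction (T := ∀ i, T i) (fun c => ∑ i, ℓ i (c i)) (fun c => ∏ i, a i (c i))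
      (∏ i, f i) := by
  classical
  choose I hI hf using h
  intro N
  refine ⟨(Finset.finsuppAntidiag Finset.univ N).biUnion
    fun l => Fintype.piFinset fun i => I i (l i), fun c => ?_, ?_⟩
  · simp only [Finset.mem_biUnion, Finset.mem_finsuppAntidiag, Fintype.mem_piFinset, hI]
    constructor
    · rintro ⟨l, ⟨hl, -⟩, hc⟩
      rw [← hl]
      exact Finset.sum_congr rfl fun i _ => hc i
    · intro hc
      exact ⟨Finsupp.equivFunOnFinite.symm fun i => ℓ i (c i), ⟨hc, Finset.subset_univ _⟩,
        fun i => rfl⟩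
  · rw [PowerSeries.coeff_prod, Finset.sum_biUnion]
    · refine Finset.sum_congr rfl fun l _ => ?_
      rw [← Finset.prod_univ_sum]
      exact Finset.prod_congr rfl fun i _ => hf i _
    · intro l _ l' _ hne
      refine Finset.disjoint_left.2 fun c hc hc' => hne ?_
      rw [Fintype.mem_piFinset] at hc hc'
      ext i
      exact ((hI _ _ _).1 (hc i)).symm.trans ((hI _ _ _).1 (hc' i))

lemma prod {T' : Type*} {ℓ' : T' → ℕ} {a' : T' → A} {f' : PowerSeries A}
    (h : IsGeneratingFunction ℓ a f) (h' : IsGeneratingFunction ℓ' a' f') :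
    IsGeneratingFunction (T := T × T') (fun c => ℓ c.1 + ℓ' c.2) (fun c => a c.1 * a' c.2)
      (f * f') := by
  classical
  choose I hI hf using h
  choose I' hI' hf' using h'
  intro N
  refine ⟨(Finset.HasAntidiagonal.antidiagonal N).biUnion fun l => I l.1 ×ˢ I' l.2, fun c => ?_, ?_⟩
  · simp only [Finset.mem_biUnion, Finset.HasAntidiagonal.mem_antidiagonal, Finset.mem_product, hI, hI']
    constructor
    · rintro ⟨l, hl, hc, hc'⟩
      rw [hc, hc', hl]
    · intro hc
      exact ⟨(ℓ c.1, ℓ' c.2), hc, rfl, rfl⟩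
  · rw [PowerSeries.coeff_mul, Finset.sum_biUnion]
    · refine Finset.sum_congr rfl fun l _ => ?_
      rw [hf, hf', Finset.sum_mul_sum, Finset.sum_product]
    · intro l _ l' _ hne
      refine Finset.disjoint_left.2 fun c hc hc' => hne ?_
      rw [Finset.mem_product, hI, hI'] at hc hc'
      exact Prod.ext (hc.1.symm.trans hc'.1) (hc.2.symm.trans hc'.2)

/-- Sequences of elements of positive degree are counted by the geometric series. -/
lemma geometric (h : IsGeneratingFunction ℓ a f) (hℓ : ∀ t, 1 ≤ ℓ t) {u : PowerSeries A}
    (hu : (1 - f) * u = 1) :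
    IsGeneratingFunction (T := (n : ℕ) × (Fin n → T)) (fun c => ∑ i, ℓ (c.2 i))
      (fun c => ∏ i, a (c.2 i)) u := by
  classical
  have hX : PowerSeries.X ∣ f := by
    rw [PowerSeries.X_dvd_iff, ← PowerSeries.coeff_zero_eq_constantCoeff_apply]
    obtain ⟨I, hI, h0⟩ := h 0
    rw [h0]
    refine Finset.sum_eq_zero fun t ht => ?_
    have h1 := (hI t).1 ht
    have h2 := hℓ t
    omega
  have hpow : ∀ j : ℕ, IsGeneratingFunction (T := Fin j → T) (fun c => ∑ i, ℓ (c i))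
      (fun c => ∏ i, a (c i)) (f ^ j) := fun j => by
    have := pi (ι := Fin j) (fun _ => h)
    rwa [Finset.prod_const, Finset.card_univ, Fintype.card_fin] at this
  choose I hI hf using hpow
  intro N
  refine ⟨(Finset.range (N + 1)).sigma fun j => I j N, fun c => ?_, ?_⟩
  · rw [Finset.mem_sigma, hI, and_iff_right_of_imp]
    intro hc
    have h1 : ∑ _i : Fin c.1, 1 ≤ ∑ i, ℓ (c.2 i) := Finset.sum_le_sum fun i _ => hℓ _
    rw [show ∑ i, ℓ (c.2 i) = N from hc] at h1
    simp only [Finset.sum_const, Finset.card_univ, Fintype.card_fin, smul_eq_mul, mul_one] at h1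
    exact Finset.mem_range.2 (by omega)
  · have h1 : u = ∑ j ∈ Finset.range (N + 1), f ^ j + f ^ (N + 1) * u := by
      have h2 := mul_neg_geom_sum f (N + 1)
      calc u = ((1 - f) * ∑ j ∈ Finset.range (N + 1), f ^ j) * u + f ^ (N + 1) * u := by
            rw [h2]; ring
        _ = ((1 - f) * u) * ∑ j ∈ Finset.range (N + 1), f ^ j + f ^ (N + 1) * u := by ring
        _ = _ := by rw [hu, one_mul]
    have h3 : PowerSeries.coeff N (f ^ (N + 1) * u) = 0 :=
      PowerSeries.X_pow_dvd_iff.1 (Dvd.dvd.mul_right (pow_dvd_pow_of_dvd hX (N + 1)) u) N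
        (Nat.lt_succ_self N)
    rw [h1, map_add, h3, add_zero, map_sum, Finset.sum_sigma]
    exact Finset.sum_congr rfl fun j _ => hf j N

end IsGeneratingFunction

end

/-! ### Green's functions as generating functions of stable graphs -/

namespace OnePIClass

variable {r : Res}

lemma mk_out (g : OnePIClass r) : mk g.out.1 g.out.2 = g := Quotient.out_eq g

lemma mk_eq_iff {Γ Γ' : FeynmanGraph r} {h : Γ.IsOnePI} {h' : Γ'.IsOnePI} :
    mk Γ h = mk Γ' h' ↔ Nonempty (Iso Γ Γ') :=
  ⟨fun h => Quotient.exact h, fun h => Quotient.sound h⟩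

lemma exists_iso_out (Γ : FeynmanGraph r) (h : Γ.IsOnePI) : Nonempty (Iso (mk Γ h).out.1 Γ) :=
  mk_eq_iff.1 (mk_out (mk Γ h))

lemma symFactor_out (g : OnePIClass r) : g.out.1.symFactor = g.symFactor := by
  conv_rhs => rw [← mk_out g]
  rfl

lemma loopNumber_out (g : OnePIClass r) : g.out.1.loopNumber = g.loopNumber := by
  conv_rhs => rw [← mk_out g]
  rfl

/-- The class with relabelled external lines. -/
noncomputable def relabel (π : LegPerm r) (g : OnePIClass r) : OnePIClass r :=
  mk (FeynmanGraph.relabel π g.out.1) (relabel_isOnePI π g.out.2)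

lemma relabel_symFactor (π : LegPerm r) (g : OnePIClass r) :
    (g.relabel π).symFactor = g.symFactor :=
  (FeynmanGraph.relabel_symFactor π (Γ := g.out.1)).trans g.symFactor_out

lemma relabel_loopNumber (π : LegPerm r) (g : OnePIClass r) :
    (g.relabel π).loopNumber = g.loopNumber :=
  (FeynmanGraph.relabel_loopNumber π (Γ := g.out.1)).trans g.loopNumber_out

lemma relabel_relabel {π π' : LegPerm r} (h : ∀ k, π.1 (π'.1 k) = k) (g : OnePIClass r) :
    (g.relabel π).relabel π' = g := by
  rw [← mk_out g]
  refine mk_eq_iff.2 ?_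
  obtain ⟨f⟩ := exists_iso_out _ (relabel_isOnePI π (mk g.out.1 g.out.2).out.2)
  obtain ⟨f'⟩ := exists_iso_out _ g.out.2
  obtain ⟨f''⟩ := nonempty_iso_relabel_relabel h (Γ := (mk g.out.1 g.out.2).out.1)
  exact ⟨(f.relabel π').trans (f''.trans f')⟩

end OnePIClass

namespace GraphAlgebra

variable (k : Type*) [Field k]

/-- Averaging over the labellings does not change the sum over all graphs. -/
lemma sum_average [CharZero k] (r : Res) (L : ℕ) :
    ∑ g ∈ (OnePIClass.finite_loopNumber r L).toFinset,
      (g.symFactor : k)⁻¹ • average k g.out.2 = graphSum k r L := by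
  have h1 : ∀ π : LegPerm r, ∑ g ∈ (OnePIClass.finite_loopNumber r L).toFinset,
      (g.symFactor : k)⁻¹ • (MvPolynomial.X ⟨r, g.relabel π⟩ : GraphAlgebra k) =
        graphSum k r L := by
    intro π
    let π' : LegPerm r := ⟨π.1.symm, fun j => by
      have := π.2 (π.1.symm j)
      rw [Equiv.apply_symm_apply] at this
      exact this.symm⟩
    refine Finset.sum_bij' (fun g _ => g.relabel π) (fun g _ => g.relabel π') ?_ ?_ ?_ ?_ ?_
    · intro g hg
      rw [Set.Finite.mem_toFinset] at hg ⊢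
      exact (g.relabel_loopNumber π).trans hg
    · intro g hg
      rw [Set.Finite.mem_toFinset] at hg ⊢
      exact (g.relabel_loopNumber π').trans hg
    · exact fun g _ => g.relabel_relabel fun j => π.1.apply_symm_apply j
    · exact fun g _ => g.relabel_relabel fun j => π.1.symm_apply_apply j
    · intro g _
      rw [OnePIClass.relabel_symFactor]
  have hcard : (Nat.card (LegPerm r) : k) ≠ 0 := Nat.cast_ne_zero.2 Nat.card_pos.ne'
  calc _ = ∑ g ∈ (OnePIClass.finite_loopNumber r L).toFinset, ∑ π : LegPerm r,
        (Nat.card (LegPerm r) : k)⁻¹ •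
          ((g.symFactor : k)⁻¹ • (MvPolynomial.X ⟨r, g.relabel π⟩ : GraphAlgebra k)) := by
        refine Finset.sum_congr rfl fun g _ => ?_
        unfold average
        rw [smul_comm, Finset.smul_sum, Finset.smul_sum]
        rfl
    _ = ∑ _π : LegPerm r, (Nat.card (LegPerm r) : k)⁻¹ • graphSum k r L := by
        rw [Finset.sum_comm]
        refine Finset.sum_congr rfl fun π _ => ?_
        rw [← Finset.smul_sum, h1]
    _ = _ := by
        rw [Finset.sum_const, Finset.card_univ, ← Nat.card_eq_fintype_card, ← Nat.cast_smul_eq_nsmul k,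
          smul_smul, mul_inv_cancel₀ hcard, one_smul]

lemma graphSum_zero (r : Res) : graphSum k r 0 = 0 := by
  refine Finset.sum_eq_zero fun g hg => ?_
  rw [Set.Finite.mem_toFinset] at hg
  have h1 := g.out.2.one_le_loopNumber
  rw [g.loopNumber_out, show g.loopNumber = ((0 : ℕ) : ℤ) from hg] at h1
  exact absurd h1 (by norm_num)

/-- Stable classes with at least one loop are the 1PI classes. -/
lemma exists_sum_stableClass [CharZero k] (r : Res) {L : ℕ} (hL : L ≠ 0) :
    ∃ I : Finset (StableClass r), (∀ s, s ∈ I ↔ s.loops = L) ∧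
      graphSum k r L = ∑ s ∈ I, (s.sym : k)⁻¹ • s.weight k := by
  classical
  let f : OnePIClass r → StableClass r := fun g => .mk ⟨g.out.1, g.out.2.isStable⟩
  have hf : ∀ g, Nonempty (Iso (f g).rep.1 g.out.1) := fun g => StableClass.exists_iso_rep _
  have hloops : ∀ g, ((f g).loops : ℤ) = g.loopNumber := fun g => by
    obtain ⟨φ⟩ := hf g
    rw [StableClass.coe_loops, φ.loopNumber_eq, g.loopNumber_out]
  refine ⟨(OnePIClass.finite_loopNumber r L).toFinset.image f, fun s => ?_, ?_⟩
  · rw [Finset.mem_image]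
    constructor
    · rintro ⟨g, hg, rfl⟩
      rw [Set.Finite.mem_toFinset] at hg
      exact Nat.cast_injective ((hloops g).trans hg)
    · intro hs
      have hne : ¬ s.IsTrivial := fun h => hL (hs.symm.trans (StableClass.loops_eq_zero_iff.2 h))
      have h1 := s.rep.2.isOnePI (Set.nonempty_iff_ne_empty.2 hne)
      have h2 : f (.mk s.rep.1 h1) = s := by
        obtain ⟨φ⟩ := OnePIClass.exists_iso_out _ h1
        exact (StableClass.mk_eq_iff.2 ⟨φ⟩).trans s.mk_rep
      refine ⟨_, ?_, h2⟩
      rw [Set.Finite.mem_toFinset]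
      refine ((hloops _).symm.trans ?_)
      rw [h2, hs]
  · rw [Finset.sum_image, ← sum_average]
    · refine Finset.sum_congr rfl fun g _ => ?_
      obtain ⟨φ⟩ := hf g
      have h1 : (f g).sym = g.symFactor := by
        rw [← g.symFactor_out]
        exact (card_iso_congr_left φ).trans (card_iso_congr_right φ)
      rw [h1]
      congr 1
      exact (StableClass.weight_mk_of_nonempty (K := ⟨g.out.1, g.out.2.isStable⟩)
        g.out.2.exists_internal).symm
    · intro g _ g' _ h
      obtain ⟨φ⟩ := StableClass.mk_eq_iff.1 h
      rw [← g.mk_out, ← g'.mk_out]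
      exact OnePIClass.mk_eq_iff.2 ⟨φ⟩

/-- The Green's function of a vertex counts the 1PI graphs and, with `1`, the single vertex. -/
lemma isGeneratingFunction_vertex [CharZero k] (v : Vertex) :
    IsGeneratingFunction (fun s : StableClass (.inl v) => s.loops)
      (fun s => (s.sym : k)⁻¹ • s.weight k) (green k (.inl v)) := by
  intro L
  by_cases hL : L = 0
  · subst hL
    obtain ⟨s₀, hs₀⟩ := StableClass.exists_isTrivial v
    refine ⟨{s₀}, fun s => ?_, ?_⟩
    · rw [Finset.mem_singleton, StableClass.loops_eq_zero_iff]
      exact ⟨fun h => h ▸ hs₀, fun h => h.eq hs₀⟩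
    · rw [Finset.sum_singleton, hs₀.sym_eq, hs₀.weight_eq]
      simp [green, graphSum_zero]
  · obtain ⟨I, hI, h⟩ := exists_sum_stableClass k (.inl v) hL
    refine ⟨I, hI, ?_⟩
    rw [← h]
    simp [green, PowerSeries.coeff_one, hL]

/-- The self-energy counts the stable graphs whose residue is a line; all of them have a loop. -/
lemma isGeneratingFunction_line [CharZero k] (e : Line) :
    IsGeneratingFunction (fun s : StableClass (.inr e) => s.loops)
      (fun s => (s.sym : k)⁻¹ • s.weight k) (1 - green k (.inr e)) := by
  intro L
  by_cases hL : L = 0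
  · subst hL
    refine ⟨∅, fun s => ⟨fun h => (Finset.notMem_empty _ h).elim, fun h => ?_⟩, ?_⟩
    · have := (StableClass.loops_eq_zero_iff.1 h).isLeft
      cases this
    · rw [Finset.sum_empty]
      simp [green, graphSum_zero]
  · obtain ⟨I, hI, h⟩ := exists_sum_stableClass k (.inr e) hL
    refine ⟨I, hI, ?_⟩
    rw [← h]
    simp [green]

/-- The propagator: the inverse of the Green's function of a line. -/
noncomputable def propagator (e : Line) : PowerSeries (GraphAlgebra k) :=
  PowerSeries.invOfUnit (green k (.inr e)) 1

lemma constantCoeff_green (r : Res) : PowerSeries.constantCoeff (green k r) = 1 := by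
  rcases r with v | e
  · rw [← PowerSeries.coeff_zero_eq_constantCoeff_apply]
    simp [green, graphSum_zero, -PowerSeries.coeff_zero_eq_constantCoeff]
  · rw [← PowerSeries.coeff_zero_eq_constantCoeff_apply]
    simp [green, graphSum_zero, -PowerSeries.coeff_zero_eq_constantCoeff]

lemma green_mul_propagator (e : Line) : green k (.inr e) * propagator k e = 1 :=
  PowerSeries.mul_invOfUnit _ _ (constantCoeff_green k _)

end GraphAlgebra

namespace FeynmanGraph

variable {r : Res} {Γ₀ : FeynmanGraph r} (m : Γ₀.Marking)

/-- Chains of self-energy insertions in an edge; there are none in an external edge. -/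
abbrev Chain (e : Γ₀.E) :=
  {x : (n : ℕ) × (Fin n → StableClass (.inr (Γ₀.etype e))) // e ∉ Γ₀.internal → x.1 = 0}

/-- A filling consists of independent choices at the vertices and the edges. -/
noncomputable def Marking.fillingEquiv : m.Filling ≃
    (∀ v : Γ₀.V, StableClass (.inl (Γ₀.vtype v))) × (∀ e, Γ₀.Chain e) where
  toFun s := (fun v => s.cls (.inl v), fun e => ⟨⟨s.num e, fun i => s.cls (.inr ⟨e, i⟩)⟩, fun h => by
    obtain ⟨k, rfl⟩ := not_not.1 h
    exact s.num_ext k⟩)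
  invFun x := ⟨fun e => (x.2 e).1.1, fun k => (x.2 _).2 fun h => h ⟨k, rfl⟩, fun
    | .inl v => x.1 v
    | .inr p => (x.2 p.1).1.2 p.2⟩
  left_inv s := by
    obtain ⟨n, hn, c⟩ := s
    refine congrArg (Marking.Filling.mk n hn) (funext fun w => ?_)
    rcases w with v | p <;> rfl
  right_inv x := rfl

variable (k : Type*) [Field k]

/-- The product of the Green's functions of the vertices and the propagators of the internal edges
of a graph. -/
noncomputable def dressing (Γ₀ : FeynmanGraph r) [Fintype Γ₀.V] [Fintype Γ₀.internal] :
    PowerSeries (GraphAlgebra k) :=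
  (∏ v, GraphAlgebra.green k (.inl (Γ₀.vtype v))) *
    ∏ e : Γ₀.internal, GraphAlgebra.propagator k (Γ₀.etype e)

open Classical in
/-- Chains of self-energy graphs are counted by the geometric series, which is the propagator. -/
lemma isGeneratingFunction_chain [CharZero k] (e : Γ₀.E) :
    IsGeneratingFunction (fun x : Γ₀.Chain e => ∑ i, (x.1.2 i).loops)
      (fun x => ∏ i, (((x.1.2 i).sym : k)⁻¹ • (x.1.2 i).weight k))
      (if e ∈ Γ₀.internal then GraphAlgebra.propagator k (Γ₀.etype e) else 1) := by
  split_ifs with he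
  · have h := (GraphAlgebra.isGeneratingFunction_line k (Γ₀.etype e)).geometric (fun s => ?_)
      (u := GraphAlgebra.propagator k (Γ₀.etype e)) ?_
    · exact h.of_equiv (Equiv.subtypeUnivEquiv fun x hx => (hx he).elim) (fun _ => rfl)
        (fun _ => rfl)
    · refine Nat.one_le_iff_ne_zero.2 fun h => ?_
      have := (StableClass.loops_eq_zero_iff.1 h).isLeft
      cases this
    · rw [sub_sub_cancel]
      exact GraphAlgebra.green_mul_propagator k _
  · let _ : Unique (Γ₀.Chain e) := ⟨⟨⟨⟨0, Fin.elim0⟩, fun _ => rfl⟩⟩, fun ⟨⟨n, c⟩, hx⟩ => by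
      obtain rfl : n = 0 := hx he
      exact Subtype.ext (Sigma.ext rfl (heq_of_eq (funext fun i => i.elim0)))⟩
    exact .of_unique rfl rfl

/-- The fillings of a graph are counted by its dressing. -/
lemma isGeneratingFunction_filling [CharZero k] [Fintype Γ₀.V] [Fintype Γ₀.internal] :
    IsGeneratingFunction (fun s : m.Filling => s.loops)
      (fun s => (s.sym : k)⁻¹ • s.weight k) (Γ₀.dressing k) := by
  classical
  have := Fintype.ofFinite Γ₀.E
  have h1 := IsGeneratingFunction.pi fun v : Γ₀.V =>
    GraphAlgebra.isGeneratingFunction_vertex k (Γ₀.vtype v)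
  have h2 := IsGeneratingFunction.pi fun e : Γ₀.E => isGeneratingFunction_chain k e
  have h3 : ∏ e : Γ₀.E, (if e ∈ Γ₀.internal then GraphAlgebra.propagator k (Γ₀.etype e) else 1) =
      ∏ e : Γ₀.internal, GraphAlgebra.propagator k (Γ₀.etype e) := by
    rw [← Finset.prod_filter]
    refine Finset.prod_subtype _ (fun e => ?_) _
    simp
  rw [h3] at h2
  refine (h1.prod h2).of_equiv m.fillingEquiv (fun s => ?_) (fun s => ?_)
  · have h4 : s.loops = ∑ w : Γ₀.V ⊕ ((e : Γ₀.E) × Fin (s.num e)), (s.cls w).loops :=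
      
      congrArg (fun i : Fintype (Γ₀.V ⊕ ((e : Γ₀.E) × Fin (s.num e))) =>
        @Finset.sum _ _ _ (@Finset.univ _ i) fun w => (s.cls w).loops)
        (@Subsingleton.elim _ _ _ (instFintypeSum _ _))
    rw [h4, Fintype.sum_sum_type, Fintype.sum_sigma]
    rfl
  · have h4 : (s.sym : k)⁻¹ • s.weight k = ∏ w : Γ₀.V ⊕ ((e : Γ₀.E) × Fin (s.num e)),
        (((s.cls w).sym : k)⁻¹ • (s.cls w).weight k) := by
      unfold Marking.Filling.sym Marking.Filling.weight
      rw [Nat.cast_prod, ← Finset.prod_inv_distrib, ← Finset.prod_smul]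
      exact congrArg (fun i : Fintype (Γ₀.V ⊕ ((e : Γ₀.E) × Fin (s.num e))) =>
        @Finset.prod _ _ _ (@Finset.univ _ i) fun w =>
          (((s.cls w).sym : k)⁻¹ • (s.cls w).weight k))
        (@Subsingleton.elim _ _ _ (instFintypeSum _ _))
    rw [h4, Fintype.prod_sum_type, Fintype.prod_sigma]
    rfl

end FeynmanGraph

/-! ### The coproduct of the sum over all graphs -/

section

variable {r : Res}

lemma OnePIClass.card_iso_out {Γ : FeynmanGraph r} (hΓ : Γ.IsOnePI) (h : OnePIClass r)
    [Decidable (h = mk Γ hΓ)] :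
    Nat.card (Iso Γ h.out.1) = if h = mk Γ hΓ then h.symFactor else 0 := by
  split_ifs with hh
  · obtain ⟨f⟩ := exists_iso_out Γ hΓ
    rw [← hh] at f
    rw [← h.symFactor_out]
    exact (card_iso_congr_left f).symm
  · rw [Nat.card_eq_zero]
    exact .inl ⟨fun f => hh ((mk_out h).symm.trans (mk_eq_iff.2 ⟨f.symm⟩))⟩

lemma card_iso_comm {Γ Γ' : FeynmanGraph r} : Nat.card (Iso Γ Γ') = Nat.card (Iso Γ' Γ) :=
  Nat.card_congr ⟨Iso.symm, Iso.symm, fun _ => rfl, fun _ => rfl⟩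

lemma OnePIClass.symFactor_pos (h : OnePIClass r) : 0 < h.symFactor := by
  rw [← h.symFactor_out]
  exact FeynmanGraph.symFactor_pos _

/-- The 1PI graphs with at most `L` loops. -/
noncomputable def OnePIClass.upTo (r : Res) (L : ℕ) : Finset (OnePIClass r) := by
  classical
  exact (Finset.range (L + 1)).biUnion fun l => (finite_loopNumber r l).toFinset

lemma OnePIClass.mem_upTo {L : ℕ} {h : OnePIClass r} : h ∈ upTo r L ↔ h.loopNumber ≤ L := by
  classical
  unfold upTo
  rw [Finset.mem_biUnion]
  constructor
  · rintro ⟨l, hl, hh⟩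
    rw [Set.Finite.mem_toFinset] at hh
    rw [show h.loopNumber = l from hh]
    exact_mod_cast Nat.lt_succ_iff.1 (Finset.mem_range.1 hl)
  · intro hh
    have h1 := h.out.2.one_le_loopNumber
    rw [h.loopNumber_out] at h1
    refine ⟨h.loopNumber.toNat, Finset.mem_range.2 (by omega), ?_⟩
    rw [Set.Finite.mem_toFinset]
    exact (Int.toNat_of_nonneg (by omega)).symm

lemma OnePIClass.sum_upTo {M : Type*} [AddCommMonoid M] (L : ℕ) (f : OnePIClass r → M) :
    ∑ h ∈ upTo r L, f h =
      ∑ l ∈ Finset.range (L + 1), ∑ h ∈ (finite_loopNumber r l).toFinset, f h := by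
  classical
  unfold upTo
  refine Finset.sum_biUnion fun l _ l' _ hne => Finset.disjoint_left.2 fun h hh hh' => hne ?_
  rw [Set.Finite.mem_toFinset] at hh hh'
  exact Nat.cast_injective (R := ℤ) (hh.symm.trans hh')

lemma FeynmanGraph.loopNumber_contract_le {Γ : FeynmanGraph r} (hΓ : Γ.IsOnePI)
    (γ : Γ.ProperSubgraph) : (contract hΓ γ).loopNumber ≤ Γ.loopNumber := by
  have h₀ := contract_isOnePI hΓ γ
  obtain ⟨m⟩ := exists_marking h₀.isStable
  obtain ⟨s, ⟨F, -⟩, -⟩ := Marking.Filling.existsUnique_presents m h₀ hΓ γ (.refl _)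
  have := Marking.Filling.loops_of_iso F
  omega

end

namespace GraphAlgebra

variable {k : Type*} [Field k] [CharZero k] {r : Res}

open Classical in
/-- A graph as a sum over all graphs, weighted by the number of isomorphisms. -/
lemma of_eq_sum_card_iso {Γ : FeynmanGraph r} (hΓ : Γ.IsOnePI) {L : ℕ} (hL : Γ.loopNumber ≤ L) :
    of k Γ hΓ = ∑ h ∈ OnePIClass.upTo r L, (h.symFactor : k)⁻¹ •
      ((Nat.card (Iso Γ h.out.1) : k) • (MvPolynomial.X ⟨r, h⟩ : GraphAlgebra k)) := by
  rw [Finset.sum_eq_single (OnePIClass.mk Γ hΓ)]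
  · have h1 : ((OnePIClass.mk Γ hΓ).symFactor : k) ≠ 0 :=
      Nat.cast_ne_zero.2 (OnePIClass.symFactor_pos _).ne'
    rw [OnePIClass.card_iso_out hΓ, if_pos rfl, smul_smul, inv_mul_cancel₀ h1, one_smul]
    rfl
  · intro h _ hne
    rw [OnePIClass.card_iso_out hΓ, if_neg hne, Nat.cast_zero, zero_smul, smul_zero]
  · intro h
    exact (h (OnePIClass.mem_upTo.2 hL)).elim

open Classical in
lemma sum_card_iso_out {Γ : FeynmanGraph r} (hΓ : Γ.IsOnePI) {L : ℕ} (hL : Γ.loopNumber = L) :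
    ∑ g ∈ (OnePIClass.finite_loopNumber r L).toFinset,
      (g.symFactor : k)⁻¹ * (Nat.card (Iso Γ g.out.1) : k) = 1 := by
  rw [Finset.sum_eq_single (OnePIClass.mk Γ hΓ)]
  · rw [OnePIClass.card_iso_out hΓ, if_pos rfl]
    exact inv_mul_cancel₀ (Nat.cast_ne_zero.2 (OnePIClass.symFactor_pos _).ne')
  · intro h _ hne
    rw [OnePIClass.card_iso_out hΓ, if_neg hne, Nat.cast_zero, mul_zero]
  · intro h
    refine (h ?_).elim
    rw [Set.Finite.mem_toFinset]
    exact hL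

noncomputable instance (Γ : FeynmanGraph r) : Fintype Γ.V := Fintype.ofFinite _

noncomputable instance (Γ : FeynmanGraph r) : Fintype Γ.internal := Fintype.ofFinite _

variable (k) in
/-- The coproduct of the sum over all graphs with `L` loops: every graph `h` appears on the right,
and on the left the ways of inserting graphs in its vertices and internal edges. -/
theorem coproduct_graphSum (r : Res) (L : ℕ) :
    coproduct k (graphSum k r L) = graphSum k r L ⊗ₜ[k] 1 +
      ∑ l ∈ Finset.range (L + 1), ∑ h ∈ (OnePIClass.finite_loopNumber r l).toFinset,
        (h.symFactor : k)⁻¹ • (PowerSeries.coeff (L - l) (h.out.1.dressing k) ⊗ₜ[k]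
          (MvPolynomial.X ⟨r, h⟩ : GraphAlgebra k)) := by
  classical
  have hm : ∀ h : OnePIClass r, ∃ (m : h.out.1.Marking) (I : Finset m.Filling),
      (∀ s : m.Filling, s ∈ I ↔ s.loops = L - h.loopNumber.toNat) ∧
        PowerSeries.coeff (L - h.loopNumber.toNat) (h.out.1.dressing k) =
          ∑ s ∈ I, (s.sym : k)⁻¹ • s.weight k := fun h => by
    obtain ⟨m⟩ := exists_marking h.out.2.isStable
    obtain ⟨I, hI, hN⟩ := isGeneratingFunction_filling m k (L - h.loopNumber.toNat)
    exact ⟨m, I, hI, hN⟩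
  choose m I hI hN using hm
  have hpos : ∀ h : OnePIClass r, 0 ≤ h.loopNumber := fun h => by
    have h1 := h.out.2.one_le_loopNumber
    rw [h.loopNumber_out] at h1
    omega
  -- the coproduct of a single graph, expanded over all graphs `h` on the right
  have hgen : ∀ g ∈ (OnePIClass.finite_loopNumber r L).toFinset,
      coproduct k (MvPolynomial.X ⟨r, g⟩) = (MvPolynomial.X ⟨r, g⟩ : GraphAlgebra k) ⊗ₜ[k] 1 +
        ∑ h ∈ OnePIClass.upTo r L, (h.symFactor : k)⁻¹ • ((∑ s ∈ I h,
          ((s.sym : k)⁻¹ * (Nat.card (Iso s.graph g.out.1) : k)) • s.weight k) ⊗ₜ[k]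
            (MvPolynomial.X ⟨r, h⟩ : GraphAlgebra k)) := by
    intro g hg
    rw [Set.Finite.mem_toFinset] at hg
    have hgL : g.out.1.loopNumber = L := g.loopNumber_out.trans hg
    have := Fintype.ofFinite g.out.1.ProperSubgraph
    have h1 : (MvPolynomial.X ⟨r, g⟩ : GraphAlgebra k) = of k g.out.1 g.out.2 := by
      unfold of
      rw [OnePIClass.mk_out]
    have h2 : coproduct k (MvPolynomial.X ⟨r, g⟩) =
        (MvPolynomial.X ⟨r, g⟩ : GraphAlgebra k) ⊗ₜ[k] 1 + (1 ⊗ₜ[k] of k g.out.1 g.out.2 +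
          ∑ γ : g.out.1.ProperSubgraph, ofSub k γ ⊗ₜ[k] ofContract k g.out.2 γ) := by
      rw [← h1, ← add_assoc, ← finsum_eq_sum_of_fintype]
      exact MvPolynomial.aeval_X _ _
    rw [h2]
    congr 1
    rw [of_eq_sum_card_iso g.out.2 hgL.le, TensorProduct.tmul_sum]
    have h3 : ∀ γ : g.out.1.ProperSubgraph, ofSub k γ ⊗ₜ[k] ofContract k g.out.2 γ =
        ∑ h ∈ OnePIClass.upTo r L, (h.symFactor : k)⁻¹ •
          (((Nat.card (Iso (contract g.out.2 γ) h.out.1) : k) • ofSub k γ) ⊗ₜ[k]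
            (MvPolynomial.X ⟨r, h⟩ : GraphAlgebra k)) := by
      intro γ
      unfold ofContract
      rw [of_eq_sum_card_iso _ ((loopNumber_contract_le g.out.2 γ).trans hgL.le),
        TensorProduct.tmul_sum]
      refine Finset.sum_congr rfl fun h _ => ?_
      rw [TensorProduct.tmul_smul, TensorProduct.tmul_smul, TensorProduct.smul_tmul']
    rw [Finset.sum_congr rfl fun γ _ => h3 γ, Finset.sum_comm, ← Finset.sum_add_distrib]
    refine Finset.sum_congr rfl fun h hh => ?_
    rw [← Finset.smul_sum, ← TensorProduct.sum_tmul, TensorProduct.tmul_smul,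
      TensorProduct.tmul_smul, TensorProduct.smul_tmul', ← smul_add, ← TensorProduct.add_tmul]
    congr 2
    rw [(m h).sum_card_iso_filling k h.out.2 g.out.2 (I h) fun s => ?_, card_iso_comm]
    rw [hI, hgL, h.loopNumber_out]
    have h4 := OnePIClass.mem_upTo.1 hh
    have h5 := hpos h
    omega
  have hsum : ∀ h ∈ OnePIClass.upTo r L, ∑ g ∈ (OnePIClass.finite_loopNumber r L).toFinset,
      (g.symFactor : k)⁻¹ • (∑ s ∈ I h,
        ((s.sym : k)⁻¹ * (Nat.card (Iso s.graph g.out.1) : k)) • s.weight k) =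
      PowerSeries.coeff (L - h.loopNumber.toNat) (h.out.1.dressing k) := by
    intro h hh
    rw [hN]
    simp only [Finset.smul_sum]
    rw [Finset.sum_comm]
    refine Finset.sum_congr rfl fun s hs => ?_
    simp only [smul_smul]
    rw [← Finset.sum_smul]
    congr 1
    have h8 := sum_card_iso_out (k := k) (s.graph_isOnePI h.out.2) (L := L) (by
      rw [s.loopNumber_graph, h.loopNumber_out, (hI h s).1 hs]
      have h4 := OnePIClass.mem_upTo.1 hh
      have h5 := hpos h
      omega)
    refine Eq.trans ?_ ((congrArg ((s.sym : k)⁻¹ * ·) h8).trans (mul_one _))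
    rw [Finset.mul_sum]
    exact Finset.sum_congr rfl fun g _ => by ring
  have h6 : coproduct k (graphSum k r L) = ∑ g ∈ (OnePIClass.finite_loopNumber r L).toFinset,
      (g.symFactor : k)⁻¹ • coproduct k (MvPolynomial.X ⟨r, g⟩) := by
    unfold graphSum
    rw [map_sum]
    exact Finset.sum_congr rfl fun g _ => map_smul _ _ _
  rw [h6, Finset.sum_congr rfl fun g hg => by rw [hgen g hg, smul_add], Finset.sum_add_distrib]
  congr 1
  · unfold graphSum
    rw [TensorProduct.sum_tmul]
    exact Finset.sum_congr rfl fun g _ => (TensorProduct.smul_tmul' _ _ _)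
  · simp only [Finset.smul_sum]
    rw [Finset.sum_comm]
    have h7 : ∀ h ∈ OnePIClass.upTo r L, ∑ g ∈ (OnePIClass.finite_loopNumber r L).toFinset,
        (g.symFactor : k)⁻¹ • (h.symFactor : k)⁻¹ • ((∑ s ∈ I h,
          ((s.sym : k)⁻¹ * (Nat.card (Iso s.graph g.out.1) : k)) • s.weight k) ⊗ₜ[k]
            (MvPolynomial.X ⟨r, h⟩ : GraphAlgebra k)) =
        (h.symFactor : k)⁻¹ • (PowerSeries.coeff (L - h.loopNumber.toNat)
          (h.out.1.dressing k) ⊗ₜ[k] (MvPolynomial.X ⟨r, h⟩ : GraphAlgebra k)) := by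
      intro h hh
      rw [← hsum h hh, TensorProduct.sum_tmul, Finset.smul_sum]
      refine Finset.sum_congr rfl fun g _ => ?_
      rw [smul_comm, TensorProduct.smul_tmul']
    refine (Finset.sum_congr rfl h7).trans ?_
    rw [OnePIClass.sum_upTo]
    refine Finset.sum_congr rfl fun l _ => Finset.sum_congr rfl fun h hh => ?_
    rw [Set.Finite.mem_toFinset] at hh
    rw [show h.loopNumber = l from hh, Int.toNat_natCast]

end GraphAlgebra

/-! ### Power series modulo an ideal and a degree -/

section

variable {A : Type*} [CommRing A]

/-- The power series whose coefficients of degree less than `L` lie in the ideal `J`. -/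
def coeffIdeal (J : Ideal A) (L : ℕ) : Ideal (PowerSeries A) where
  carrier := {f | ∀ n < L, PowerSeries.coeff n f ∈ J}
  zero_mem' n _ := by rw [map_zero]; exact J.zero_mem
  add_mem' hf hg n hn := by rw [map_add]; exact J.add_mem (hf n hn) (hg n hn)
  smul_mem' c f hf n hn := by
    rw [smul_eq_mul, PowerSeries.coeff_mul]
    refine J.sum_mem fun p hp => J.mul_mem_left _ (hf _ ?_)
    have := Finset.HasAntidiagonal.mem_antidiagonal.1 hp
    omega

/-- The substitution of `X * y` for the variable. -/
noncomputable def rescale (y : PowerSeries A) : PowerSeries A →ₐ[A] PowerSeries A :=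
  PowerSeries.substAlgHom (PowerSeries.HasSubst.of_constantCoeff_zero' (a := PowerSeries.X * y)
    (by simp))

lemma coeff_rescale (y f : PowerSeries A) {n N : ℕ} (hn : n < N) :
    PowerSeries.coeff n (rescale y f) = ∑ l ∈ Finset.range N,
      PowerSeries.coeff l f * PowerSeries.coeff n (PowerSeries.X ^ l * y ^ l) := by
  have h : PowerSeries.HasSubst (PowerSeries.X * y) :=
    PowerSeries.HasSubst.of_constantCoeff_zero' (by simp)
  have h1 : rescale y f = PowerSeries.subst (PowerSeries.X * y) f :=
    congrFun (PowerSeries.coe_substAlgHom h) f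
  rw [h1, PowerSeries.coeff_subst' h, finsum_eq_sum_of_support_subset]
  · refine Finset.sum_congr rfl fun l _ => ?_
    rw [mul_pow, smul_eq_mul]
  · intro l hl
    rw [Finset.coe_range, Set.mem_Iio]
    by_contra hlN
    refine hl ?_
    dsimp only
    rw [mul_pow, PowerSeries.coeff_X_pow_mul', if_neg (by omega), smul_zero]

lemma coeff_mul_rescale (u y f : PowerSeries A) (n : ℕ) :
    PowerSeries.coeff n (u * rescale y f) = ∑ l ∈ Finset.range (n + 1),
      PowerSeries.coeff l f * PowerSeries.coeff (n - l) (u * y ^ l) := by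
  have h1 : ∀ p ∈ Finset.HasAntidiagonal.antidiagonal n, PowerSeries.coeff p.1 u *
      PowerSeries.coeff p.2 (rescale y f) = ∑ l ∈ Finset.range (n + 1), PowerSeries.coeff l f *
        (PowerSeries.coeff p.1 u * PowerSeries.coeff p.2 (PowerSeries.X ^ l * y ^ l)) := by
    intro p hp
    have := Finset.HasAntidiagonal.mem_antidiagonal.1 hp
    rw [coeff_rescale y f (show p.2 < n + 1 by omega), Finset.mul_sum]
    exact Finset.sum_congr rfl fun l _ => by ring
  rw [PowerSeries.coeff_mul, Finset.sum_congr rfl h1, Finset.sum_comm]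
  refine Finset.sum_congr rfl fun l hl => ?_
  rw [← Finset.mul_sum, ← PowerSeries.coeff_mul, mul_left_comm, PowerSeries.coeff_X_pow_mul',
    if_pos (Nat.lt_succ_iff.1 (Finset.mem_range.1 hl))]

lemma constantCoeff_rescale (y f : PowerSeries A) :
    PowerSeries.constantCoeff (rescale y f) = PowerSeries.constantCoeff f := by
  rw [← PowerSeries.coeff_zero_eq_constantCoeff_apply, coeff_rescale y f zero_lt_one]
  simp

lemma rescale_mem_coeffIdeal {J : Ideal A} {y f : PowerSeries A}
    (h : ∀ n, PowerSeries.coeff n f ∈ J) (L : ℕ) : rescale y f ∈ coeffIdeal J L := by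
  intro n _
  rw [coeff_rescale y f (Nat.lt_succ_self n)]
  exact J.sum_mem fun l _ => J.mul_mem_right _ (h l)

end

/-! ### Counting the lines of a graph -/

namespace FeynmanGraph

variable {r : Res} {Γ : FeynmanGraph r}

lemma card_darts_type (Γ : FeynmanGraph r) (t : Line) :
    Nat.card {d // Γ.etype (Γ.edge d) = t} = ∑ v, (Γ.vtype v).legs.count t := by
  have e : ((v : Γ.V) × {d // Γ.vert d = v ∧ Γ.etype (Γ.edge d) = t}) ≃
      {d // Γ.etype (Γ.edge d) = t} :=
    ⟨fun x => ⟨x.2.1, x.2.2.2⟩, fun d => ⟨Γ.vert d.1, d.1, rfl, d.2⟩, by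
      rintro ⟨_, d, rfl, h⟩; rfl, fun _ => rfl⟩
  rw [← Nat.card_congr e, Nat.card_sigma]
  exact Finset.sum_congr rfl fun v _ => Γ.vertex_legs v t

/-- Counting the ends of the lines of type `t` in two ways. -/
lemma IsStable.two_mul_card_internal (h : Γ.IsStable) (t : Line) :
    2 * Nat.card {e : Γ.internal // Γ.etype e = t} + r.legs.count t =
      ∑ v, (Γ.vtype v).legs.count t := by
  have h1 : Nat.card {e // Γ.etype e = t} =
      Nat.card {e : Γ.internal // Γ.etype e = t} + r.legs.count t := by
    classical
    rw [← card_get_eq_count r.legs t, ← Nat.card_sum]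
    refine (Nat.card_congr (Equiv.ofBijective (Sum.elim (fun e => ⟨e.1.1, e.2⟩)
      fun j => ⟨Γ.ext j.1, (Γ.ext_type j.1).trans j.2⟩) ⟨?_, ?_⟩)).symm
    · rintro (⟨e, he⟩ | ⟨j, hj⟩) (⟨e', he'⟩ | ⟨j', hj'⟩) hh
      · exact congrArg Sum.inl (Subtype.ext (Subtype.ext (congrArg (fun x : {e // Γ.etype e = t} => x.1) hh)))
      · exact (e.2 ⟨j', (congrArg (fun x : {e // Γ.etype e = t} => x.1) hh).symm⟩).elim
      · exact (e'.2 ⟨j, congrArg (fun x : {e // Γ.etype e = t} => x.1) hh⟩).elim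
      · exact congrArg Sum.inr (Subtype.ext (h.ext_injective (congrArg (fun x : {e // Γ.etype e = t} => x.1) hh)))
    · rintro ⟨e, he⟩
      by_cases hi : e ∈ Γ.internal
      · exact ⟨.inl ⟨⟨e, hi⟩, he⟩, rfl⟩
      · obtain ⟨j, rfl⟩ := not_not.1 hi
        exact ⟨.inr ⟨j, (Γ.ext_type j).symm.trans he⟩, rfl⟩
  have h2 : Nat.card {d // Γ.etype (Γ.edge d) = t} + r.legs.count t =
      2 * Nat.card {e // Γ.etype e = t} := by
    have e : ((e : {e // Γ.etype e = t}) × ({d // Γ.edge d = e.1} ⊕ {j // Γ.ext j = e.1})) ≃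
        {d // Γ.etype (Γ.edge d) = t} ⊕ {j // r.legs.get j = t} :=
      (Equiv.sigmaSumDistrib _ _).trans (Equiv.sumCongr
        ⟨fun x => ⟨x.2.1, (congrArg Γ.etype x.2.2).trans x.1.2⟩,
          fun d => ⟨⟨Γ.edge d.1, d.2⟩, d.1, rfl⟩, by
            rintro ⟨⟨e, he⟩, d, hd⟩
            change Γ.edge d = e at hd
            subst hd
            rfl, fun _ => rfl⟩
        ⟨fun x => ⟨x.2.1, (Γ.ext_type x.2.1).symm.trans ((congrArg Γ.etype x.2.2).trans x.1.2)⟩,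
          fun j => ⟨⟨Γ.ext j.1, (Γ.ext_type j.1).trans j.2⟩, j.1, rfl⟩,
          by
            rintro ⟨⟨e, he⟩, j, hj⟩
            change Γ.ext j = e at hj
            subst hj
            rfl, fun _ => rfl⟩)
    have := Fintype.ofFinite {e // Γ.etype e = t}
    have h3 := Nat.card_congr e
    rw [Nat.card_sigma, Nat.card_sum, card_get_eq_count] at h3
    simp only [Nat.card_sum, Γ.edge_ends, Finset.sum_const, Finset.card_univ, smul_eq_mul] at h3
    rw [← h3, Nat.card_eq_fintype_card, mul_comm]
  rw [← Γ.card_darts_type]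
  omega

lemma sum_comp_eq_card {α β M : Type*} [Fintype α] [Fintype β] [DecidableEq β] [AddCommGroup M]
    (τ : α → β) (f : β → M) :
    ∑ x, f (τ x) = ∑ b, (Nat.card {x // τ x = b} : ℤ) • f b := by
  rw [← Fintype.sum_fiberwise τ]
  refine Finset.sum_congr rfl fun b _ => ?_
  rw [Finset.sum_congr rfl fun x _ => congrArg f x.2, Finset.sum_const, Finset.card_univ,
    natCast_zsmul, Nat.card_eq_fintype_card]

lemma sum_line {M : Type*} [AddCommMonoid M] (f : Line → M) :
    ∑ t, f t = f .quark + (f .ghost + f .gluon) := by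
  rw [show (Finset.univ : Finset Line) = {.quark, .ghost, .gluon} from rfl]
  simp

lemma sum_vertex {M : Type*} [AddCommMonoid M] (f : Vertex → M) :
    ∑ v, f v = f .quarkGluon + (f .ghostGluon + (f .gluon3 + f .gluon4)) := by
  rw [show (Finset.univ : Finset Vertex) = {.quarkGluon, .ghostGluon, .gluon3, .gluon4} from rfl]
  simp

/-- The factors of the vertices and of the internal lines of a graph multiply (here in additive
notation) to the factor of the residue and a power of the coupling, as soon as the factors of all
vertices are given by the same coupling. -/
lemma IsStable.sum_factors {M : Type*} [AddCommGroup M] (h : Γ.IsStable) (w : Res → M)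
    (hq : w (.inl .gluon3) + w (.inl .quarkGluon) = w (.inl .gluon4) + w (.inr .quark))
    (hc : w (.inl .gluon3) + w (.inl .ghostGluon) = w (.inl .gluon4) + w (.inr .ghost))
    (hg : w (.inl .gluon3) + w (.inl .gluon3) = w (.inl .gluon4) + w (.inr .gluon)) :
    ∑ v, w (.inl (Γ.vtype v)) - ∑ e : Γ.internal, w (.inr (Γ.etype e)) =
      w r + Γ.loopNumber • ((2 : ℤ) • w (.inl .gluon3) - (3 : ℤ) • w (.inr .gluon)) := by
  have h4 : w (.inl .gluon4) = w (.inl .gluon3) + w (.inl .gluon3) - w (.inr .gluon) :=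
    eq_sub_of_add_eq hg.symm
  have h3q : w (.inl .quarkGluon) = w (.inl .gluon3) - w (.inr .gluon) + w (.inr .quark) := by
    rw [h4] at hq
    rw [← sub_eq_zero] at hq ⊢
    rw [← hq]
    abel
  have h3c : w (.inl .ghostGluon) = w (.inl .gluon3) - w (.inr .gluon) + w (.inr .ghost) := by
    rw [h4] at hc
    rw [← sub_eq_zero] at hc ⊢
    rw [← hc]
    abel
  have hV : (Nat.card Γ.V : ℤ) = ∑ _v : Γ.V, (1 : ℤ) := by
    simp [Nat.card_eq_fintype_card]
  have hE : (Nat.card Γ.internal : ℤ) = ∑ _e : Γ.internal, (1 : ℤ) := by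
    simp [Nat.card_eq_fintype_card]
  have hlines := h.two_mul_card_internal
  unfold loopNumber
  rw [hV, hE]
  rw [sum_comp_eq_card (fun e : Γ.internal => Γ.etype e) fun t => w (.inr t),
    sum_comp_eq_card Γ.vtype fun v => w (.inl v),
    sum_comp_eq_card (fun e : Γ.internal => Γ.etype e) fun _ => (1 : ℤ),
    sum_comp_eq_card Γ.vtype fun _ => (1 : ℤ)]
  have hl : ∀ t, 2 * (Nat.card {e : Γ.internal // Γ.etype e = t} : ℤ) + (r.legs.count t : ℤ) =
      ∑ v, (Nat.card {x // Γ.vtype x = v} : ℤ) • (v.legs.count t : ℤ) := by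
    intro t
    rw [← sum_comp_eq_card Γ.vtype fun v => (v.legs.count t : ℤ)]
    exact_mod_cast hlines t
  have hlq := hl .quark
  have hlc := hl .ghost
  have hlg := hl .gluon
  simp only [sum_vertex, sum_line, smul_eq_mul] at hlq hlc hlg ⊢
  generalize (Nat.card {e : Γ.internal // Γ.etype e = .quark} : ℤ) = nq at *
  generalize (Nat.card {e : Γ.internal // Γ.etype e = .ghost} : ℤ) = nc at *
  generalize (Nat.card {e : Γ.internal // Γ.etype e = .gluon} : ℤ) = ng at *
  generalize (Nat.card {x // Γ.vtype x = .quarkGluon} : ℤ) = mq at *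
  generalize (Nat.card {x // Γ.vtype x = .ghostGluon} : ℤ) = mc at *
  generalize (Nat.card {x // Γ.vtype x = .gluon3} : ℤ) = m3 at *
  generalize (Nat.card {x // Γ.vtype x = .gluon4} : ℤ) = m4 at *
  rcases r with (_ | _ | _ | _) | (_ | _ | _) <;>
    simp [Vertex.legs, Res.legs] at hlq hlc hlg <;>
    simp only [h3q, h3c, h4] <;> match_scalars <;> linarith

end FeynmanGraph

/-! ### The Slavnov–Taylor ideal -/

namespace GraphAlgebra

variable (k : Type*) [Field k]

/-- The Green's functions are invertible power series. -/
noncomputable def greenUnit (r : Res) : (PowerSeries (GraphAlgebra k))ˣ where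
  val := green k r
  inv := PowerSeries.invOfUnit (green k r) 1
  val_inv := PowerSeries.mul_invOfUnit _ _ (constantCoeff_green k r)
  inv_val := (mul_comm _ _).trans (PowerSeries.mul_invOfUnit _ _ (constantCoeff_green k r))

/-- The square `(G^{3g})² / (G^{gluon})³` of the coupling of the three-gluon vertex. -/
noncomputable def couplingSq : PowerSeries (GraphAlgebra k) :=
  green k (.inl .gluon3) ^ 2 * propagator k .gluon ^ 3

variable {k}

/-- Where the Slavnov–Taylor identities hold, the dressing of a graph depends only on its residue
and its loop number. -/
lemma map_dressing {C : Type*} [CommRing C] (ρ : PowerSeries (GraphAlgebra k) →+* C)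
    (h₁ : ρ (ST₁ k) = 0) (h₂ : ρ (ST₂ k) = 0) (h₃ : ρ (ST₃ k) = 0) {r : Res} {Γ : FeynmanGraph r}
    (hΓ : Γ.IsStable) {l : ℕ} (hl : Γ.loopNumber = l) :
    ρ (Γ.dressing k) = ρ (green k r * couplingSq k ^ l) := by
  let u : Res → Cˣ := fun r => Units.map (ρ : PowerSeries (GraphAlgebra k) →* C) (greenUnit k r)
  have hu : ∀ a b c d : Res, ρ (green k a * green k b - green k c * green k d) = 0 →
      Additive.ofMul (u a) + Additive.ofMul (u b) = Additive.ofMul (u c) + Additive.ofMul (u d) := by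
    intro a b c d h
    rw [map_sub, sub_eq_zero, map_mul, map_mul] at h
    exact congrArg Additive.ofMul (Units.ext h)
  have h1 := hΓ.sum_factors (fun r => Additive.ofMul (u r)) (hu _ _ _ _ h₁) (hu _ _ _ _ h₂)
    (hu _ _ _ _ h₃)
  have h2 : (∏ v, u (.inl (Γ.vtype v))) * ∏ e : Γ.internal, (u (.inr (Γ.etype e)))⁻¹ =
      u r * (u (.inl .gluon3) ^ 2 * (u (.inr .gluon))⁻¹ ^ 3) ^ l := by
    apply Additive.ofMul.injective
    rw [hl] at h1
    simp only [ofMul_mul, ofMul_prod, ofMul_pow, ofMul_inv, Finset.sum_neg_distrib]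
    rw [← sub_eq_add_neg, h1]
    module
  have h3 := congrArg Units.val h2
  simp only [Units.val_mul, Units.coe_prod, Units.val_pow_eq_pow_val] at h3
  unfold dressing couplingSq
  rw [map_mul, map_prod, map_prod, map_mul, map_pow, map_mul, map_pow, map_pow]
  exact h3

variable (k)

/-- The ideal generated by the coefficients of degree less than `L` of the Slavnov–Taylor
elements. -/
noncomputable def stIdealBelow (L : ℕ) : Ideal (GraphAlgebra k) :=
  Ideal.span {x | ∃ n < L, x = PowerSeries.coeff n (ST₁ k) ∨ x = PowerSeries.coeff n (ST₂ k) ∨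
    x = PowerSeries.coeff n (ST₃ k)}

variable {k}

lemma coeff_dressing_sub_mem {r : Res} {Γ : FeynmanGraph r} (hΓ : Γ.IsStable) {l : ℕ}
    (hl : Γ.loopNumber = l) {n L : ℕ} (hn : n < L) :
    PowerSeries.coeff n (Γ.dressing k) - PowerSeries.coeff n (green k r * couplingSq k ^ l) ∈
      stIdealBelow k L := by
  have h := map_dressing (Ideal.Quotient.mk (coeffIdeal (stIdealBelow k L) L))
    (Ideal.Quotient.eq_zero_iff_mem.2 fun n hn => Ideal.subset_span ⟨n, hn, .inl rfl⟩)
    (Ideal.Quotient.eq_zero_iff_mem.2 fun n hn => Ideal.subset_span ⟨n, hn, .inr (.inl rfl)⟩)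
    (Ideal.Quotient.eq_zero_iff_mem.2 fun n hn => Ideal.subset_span ⟨n, hn, .inr (.inr rfl)⟩) hΓ hl
  rw [Ideal.Quotient.mk_eq_mk_iff_sub_mem] at h
  rw [← map_sub]
  exact h n hn

variable (k) in
/-- The inclusion `x ↦ x ⊗ 1`. -/
noncomputable abbrev inl : GraphAlgebra k →ₐ[k] GraphAlgebra k ⊗[k] GraphAlgebra k :=
  Algebra.TensorProduct.includeLeft

variable (k) in
/-- The inclusion `x ↦ 1 ⊗ x`. -/
noncomputable abbrev inr : GraphAlgebra k →ₐ[k] GraphAlgebra k ⊗[k] GraphAlgebra k :=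
  Algebra.TensorProduct.includeRight

lemma tmul_eq (x y : GraphAlgebra k) : x ⊗ₜ[k] y = inl k x * inr k y := by
  rw [Algebra.TensorProduct.includeLeft_apply, Algebra.TensorProduct.includeRight_apply,
    Algebra.TensorProduct.tmul_mul_tmul, mul_one, one_mul]

/-- Modulo the Slavnov–Taylor elements of lower degree on the left, the coproduct of a Green's
function is given by substituting the coupling for the loop-counting variable. -/
lemma coproduct_green [CharZero k] (r : Res) (L : ℕ) :
    PowerSeries.map (coproduct k : GraphAlgebra k →+* _) (green k r) -
      PowerSeries.map (inl k : GraphAlgebra k →+* _) (green k r) *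
        rescale (PowerSeries.map (inl k : GraphAlgebra k →+* _) (couplingSq k))
          (PowerSeries.map (inr k : GraphAlgebra k →+* _) (green k r)) ∈
      coeffIdeal ((stIdealBelow k L).map (inl k)) (L + 1) := by
  obtain ⟨σ, hσ⟩ : ∃ σ : k, ∀ n, n ≠ 0 → PowerSeries.coeff n (green k r) = σ • graphSum k r n := by
    rcases r with v | e
    · exact ⟨1, fun n hn => by simp [green, PowerSeries.coeff_one, hn]⟩
    · exact ⟨-1, fun n hn => by simp [green, PowerSeries.coeff_one, hn]⟩
  have h0 : PowerSeries.coeff 0 (green k r) = 1 := by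
    rw [PowerSeries.coeff_zero_eq_constantCoeff_apply, constantCoeff_green]
  intro n hn
  rw [map_sub, coeff_mul_rescale, PowerSeries.coeff_map]
  by_cases hn0 : n = 0
  · subst hn0
    rw [Finset.sum_range_one, PowerSeries.coeff_map, h0, pow_zero, mul_one, PowerSeries.coeff_map,
      h0]
    simp only [map_one, mul_one, sub_self]
    exact Ideal.zero_mem _
  · have h1 : coproduct k (PowerSeries.coeff n (green k r)) =
        inl k (PowerSeries.coeff n (green k r)) + ∑ l ∈ Finset.range n,
          ∑ h ∈ (OnePIClass.finite_loopNumber r (l + 1)).toFinset, (σ * (h.symFactor : k)⁻¹) •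
            (inl k (PowerSeries.coeff (n - (l + 1)) (h.out.1.dressing k)) *
              inr k (MvPolynomial.X ⟨r, h⟩)) := by
      have h2 : (OnePIClass.finite_loopNumber r 0).toFinset = ∅ := by
        refine Finset.eq_empty_of_forall_notMem fun h hh => ?_
        rw [Set.Finite.mem_toFinset] at hh
        have h1 := h.out.2.one_le_loopNumber
        rw [h.loopNumber_out, show h.loopNumber = ((0 : ℕ) : ℤ) from hh] at h1
        exact absurd h1 (by norm_num)
      rw [hσ n hn0, map_smul, coproduct_graphSum, Finset.sum_range_succ', h2, Finset.sum_empty,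
        add_zero, smul_add, map_smul]
      congr 1
      rw [Finset.smul_sum]
      refine Finset.sum_congr rfl fun l _ => ?_
      rw [Finset.smul_sum]
      refine Finset.sum_congr rfl fun h _ => ?_
      rw [smul_smul, tmul_eq]
    have h2 : ∀ l, PowerSeries.coeff (l + 1) (green k r) =
        ∑ h ∈ (OnePIClass.finite_loopNumber r (l + 1)).toFinset, (σ * (h.symFactor : k)⁻¹) •
          (MvPolynomial.X ⟨r, h⟩ : GraphAlgebra k) := by
      intro l
      rw [hσ _ (Nat.succ_ne_zero l), graphSum, Finset.smul_sum]
      exact Finset.sum_congr rfl fun h _ => smul_smul _ _ _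
    rw [Finset.sum_range_succ', RingHom.coe_coe, h1, PowerSeries.coeff_map, h0, pow_zero, mul_one,
      Nat.sub_zero, PowerSeries.coeff_map, RingHom.coe_coe, RingHom.coe_coe, map_one, one_mul,
      add_comm (inl k _), add_sub_add_right_eq_sub, ← Finset.sum_sub_distrib]
    refine Ideal.sum_mem _ fun l hl => ?_
    rw [← map_pow, ← map_mul, PowerSeries.coeff_map, PowerSeries.coeff_map, RingHom.coe_coe,
      RingHom.coe_coe, h2, map_sum, Finset.sum_mul, ← Finset.sum_sub_distrib]
    refine Ideal.sum_mem _ fun h hh => ?_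
    rw [Set.Finite.mem_toFinset] at hh
    have h3 := coeff_dressing_sub_mem (k := k) h.out.2.isStable (l := l + 1)
      (h.loopNumber_out.trans hh) (n := n - (l + 1)) (L := L) (by omega)
    have h4 := Ideal.mul_mem_right (inr k ((σ * (h.symFactor : k)⁻¹) • MvPolynomial.X ⟨r, h⟩)) _
      (Ideal.mem_map_of_mem (inl k) h3)
    refine (Eq.mp (congrArg (· ∈ _) ?_) h4)
    rw [map_smul, map_sub, sub_mul, mul_smul_comm]
    congr 1
    exact mul_comm _ _

/-- The coproduct of a Slavnov–Taylor element. One uses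
`xy - zw = (x - z) y + z (y - w)`, where `x`, `z` are the products on the left and `y`, `w` the
substituted products on the right. -/
lemma coproduct_coeff_sub_mem [CharZero k] {a b c d : Res} {f : PowerSeries (GraphAlgebra k)}
    (hf : f = green k a * green k b - green k c * green k d)
    (hI : ∀ n, PowerSeries.coeff n f ∈ stIdeal k) {L : ℕ}
    (hL : ∀ n < L, PowerSeries.coeff n f ∈ stIdealBelow k L) :
    coproduct k (PowerSeries.coeff L f) - inl k (PowerSeries.coeff L f) ∈
      (stIdealBelow k L).map (inl k) ⊔ (stIdeal k).map (inr k) := by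
  set T := (stIdealBelow k L).map (inl k) ⊔ (stIdeal k).map (inr k) with hT
  let ρ := Ideal.Quotient.mk (coeffIdeal T (L + 1))
  let Δ := PowerSeries.map
    (coproduct k : GraphAlgebra k →+* GraphAlgebra k ⊗[k] GraphAlgebra k)
  let ι₁ := PowerSeries.map (inl k : GraphAlgebra k →+* GraphAlgebra k ⊗[k] GraphAlgebra k)
  let ι₂ := PowerSeries.map (inr k : GraphAlgebra k →+* GraphAlgebra k ⊗[k] GraphAlgebra k)
  let θ := rescale (ι₁ (couplingSq k))
  have h1 : ∀ r, ρ (Δ (green k r)) = ρ (ι₁ (green k r)) * ρ (θ (ι₂ (green k r))) := by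
    intro r
    rw [← map_mul, Ideal.Quotient.mk_eq_mk_iff_sub_mem]
    exact fun n hn => (le_sup_left : _ ≤ T) (coproduct_green r L n hn)
  have h2 : ρ (θ (ι₂ f)) = 0 := by
    refine Ideal.Quotient.eq_zero_iff_mem.2 (rescale_mem_coeffIdeal (fun n => ?_) _)
    rw [PowerSeries.coeff_map]
    exact (le_sup_right : _ ≤ T) (Ideal.mem_map_of_mem (inr k) (hI n))
  have h3 : ρ (Δ f) = ρ (ι₁ f * θ (ι₂ (green k a * green k b))) := by
    have h4 : ρ (Δ f) = ρ (ι₁ f * θ (ι₂ (green k a * green k b))) +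
        ρ (ι₁ (green k c * green k d)) * ρ (θ (ι₂ f)) := by
      rw [hf]
      simp only [map_sub, map_mul, h1]
      ring
    linear_combination h4 + ρ (ι₁ (green k c * green k d)) * h2
  have h5 := Ideal.Quotient.mk_eq_mk_iff_sub_mem _ _ |>.1 h3 L (Nat.lt_succ_self L)
  have h6 : PowerSeries.coeff L (ι₁ f * θ (ι₂ (green k a * green k b))) -
      inl k (PowerSeries.coeff L f) ∈ T := by
    have h7 : PowerSeries.coeff 0 (θ (ι₂ (green k a * green k b))) = 1 := by
      rw [PowerSeries.coeff_zero_eq_constantCoeff_apply, constantCoeff_rescale,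
        ← PowerSeries.coeff_zero_eq_constantCoeff_apply, PowerSeries.coeff_map,
        PowerSeries.coeff_zero_eq_constantCoeff_apply, map_mul, constantCoeff_green,
        constantCoeff_green, mul_one, map_one]
    rw [PowerSeries.coeff_mul, Finset.Nat.sum_antidiagonal_eq_sum_range_succ_mk,
      Finset.sum_range_succ, Nat.sub_self, h7, mul_one, PowerSeries.coeff_map, RingHom.coe_coe,
      add_sub_cancel_right]
    refine Ideal.sum_mem _ fun n hn => Ideal.mul_mem_right _ _ ?_
    rw [PowerSeries.coeff_map]
    exact (le_sup_left : _ ≤ T)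
      (Ideal.mem_map_of_mem (inl k) (hL n (Finset.mem_range.1 hn)))
  have h8 := T.add_mem h5 h6
  rw [map_sub, sub_add_sub_cancel] at h8
  exact h8

/-- The coproduct of a generator `x` of the ideal of degree `L` is `x ⊗ 1`, up to terms with a
generator of lower degree on the left or an element of the ideal on the right. -/
lemma coproduct_sub_mem [CharZero k] {x : GraphAlgebra k} {L : ℕ}
    (hx : x = PowerSeries.coeff L (ST₁ k) ∨ x = PowerSeries.coeff L (ST₂ k) ∨
      x = PowerSeries.coeff L (ST₃ k)) :
    coproduct k x - inl k x ∈ (stIdealBelow k L).map (inl k) ⊔ (stIdeal k).map (inr k) := by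
  rcases hx with rfl | rfl | rfl
  · exact coproduct_coeff_sub_mem rfl (fun n => Ideal.subset_span ⟨n, .inl rfl⟩)
      fun n hn => Ideal.subset_span ⟨n, hn, .inl rfl⟩
  · exact coproduct_coeff_sub_mem rfl (fun n => Ideal.subset_span ⟨n, .inr (.inl rfl)⟩)
      fun n hn => Ideal.subset_span ⟨n, hn, .inr (.inl rfl)⟩
  · exact coproduct_coeff_sub_mem rfl (fun n => Ideal.subset_span ⟨n, .inr (.inr rfl)⟩)
      fun n hn => Ideal.subset_span ⟨n, hn, .inr (.inr rfl)⟩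

lemma mul_mem_tensorSum {I : Ideal (GraphAlgebra k)} {z : GraphAlgebra k ⊗[k] GraphAlgebra k}
    (hz : z ∈ tensorSum k I) (t : GraphAlgebra k ⊗[k] GraphAlgebra k) : t * z ∈ tensorSum k I := by
  induction t with
  | zero => rw [zero_mul]; exact zero_mem _
  | add t t' ht ht' => rw [add_mul]; exact add_mem ht ht'
  | tmul p q =>
    unfold tensorSum at hz ⊢
    induction hz using Submodule.span_induction with
    | mem z hz =>
      obtain ⟨x, hx, y, rfl | rfl⟩ := hz
      · rw [Algebra.TensorProduct.tmul_mul_tmul]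
        exact Submodule.subset_span ⟨_, I.mul_mem_left p hx, _, .inl rfl⟩
      · rw [Algebra.TensorProduct.tmul_mul_tmul]
        exact Submodule.subset_span ⟨_, I.mul_mem_left q hx, _, .inr rfl⟩
    | zero => rw [mul_zero]; exact zero_mem _
    | add z z' _ _ h h' => rw [mul_add]; exact add_mem h h'
    | smul c z _ h => rw [mul_smul_comm]; exact Submodule.smul_mem _ c h

lemma mem_tensorSum {I : Ideal (GraphAlgebra k)} {z : GraphAlgebra k ⊗[k] GraphAlgebra k}
    (hz : z ∈ I.map (inl k) ⊔ I.map (inr k)) : z ∈ tensorSum k I := by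
  rw [Ideal.map, Ideal.map, ← Ideal.span_union] at hz
  induction hz using Submodule.span_induction with
  | mem z hz =>
    rcases hz with ⟨x, hx, rfl⟩ | ⟨x, hx, rfl⟩
    · exact Submodule.subset_span ⟨x, hx, 1, .inl rfl⟩
    · exact Submodule.subset_span ⟨x, hx, 1, .inr rfl⟩
  | zero => exact zero_mem _
  | add z z' _ _ h h' => exact add_mem h h'
  | smul t z _ h => exact mul_mem_tensorSum h t

lemma stIdealBelow_le (L : ℕ) : stIdealBelow k L ≤ stIdeal k :=
  Ideal.span_mono fun _ ⟨n, _, h⟩ => ⟨n, h⟩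

/-! ### The Hopf ideal -/

theorem coproduct_mem_tensorSum [CharZero k] {x : GraphAlgebra k} (hx : x ∈ stIdeal k) :
    coproduct k x ∈ tensorSum k (stIdeal k) := by
  refine mem_tensorSum ?_
  suffices h : stIdeal k ≤
      ((stIdeal k).map (inl k) ⊔ (stIdeal k).map (inr k)).comap (coproduct k) from h hx
  refine Ideal.span_le.2 fun x hx => ?_
  have hxI : x ∈ stIdeal k := Ideal.subset_span hx
  obtain ⟨L, hL⟩ := hx
  have h1 := coproduct_sub_mem hL
  have h2 := sup_le_sup_right (Ideal.map_mono (f := inl k) (stIdealBelow_le L))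
    ((stIdeal k).map (inr k)) h1
  have h3 := Ideal.add_mem _ h2
    ((le_sup_left : _ ≤ (stIdeal k).map (inl k) ⊔ (stIdeal k).map (inr k))
      (Ideal.mem_map_of_mem (inl k) hxI))
  rw [sub_add_cancel] at h3
  exact h3

lemma map_counit_green (r : Res) :
    PowerSeries.map (counit k : GraphAlgebra k →+* k) (green k r) = 1 := by
  have h : ∀ L, counit k (graphSum k r L) = 0 := fun L => by
    unfold graphSum
    rw [map_sum]
    refine Finset.sum_eq_zero fun g _ => ?_
    rw [map_smul, counit, MvPolynomial.aeval_X, smul_zero]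
  have h1 : PowerSeries.map (counit k : GraphAlgebra k →+* k) (PowerSeries.mk (graphSum k r)) =
      0 := by
    ext n
    rw [PowerSeries.coeff_map, PowerSeries.coeff_mk, map_zero]
    exact h n
  rcases r with v | e
  · rw [green, map_add, map_one, h1, add_zero]
  · rw [green, map_sub, map_one, h1, sub_zero]

theorem counit_eq_zero {x : GraphAlgebra k} (hx : x ∈ stIdeal k) : counit k x = 0 := by
  suffices h : stIdeal k ≤ RingHom.ker (counit k) from h hx
  refine Ideal.span_le.2 fun x ⟨L, hL⟩ => ?_
  have h : ∀ a b c d : Res, counit k (PowerSeries.coeff L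
      (green k a * green k b - green k c * green k d)) = 0 := by
    intro a b c d
    have h1 := PowerSeries.coeff_map (counit k : GraphAlgebra k →+* k) L
      (green k a * green k b - green k c * green k d)
    rw [map_sub, map_mul, map_mul] at h1
    simp only [map_counit_green, mul_one, sub_self, map_zero] at h1
    exact h1.symm
  rcases hL with rfl | rfl | rfl
  · exact h _ _ _ _
  · exact h _ _ _ _
  · exact h _ _ _ _

/-- The antipode is a left convolution inverse of the identity. -/
lemma productMap_antipode_coproduct (x : GraphAlgebra k) :
    Algebra.TensorProduct.productMap (antipode k) (AlgHom.id k _) (coproduct k x) =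
      algebraMap k _ (counit k x) := by
  have h : (Algebra.TensorProduct.productMap (antipode k) (AlgHom.id k _)).comp (coproduct k) =
      (Algebra.ofId k (GraphAlgebra k)).comp (counit k) := by
    refine MvPolynomial.algHom_ext fun g => ?_
    have := Fintype.ofFinite g.2.out.1.ProperSubgraph
    rw [AlgHom.comp_apply, AlgHom.comp_apply, counit, MvPolynomial.aeval_X, map_zero, coproduct,
      MvPolynomial.aeval_X, finsum_eq_sum_of_fintype, map_add, map_add, map_sum]
    simp only [Algebra.TensorProduct.productMap_apply_tmul, map_one, mul_one, one_mul,
      AlgHom.id_apply]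
    rw [antipode_X, finsum_eq_sum_of_fintype]
    ring
  exact DFunLike.congr_fun h x

theorem antipode_mem [CharZero k] {x : GraphAlgebra k} (hx : x ∈ stIdeal k) :
    antipode k x ∈ stIdeal k := by
  let μ := Algebra.TensorProduct.productMap (antipode k) (AlgHom.id k (GraphAlgebra k))
  have hgen : ∀ (L : ℕ) (x : GraphAlgebra k), (x = PowerSeries.coeff L (ST₁ k) ∨
      x = PowerSeries.coeff L (ST₂ k) ∨ x = PowerSeries.coeff L (ST₃ k)) →
      antipode k x ∈ stIdeal k := by
    intro L
    induction L using Nat.strong_induction_on with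
    | _ L ih =>
      intro x hx
      have h1 : stIdealBelow k L ≤ (stIdeal k).comap (antipode k) :=
        Ideal.span_le.2 fun y ⟨n, hn, hy⟩ => ih n hn y hy
      have h2 : (stIdealBelow k L).map (inl k) ⊔ (stIdeal k).map (inr k) ≤
          (stIdeal k).comap μ := by
        refine sup_le (Ideal.map_le_iff_le_comap.2 fun y hy => ?_)
          (Ideal.map_le_iff_le_comap.2 fun y hy => ?_)
        · change μ (y ⊗ₜ 1) ∈ stIdeal k
          rw [Algebra.TensorProduct.productMap_apply_tmul, map_one, mul_one]
          exact h1 hy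
        · change μ (1 ⊗ₜ y) ∈ stIdeal k
          rw [Algebra.TensorProduct.productMap_apply_tmul, map_one, one_mul]
          exact hy
      -- `μ (Δ x) = ε(x) = 0`, so that `S(x) = μ (x ⊗ 1)` lies in the ideal
      have h3 : μ (coproduct k x - inl k x) ∈ stIdeal k := h2 (coproduct_sub_mem hx)
      have h4 : μ (inl k x) = antipode k x := by
        rw [Algebra.TensorProduct.includeLeft_apply,
          Algebra.TensorProduct.productMap_apply_tmul, map_one, mul_one]
      rw [map_sub, productMap_antipode_coproduct, counit_eq_zero (Ideal.subset_span ⟨L, hx⟩),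
        map_zero, zero_sub, h4] at h3
      exact neg_mem_iff.1 h3
  suffices h : stIdeal k ≤ (stIdeal k).comap (antipode k) from h hx
  exact Ideal.span_le.2 fun x ⟨L, hL⟩ => hgen L x hL

end GraphAlgebra

end QCD

theorem mainTheorem1 (k : Type*) [Field k] [CharZero k] :
    (∀ x ∈ QCD.GraphAlgebra.stIdeal k,
      QCD.GraphAlgebra.coproduct k x ∈
        QCD.GraphAlgebra.tensorSum k (QCD.GraphAlgebra.stIdeal k)) ∧
    (∀ x ∈ QCD.GraphAlgebra.stIdeal k, QCD.GraphAlgebra.counit k x = 0) ∧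
    (∀ x ∈ QCD.GraphAlgebra.stIdeal k,
      QCD.GraphAlgebra.antipode k x ∈ QCD.GraphAlgebra.stIdeal k) :=
  ⟨fun _ => QCD.GraphAlgebra.coproduct_mem_tensorSum, fun _ => QCD.GraphAlgebra.counit_eq_zero,
    fun _ => QCD.GraphAlgebra.antipode_mem⟩
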